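/- **Definitions.** $\lambda$ is Lebesgue measure on $\mathbb R$; $\emptyset'$ is the halting problem. A *rational interval* is an open interval $(a,b)$ with $a,b\in\mathbb Q$ (empty if $b\le a$). A *Cauchy name* of a real $x$ is a sequence of rationals $q_n\to x$ with $|q_k-q_n|\le 2^{-n}$ for all $k\ge n$. An *interval sequence test* consists of a computable family of rational intervals $(Q^m_r(k))_{m,r,k\ge 1}$ and a uniformly c.e. family of finite sets $(E^m_r)_{m,r\ge 1}$ of positive integers such that for all $m,r\ge1$ $$\lambda\Bigl(\bigcup\{Q^m_r(k): k\notin E^m_r\}\Bigr)\le 2^{-(m+r)}.$$ A real $z$ *fails* it if for every $m\ge1$ there are $r\ge 1$ and $k\ge1$ with $k\notin E^m_r$ and $z\in Q^m_r(k)$; otherwise $z$ *passes* it. An index of such a test is a pair of indices, of a partial computable function giving the $Q^m_r(k)$ and of a c.e. set giving the $E^m_r$. A *Schnorr test relative to $\emptyset'$* is a sequence $(G_m)_{m\in\mathbb N}$ of open sets, $G_m$ being the union of a set of rational intervals that is c.e. relative to $\emptyset'$ uniformly in $m$, such that $\lambda(G_m)\le 2^{-m}$ for every $m$ and a Cauchy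 name of $\lambda(G_m)$ is computable from $\emptyset'$ uniformly in $m$. A real $z$ *fails* it if $z\in\bigcap_m G_m$. An index of such a test is a pair of indices of oracle programs, one enumerating with oracle $\emptyset'$ the intervals of the $G_m$ and one computing with oracle $\emptyset'$ Cauchy names of the $\lambda(G_m)$. A *pseudo-number* is a $\Delta^0_2$ real, i.e. a real with a Cauchy name computable from $\emptyset'$. **Proposition.** Interval sequence tests are uniformly equivalent to Schnorr tests relative to $\emptyset'$: 1. there is a computable function taking each index of an interval sequence test to an index of a Schnorr test relative to $\emptyset'$ that is failed by exactly the same reals; 2. there is a computable function taking each index of a Schnorr test relative to $\emptyset'$ to an index of an interval sequence test that is failed by exactly the same reals. Moreover: 3. for every property $P$ of reals the following are equivalent: * ($P$ holds for almost every pseudo-number.) There is an interval sequence test such that $P$ holds for every pseudo-number passing it. * (The relativization to $\emptyset'$ of "$P$ holds for almost every computable real".) There is a $\emptyset'$-computable double sequence $(H_{n,i})_{n,i\in\mathbb N}$ of closed intervals $[a,b]$, $a\le b$, with rational endpoints such that for each $n$ the intervals $H_{n,i}$, $i\in\mathbb N$, are non-overlapping (their interiors are pairwise disjoint), $\sum_i|H_{n,i}|$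 converges to a real that is at most $2^{-n}$ and has a Cauchy name computable from $\emptyset'$ uniformly in $n$, and $P(x)$ holds for every real $x$ computable from $\emptyset'$ that is outside $\bigcup_i H_{n,i}$ for some $n$. -/

import Mathlib

open Filter Topology MeasureTheory
open scoped ENNReal

/-! ### Oracle computability with indices -/

/-- Programs with access to an oracle. Same closure operations as `Nat.RecursiveIn`. -/
inductive OracleCode : Type
  | zero : OracleCode
  | succ : OracleCode
  | left : OracleCode
  | right : OracleCode
  | oracle : OracleCode
  | pair : OracleCode → OracleCode → OracleCode
  | comp : OracleCode → OracleCode → OracleCode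
  | prec : OracleCode → OracleCode → OracleCode
  | rfind : OracleCode → OracleCode

namespace OracleCode

/-- The partial function computed by an oracle program when the oracle is `g`. -/
def eval (g : ℕ →. ℕ) : OracleCode → ℕ →. ℕ
  | zero => fun _ => 0
  | succ => Nat.succ
  | left => fun n => (Nat.unpair n).1
  | right => fun n => (Nat.unpair n).2
  | oracle => g
  | pair cf ch => fun n => Nat.pair <$> eval g cf n <*> eval g ch n
  | comp cf ch => fun n => eval g ch n >>= eval g cf
  | prec cf ch => fun p =>
      let (a, n) := Nat.unpair p
      n.rec (eval g cf a) fun y IH => do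
        let i ← IH
        eval g ch (Nat.pair a (Nat.pair y i))
  | rfind cf => fun a =>
      Nat.rfind fun n => (fun m => m = 0) <$> eval g cf (Nat.pair a n)

/-- The functions computed by oracle programs are exactly the functions that Mathlib calls
recursive in the oracle. -/
theorem exists_code {g f : ℕ →. ℕ} : Nat.RecursiveIn {g} f ↔ ∃ c : OracleCode, c.eval g = f := by
  constructor
  · intro h
    induction h with
    | zero => exact ⟨zero, rfl⟩
    | succ => exact ⟨succ, rfl⟩
    | left => exact ⟨left, rfl⟩
    | right => exact ⟨right, rfl⟩
    | oracle f hf => exact ⟨oracle, (Set.mem_singleton_iff.1 hf).symm⟩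
    | pair _ _ h₁ h₂ =>
      obtain ⟨c, rfl⟩ := h₁
      obtain ⟨d, rfl⟩ := h₂
      exact ⟨pair c d, rfl⟩
    | comp _ _ h₁ h₂ =>
      obtain ⟨c, rfl⟩ := h₁
      obtain ⟨d, rfl⟩ := h₂
      exact ⟨comp c d, rfl⟩
    | prec _ _ h₁ h₂ =>
      obtain ⟨c, rfl⟩ := h₁
      obtain ⟨d, rfl⟩ := h₂
      exact ⟨prec c d, rfl⟩
    | rfind _ h₁ =>
      obtain ⟨c, rfl⟩ := h₁
      exact ⟨rfind c, rfl⟩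
  · rintro ⟨c, rfl⟩
    induction c with
    | zero => exact .zero
    | succ => exact .succ
    | left => exact .left
    | right => exact .right
    | oracle => exact .oracle g rfl
    | pair _ _ h₁ h₂ => exact .pair h₁ h₂
    | comp _ _ h₁ h₂ => exact .comp h₁ h₂
    | prec _ _ h₁ h₂ => exact .prec h₁ h₂
    | rfind _ h₁ => exact .rfind h₁

/-- Gödel numbering of oracle programs. -/
def encodeCode : OracleCode → ℕ
  | zero => 0
  | succ => 1
  | left => 2
  | right => 3
  | oracle => 4
  | pair cf ch => 4 * Nat.pair (encodeCode cf) (encodeCode ch) + 5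
  | comp cf ch => 4 * Nat.pair (encodeCode cf) (encodeCode ch) + 6
  | prec cf ch => 4 * Nat.pair (encodeCode cf) (encodeCode ch) + 7
  | rfind cf => 4 * encodeCode cf + 8

/-- The inverse of the Gödel numbering. -/
def ofNatCode : ℕ → OracleCode
  | 0 => zero
  | 1 => succ
  | 2 => left
  | 3 => right
  | 4 => oracle
  | n + 5 =>
    have hm : n / 4 < n + 5 := by omega
    have _m1 : (n / 4).unpair.1 < n + 5 := lt_of_le_of_lt (n / 4).unpair_left_le hm
    have _m2 : (n / 4).unpair.2 < n + 5 := lt_of_le_of_lt (n / 4).unpair_right_le hm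
    if n % 4 = 0 then pair (ofNatCode (n / 4).unpair.1) (ofNatCode (n / 4).unpair.2)
    else if n % 4 = 1 then comp (ofNatCode (n / 4).unpair.1) (ofNatCode (n / 4).unpair.2)
    else if n % 4 = 2 then prec (ofNatCode (n / 4).unpair.1) (ofNatCode (n / 4).unpair.2)
    else rfind (ofNatCode (n / 4))

theorem ofNatCode_encodeCode (c : OracleCode) : ofNatCode (encodeCode c) = c := by
  induction c with
  | zero | succ | left | right | oracle => simp [encodeCode, ofNatCode]
  | pair c d hc hd =>
    rw [encodeCode, ofNatCode]
    simp [hc, hd]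
  | comp c d hc hd =>
    rw [encodeCode, ofNatCode]
    have h1 : (4 * Nat.pair c.encodeCode d.encodeCode + 1) / 4
      = Nat.pair c.encodeCode d.encodeCode := by omega
    have h2 : (4 * Nat.pair c.encodeCode d.encodeCode + 1) % 4 = 1 := by omega
    simp [h1, h2, hc, hd]
  | prec c d hc hd =>
    rw [encodeCode, ofNatCode]
    have h1 : (4 * Nat.pair c.encodeCode d.encodeCode + 2) / 4
      = Nat.pair c.encodeCode d.encodeCode := by omega
    have h2 : (4 * Nat.pair c.encodeCode d.encodeCode + 2) % 4 = 2 := by omega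
    simp [h1, h2, hc, hd]
  | rfind c hc =>
    rw [encodeCode, ofNatCode]
    have h1 : (4 * c.encodeCode + 3) / 4 = c.encodeCode := by omega
    have h2 : (4 * c.encodeCode + 3) % 4 = 3 := by omega
    simp [h1, h2, hc]

theorem encodeCode_ofNatCode (n : ℕ) : encodeCode (ofNatCode n) = n := by
  induction n using Nat.strong_induction_on with
  | _ n ih =>
    match n with
    | 0 | 1 | 2 | 3 | 4 => simp [ofNatCode, encodeCode]
    | n + 5 =>
      have hm : n / 4 < n + 5 := by omega
      have i0 := ih _ hm
      have i1 := ih _ (lt_of_le_of_lt (n / 4).unpair_left_le hm)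
      have i2 := ih _ (lt_of_le_of_lt (n / 4).unpair_right_le hm)
      rw [ofNatCode]
      split_ifs <;> simp only [encodeCode, i0, i1, i2, Nat.pair_unpair] <;> omega

instance : Denumerable OracleCode :=
  Denumerable.mk' ⟨encodeCode, ofNatCode, ofNatCode_encodeCode, encodeCode_ofNatCode⟩

end OracleCode

open Classical in
/-- The halting problem `∅' = {e | φ_e(e)↓}`, as a (total) characteristic function. -/
noncomputable def zeroJump : ℕ →. ℕ := fun e =>
  Part.some (if ((Denumerable.ofNat Nat.Partrec.Code e).eval e).Dom then 1 else 0)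

/-! ### Names of rationals, rational intervals and reals -/

/-- The rational number named by `n`: `⟨⟨a, b⟩, d⟩` names `(a - b) / (d + 1)`. -/
def ratOf (n : ℕ) : ℚ :=
  ((n.unpair.1.unpair.1 : ℚ) - n.unpair.1.unpair.2) / (n.unpair.2 + 1)

/-- The open rational interval named by `n`: `⟨u, v⟩` names `(ratOf u, ratOf v)`. -/
def openInterval (n : ℕ) : Set ℝ :=
  Set.Ioo (ratOf n.unpair.1 : ℝ) (ratOf n.unpair.2 : ℝ)

/-- The closed rational interval named by `n`: `⟨u, v⟩` names `[ratOf u, ratOf v]`. -/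
def closedInterval (n : ℕ) : Set ℝ :=
  Set.Icc (ratOf n.unpair.1 : ℝ) (ratOf n.unpair.2 : ℝ)

/-- `q` is (via the naming of rationals) a Cauchy name of the real `x`. -/
def IsCauchyName (q : ℕ → ℕ) (x : ℝ) : Prop :=
  (∀ n k, n ≤ k → |ratOf (q k) - ratOf (q n)| ≤ (1 / 2 : ℚ) ^ n) ∧
    Tendsto (fun n => (ratOf (q n) : ℝ)) atTop (𝓝 x)

/-! ### Interval sequence tests -/

/-- Finite data giving an interval sequence test: a program computing the intervals `Q^m_r(k)`,
and a program whose domain is `{(m, r, k) | k ∈ E^m_r}`. -/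
abbrev IntervalIndex : Type := Nat.Partrec.Code × Nat.Partrec.Code

namespace IntervalIndex

/-- The interval `Q^m_r(k)`. -/
def Q (T : IntervalIndex) (m r k : ℕ) : Set ℝ :=
  {z | ∃ n ∈ T.1.eval (Nat.pair m (Nat.pair r k)), z ∈ openInterval n}

/-- The c.e. set `E^m_r` of positive integers. -/
def E (T : IntervalIndex) (m r : ℕ) : Set ℕ :=
  {k | 0 < k ∧ (T.2.eval (Nat.pair m (Nat.pair r k))).Dom}

/-- `T` is an index of an interval sequence test; `m`, `r`, `k` range over positive integers. -/
def IsTest (T : IntervalIndex) : Prop :=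
  ∀ m r, 0 < m → 0 < r →
    (∀ k, 0 < k → (T.1.eval (Nat.pair m (Nat.pair r k))).Dom) ∧
    (T.E m r).Finite ∧
    volume (⋃ k ∈ {k | 0 < k ∧ k ∉ T.E m r}, T.Q m r k) ≤ (2⁻¹ : ℝ≥0∞) ^ (m + r)

/-- The real `z` fails the test. -/
def Fails (T : IntervalIndex) (z : ℝ) : Prop :=
  ∀ m, 0 < m → ∃ r, 0 < r ∧ ∃ k, 0 < k ∧ k ∉ T.E m r ∧ z ∈ T.Q m r k

end IntervalIndex

/-! ### Schnorr tests relative to `∅'` -/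

/-- Finite data giving a Schnorr test relative to `∅'`: an oracle program whose domain with
oracle `∅'` is a set of pairs `(m, n)`, for which `n` names an interval enumerated into `G_m`,
and an oracle program computing from `∅'` a Cauchy name of the measure of `G_m`,
uniformly in `m`. -/
abbrev SchnorrIndex : Type := OracleCode × OracleCode

namespace SchnorrIndex

/-- The `m`-th effectively open set relative to `∅'`. -/
def G (T : SchnorrIndex) (m : ℕ) : Set ℝ :=
  ⋃ n ∈ {n | (T.1.eval zeroJump (Nat.pair m n)).Dom}, openInterval n

/-- `T` is an index of a Schnorr test relative to `∅'`. -/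
def IsTest (T : SchnorrIndex) : Prop :=
  ∀ m, volume (T.G m) ≤ (2⁻¹ : ℝ≥0∞) ^ m ∧
    ∃ q : ℕ → ℕ, (∀ j, q j ∈ T.2.eval zeroJump (Nat.pair m j)) ∧
      IsCauchyName q (volume (T.G m)).toReal

/-- The real `z` fails the test. -/
def Fails (T : SchnorrIndex) (z : ℝ) : Prop := ∀ m, z ∈ T.G m

end SchnorrIndex

/-! ### Properties that hold almost everywhere -/

/-- Pseudo-numbers, that is `Δ⁰₂` reals: reals with a Cauchy name computable from `∅'`. -/
def IsPseudoNumber (z : ℝ) : Prop :=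
  ∃ q : ℕ → ℕ, ComputableIn {zeroJump} q ∧ IsCauchyName q z

/-- `P` holds for almost every pseudo-number, in terms of interval sequence tests. -/
def AlmostEveryPseudoNumber (P : ℝ → Prop) : Prop :=
  ∃ T : IntervalIndex, T.IsTest ∧ ∀ z, IsPseudoNumber z → ¬ T.Fails z → P z

/-- The relativization to `∅'` of the definition of `P` holding for almost every computable real:
there is a `∅'`-computable sequence of sets `S n`, each being the union of a sequence of
non-overlapping closed rational intervals (named by `H n i`, `i ∈ ℕ`) whose lengths sum up to a real
of which `L n` is a Cauchy name, with `S n` of measure at most `2 ^ (-n)`, such that `P` holds at all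
reals computable from `∅'` that are outside some `S n`. -/
def AlmostEveryRelComputable (P : ℝ → Prop) : Prop :=
  ∃ H L : ℕ → ℕ → ℕ, ComputableIn₂ {zeroJump} H ∧ ComputableIn₂ {zeroJump} L ∧
    (∀ n i, ratOf (H n i).unpair.1 ≤ ratOf (H n i).unpair.2) ∧
    (∀ n, Pairwise fun i j => Disjoint (openInterval (H n i)) (openInterval (H n j))) ∧
    (∀ n, ∃ s : ℝ,
      HasSum (fun i => ((ratOf (H n i).unpair.2 : ℝ) - ratOf (H n i).unpair.1)) s ∧
      IsCauchyName (L n) s ∧ s ≤ (1 / 2 : ℝ) ^ n) ∧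
    ∀ z, IsPseudoNumber z → (∃ n, ∀ i, z ∉ closedInterval (H n i)) → P z

/-!
The three equivalences rest on a normal form for computations with oracle `∅'`. Such a computation
uses a finite part of the oracle, and a finite part of `∅'` is a finite list of bits which are
correct if and only if no later stage of the enumeration of `∅'` refutes them. So
`y ∈ c.eval zeroJump x` holds if and only if for some `w` a primitive recursive condition on `c`,
`x`, `w` and `v` holds for all `v` and `y` is a primitive recursive function of `c`, `x` and `w`
(`OracleCode.mem_eval_zeroJump`). Conversely `∅'` decides statements `∀ v, R a v` with primitive
recursive `R` (`ComputableIn.decide_forall`), and so it can search for a `w` such that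
`∀ v, R a w v` (`RecursiveIn.search`).

*From interval sequence tests to Schnorr tests.* The set with number `m` of the Schnorr test is the
union over `r` of the open sets given by `Q^(m+1)_r` and `E^(m+1)_r`. The oracle can tell whether
`k ∉ E^m_r`, so it enumerates these sets. For the measures, the terms with large `r` are negligible;
for the remaining ones the oracle searches for a stage after which no interval with index below the
stage is removed, and after which the new intervals add little measure
(`IntervalIndex.GoodStage`).

*From lists computed by `∅'` to interval sequence tests.* If `f` is computed by an oracle program,
then the limit lemma gives a computable sequence of guesses at the value of `f` at `(m, r)`. Taking
as intervals those in the successive guesses, and removing those that come from a guess which is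
changed later, one gets a computable sequence and a finite c.e. set of removed indices such that
the intervals remaining are those of the final guess (`exists_intervalIndex_of_recursiveIn`).

*From Schnorr tests to interval sequence tests.* Knowing the measure of `G_m`, the oracle computes
finite lists of intervals that are contained in `G_m` and exhaust it up to a small measure
(`SchnorrIndex.exists_exhausting`). The intersections `V_r` of such lists for `G_(m-1)` and
`G_(m+2)` exhaust `G_(m-1) ∩ G_(m+2)`, and the differences of `V_r` and a slightly shrunk `V_(r-1)`
are finite unions of open intervals of measure at most `2 ^ (-(m + r))`. They give a test of which
the level `m` is `G_(m-1) ∩ G_(m+2)`; the set `G_(m+2)` makes the measures small enough, and the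
sets `G_(m-1)` for `m ≥ 1` include `G_0`.

*Almost everywhere.* The open sets of a Schnorr test are, up to countably many points, unions of
sequences of non-overlapping closed intervals, obtained by cutting from each interval those
enumerated earlier (`piece`), and the sum of the lengths is the measure of the open set. Conversely,
knowing the sum of the lengths of a sequence of closed intervals, the oracle can cut the sequence
into finite blocks with rapidly decreasing sums, and neighbourhoods of these blocks form an interval
sequence test (`AlmostEveryRelComputable.almostEveryPseudoNumber`).
-/

/-! ### Closure properties of relative computability -/

section RelativeComputability

open Encodable

variable {α β γ σ : Type*} [Primcodable α] [Primcodable β] [Primcodable γ] [Primcodable σ]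
variable {O : Set (ℕ →. ℕ)}

theorem RecursiveIn.comp {f : β →. σ} {g : α → β} (hf : RecursiveIn O f)
    (hg : ComputableIn O g) : RecursiveIn O fun a => f (g a) :=
  (Nat.RecursiveIn.comp hf hg).of_eq fun n => by
    rcases e : decode (α := α) n with - | a <;> simp [encodek]

theorem ComputableIn.comp {f : β → σ} {g : α → β} (hf : ComputableIn O f)
    (hg : ComputableIn O g) : ComputableIn O fun a => f (g a) :=
  RecursiveIn.comp (f := fun b => Part.some (f b)) hf hg

theorem RecursiveIn.of_eq_some {f : α →. σ} {g : α → σ} (hf : RecursiveIn O f)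
    (H : ∀ a, f a = Part.some (g a)) : ComputableIn O g :=
  RecursiveIn.of_eq hf H

theorem ComputableIn.of_eq {f g : α → σ} (hf : ComputableIn O f) (H : ∀ a, f a = g a) :
    ComputableIn O g :=
  (funext H : f = g) ▸ hf

theorem ComputableIn.pair {f : α → β} {g : α → γ} (hf : ComputableIn O f)
    (hg : ComputableIn O g) : ComputableIn O fun a => (f a, g a) :=
  (Nat.RecursiveIn.pair hf hg).of_eq fun n => by
    rcases e : decode (α := α) n with - | a <;> simp [Seq.seq]

theorem ComputableIn₂.comp {f : β → γ → σ} {g : α → β} {h : α → γ} (hf : ComputableIn₂ O f)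
    (hg : ComputableIn O g) (hh : ComputableIn O h) : ComputableIn O fun a => f (g a) (h a) :=
  ComputableIn.comp hf (hg.pair hh)

theorem RecursiveIn.bind {f : α →. β} {g : α → β →. σ} (hf : RecursiveIn O f)
    (hg : RecursiveIn₂ O g) : RecursiveIn O fun a => (f a).bind (g a) :=
  (Nat.RecursiveIn.comp hg (Nat.RecursiveIn.pair Nat.Partrec.some.recursiveIn hf)).of_eq
    fun n => by
      rcases e : decode (α := α) n
      · simp [Seq.seq]
      · simp only [Seq.seq, Part.coe_some, Part.bind_some, Part.map_eq_map,
          Part.bind_eq_bind, ← Part.bind_some_eq_map, Part.bind_assoc]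
        simp only [Nat.unpair_pair, e, encodek, Part.bind_some, Part.coe_some, Option.bind_some,
          Option.map_some, decode_prod_val]
        exact (Part.bind_assoc _ _ _).symm

theorem RecursiveIn.map {f : α →. β} {g : α → β → σ} (hf : RecursiveIn O f)
    (hg : ComputableIn₂ O g) : RecursiveIn O fun a => (f a).map (g a) :=
  (RecursiveIn.bind (g := fun a b => Part.some (g a b)) hf hg).of_eq fun a => by
    simp [Part.bind_some_eq_map]

theorem RecursiveIn.rfind {p : α → ℕ → Bool} (hp : ComputableIn₂ O p) :
    RecursiveIn O fun a => Nat.rfind fun n => Part.some (p a n) :=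
  (Nat.RecursiveIn.rfind (ComputableIn.comp (O := O)
    ((Primrec.dom_bool fun b => cond b 0 1).computableIn) hp)).of_eq fun n => by
    rcases e : decode (α := α) n with - | a
    · simp only [decode_prod_val, Nat.unpair_pair, e, Option.bind_none, Part.coe_none,
        Part.bind_none, Part.map_eq_map, Part.map_none]
      exact Nat.rfind_zero_none _ rfl
    · simp only [e, decode_prod_val, Nat.unpair_pair, Option.bind_some, Part.coe_some,
        Part.bind_some, Part.map_some, Encodable.decode_nat, Option.map_some]
      simp only [encode_nat]
      congr 1
      funext k
      simp only [Part.map_eq_map, Part.map_some]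
      cases p a k <;> simp

theorem ComputableIn.nat_rec {f : α → ℕ} {g : α → σ} {h : α → ℕ × σ → σ}
    (hf : ComputableIn O f) (hg : ComputableIn O g) (hh : ComputableIn₂ O h) :
    ComputableIn O fun a =>
      Nat.rec (motive := fun _ => σ) (g a) (fun y IH => h a (y, IH)) (f a) := by
  have h0 : Nat.RecursiveIn O (fun n => Part.some n) := Nat.Partrec.some.recursiveIn
  refine Nat.RecursiveIn.of_eq (Nat.RecursiveIn.comp (Nat.RecursiveIn.prec hg hh)
    (Nat.RecursiveIn.pair h0 hf)) fun n => ?_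
  rcases e : decode (α := α) n with - | a
  · simp [Seq.seq]
  · simp only [e, Part.coe_some, Part.bind_some, Part.map_some, Seq.seq, Part.bind_eq_bind,
      Part.map_eq_map, encode_nat, Nat.unpair_pair]
    induction f a with
    | zero => simp [e]
    | succ m ih =>
      simp only [ih, Part.bind_some]
      simp [e, encodek]

/-- The list of the first values of a function computable in an oracle is computable in it. -/
theorem ComputableIn.list_map_range {f : α → ℕ} {g : α → ℕ → σ}
    (hf : ComputableIn O f) (hg : ComputableIn₂ O g) :
    ComputableIn O fun a => (List.range (f a)).map (g a) := by
  have hh : ComputableIn₂ O fun (a : α) (p : ℕ × List σ) => p.2 ++ [g a p.1] :=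
    ComputableIn₂.comp (f := fun (l : List σ) (b : σ) => l ++ [b])
      Primrec.list_concat.computableIn₂
      (Primrec.snd.comp Primrec.snd).computableIn
      (ComputableIn₂.comp (g := fun q : α × ℕ × List σ => q.1) hg ComputableIn.fst
        (Primrec.fst.comp Primrec.snd).computableIn)
  refine (ComputableIn.nat_rec hf (ComputableIn.const []) hh).of_eq fun a => ?_
  induction f a with
  | zero => rfl
  | succ n ih => simp [List.range_succ, ih]

end RelativeComputability

/-! ### The parameter theorem for oracle programs -/

namespace OracleCode

/-- A program for the constant function with value `n`. -/
def const : ℕ → OracleCode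
  | 0 => zero
  | n + 1 => comp succ (const n)

/-- The program `c` with the first component of its input fixed to be `n`. -/
def curry (c : OracleCode) (n : ℕ) : OracleCode :=
  comp c (pair (const n) (pair left right))

theorem eval_const (g : ℕ →. ℕ) (n x : ℕ) : (const n).eval g x = Part.some n := by
  induction n with
  | zero => rfl
  | succ n ih =>
    simp only [const, eval, ih]
    exact Part.bind_some _ _

theorem eval_curry (g : ℕ →. ℕ) (c : OracleCode) (n x : ℕ) :
    (curry c n).eval g x = c.eval g (Nat.pair n x) := by
  have h : (pair (const n) (pair left right)).eval g x = Part.some (Nat.pair n x) := by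
    simp [eval, eval_const, Seq.seq]
  change ((pair (const n) (pair left right)).eval g x).bind (c.eval g) = _
  rw [h]
  exact Part.bind_some _ _

theorem encode_eq (c : OracleCode) : Encodable.encode c = encodeCode c := rfl

theorem primrec_const : Primrec const := by
  rw [← Primrec.encode_iff]
  have : Primrec fun n : ℕ =>
      Nat.rec (motive := fun _ => ℕ) 0 (fun _ IH => 4 * Nat.pair 1 IH + 6) n :=
    Primrec.nat_rec₁ 0 (Primrec.nat_add.comp (Primrec.nat_mul.comp (Primrec.const 4)
      (Primrec₂.natPair.comp (Primrec.const 1) Primrec.snd)) (Primrec.const 6))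
  refine this.of_eq fun n => ?_
  induction n with
  | zero => rfl
  | succ n ih =>
    rw [encode_eq] at ih ⊢
    simp only [const, encodeCode, ← ih]

theorem primrec_curry (c : OracleCode) : Primrec (curry c) := by
  rw [← Primrec.encode_iff]
  have : Primrec fun n : ℕ => 4 * Nat.pair (encodeCode c)
      (4 * Nat.pair (Encodable.encode (const n)) (encodeCode (pair left right)) + 5) + 6 :=
    Primrec.nat_add.comp (Primrec.nat_mul.comp (Primrec.const 4) (Primrec₂.natPair.comp
      (Primrec.const _) (Primrec.nat_add.comp (Primrec.nat_mul.comp (Primrec.const 4)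
        (Primrec₂.natPair.comp (Primrec.encode.comp primrec_const) (Primrec.const _)))
        (Primrec.const 5)))) (Primrec.const 6)
  exact this.of_eq fun n => rfl

end OracleCode

/-! ### The halting problem decides universal sentences -/

section Search

variable {α : Type*} [Primcodable α]

open Classical in
/-- The halting problem decides whether a primitive recursive relation holds at all arguments. -/
theorem ComputableIn.decide_forall {R : α → ℕ → Prop} (hR : PrimrecRel R) :
    ComputableIn {zeroJump} fun a => decide (∀ v, R a v) := by
  -- `c` halts on `⟨a, x⟩` if and only if some instance `R a v` fails
  have h1 : Partrec fun a : α => Nat.rfind fun v => Part.some (decide (¬ R a v)) :=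
    Partrec.rfind (p := fun a v => Part.some (decide (¬ R a v))) hR.not.decide.to_comp.partrec
  have h2 : Partrec fun n : ℕ => ((Encodable.decode n : Option α) : Part α).bind fun a =>
      Nat.rfind fun v => Part.some (decide (¬ R a v)) :=
    (Computable.ofOption Computable.decode).bind (h1.comp Computable.snd)
  obtain ⟨c, hc⟩ := Nat.Partrec.Code.exists_code.1
    (Partrec.nat_iff.1 (h2.comp (Primrec.fst.comp Primrec.unpair).to_comp))
  have he : Computable fun a : α =>
      Encodable.encode (Nat.Partrec.Code.curry c (Encodable.encode a)) :=
    (Primrec.encode.comp (Nat.Partrec.Code.primrec₂_curry.comp (Primrec.const c)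
      Primrec.encode)).to_comp
  have hZ : RecursiveIn {zeroJump} zeroJump := RecursiveIn.oracle _ rfl
  have hZ' := hZ.comp he.computableIn
  have hb : Primrec fun n : ℕ => decide (n = 0) :=
    (Primrec.eq.comp Primrec.id (Primrec.const 0)).decide
  refine RecursiveIn.of_eq_some (hZ'.map (g := fun _ n => decide (n = 0))
    (hb.comp Primrec.snd).computableIn) fun a => ?_
  have key : ((Denumerable.ofNat Nat.Partrec.Code
      (Encodable.encode (Nat.Partrec.Code.curry c (Encodable.encode a)))).eval
      (Encodable.encode (Nat.Partrec.Code.curry c (Encodable.encode a)))).Dom ↔ ¬ ∀ v, R a v := by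
    rw [Denumerable.ofNat_encode, Nat.Partrec.Code.eval_curry, hc]
    simp only [Nat.unpair_pair, Encodable.encodek, Part.coe_some, Part.bind_some]
    refine Nat.rfind_dom.trans ?_
    simp
  simp only [zeroJump, Part.map_some, key]
  by_cases h : ∀ v, R a v <;> simp [h]

open Classical in
/-- The halting problem can search for the least witness of an existential-universal sentence. -/
theorem RecursiveIn.search {R : α → ℕ → ℕ → Prop}
    (hR : PrimrecPred fun p : (α × ℕ) × ℕ => R p.1.1 p.1.2 p.2) :
    RecursiveIn {zeroJump} fun a => Nat.rfind fun w => Part.some (decide (∀ v, R a w v)) :=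
  RecursiveIn.rfind (p := fun a w => decide (∀ v, R a w v))
    (ComputableIn.decide_forall (R := fun (p : α × ℕ) v => R p.1 p.2 v) hR)

end Search

/-! ### Oracle computations with a finite part of the oracle -/

namespace Nat.Partrec.Code

theorem eval_zero' (n : ℕ) : zero.eval n = Part.some 0 := rfl
theorem eval_succ' (n : ℕ) : succ.eval n = Part.some (n + 1) := rfl
theorem eval_left' (n : ℕ) : left.eval n = Part.some n.unpair.1 := rfl
theorem eval_right' (n : ℕ) : right.eval n = Part.some n.unpair.2 := rfl

theorem eval_comp' (a b : Code) (n : ℕ) :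
    (comp a b).eval n = (b.eval n).bind fun y => a.eval y := rfl

theorem eval_pair' (a b : Code) (n : ℕ) :
    (pair a b).eval n = (a.eval n).bind fun y => (b.eval n).map fun z => Nat.pair y z := by
  simp [eval, Seq.seq]

theorem mem_eval_rfind'_zero {c : Code} {n y : ℕ} :
    y ∈ (rfind' c).eval (Nat.pair n 0) ↔ 0 ∈ c.eval (Nat.pair n y) ∧
      ∀ m < y, ∃ u ∈ c.eval (Nat.pair n m), u ≠ 0 := by
  have h : (rfind' c).eval (Nat.pair n 0) =
      Nat.rfind fun k => (fun m => decide (m = 0)) <$> c.eval (Nat.pair n k) := by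
    simp [eval, Nat.unpaired, Part.map_id']
  rw [h]
  refine Nat.mem_rfind.trans ?_
  simp only [Part.map_eq_map, Part.mem_map_iff, decide_eq_true_eq, decide_eq_false_iff_not,
    exists_eq_right]

end Nat.Partrec.Code

namespace OracleCode

open Nat.Partrec (Code)

theorem eval_comp' (g : ℕ →. ℕ) (a b : OracleCode) (n : ℕ) :
    (comp a b).eval g n = (b.eval g n).bind fun y => a.eval g y := rfl

theorem eval_pair' (g : ℕ →. ℕ) (a b : OracleCode) (n : ℕ) :
    (pair a b).eval g n = (a.eval g n).bind fun y => (b.eval g n).map fun z => Nat.pair y z := by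
  simp [eval, Seq.seq]

theorem eval_prec' (g : ℕ →. ℕ) (a b : OracleCode) (n : ℕ) :
    (prec a b).eval g n = Nat.rec (motive := fun _ => Part ℕ) (a.eval g n.unpair.1)
      (fun y IH => IH.bind fun i => b.eval g (Nat.pair n.unpair.1 (Nat.pair y i)))
      n.unpair.2 := rfl

theorem mem_eval_rfind {g : ℕ →. ℕ} {a : OracleCode} {n y : ℕ} :
    y ∈ (rfind a).eval g n ↔ 0 ∈ a.eval g (Nat.pair n y) ∧
      ∀ m < y, ∃ u ∈ a.eval g (Nat.pair n m), u ≠ 0 := by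
  refine Nat.mem_rfind.trans ?_
  simp only [Part.map_eq_map, Part.mem_map_iff, decide_eq_true_eq, decide_eq_false_iff_not,
    exists_eq_right]

/-- Regroups `⟨⟨s, a⟩, q⟩` as `⟨s, ⟨a, q⟩⟩`. -/
def assocCode : Code :=
  .pair (.comp .left .left) (.pair (.comp .right .left) .right)

theorem eval_assocCode (s a q : ℕ) :
    assocCode.eval (Nat.pair (Nat.pair s a) q) = Part.some (Nat.pair s (Nat.pair a q)) := by
  simp [assocCode, Code.eval_comp', Code.eval_pair', Code.eval_left', Code.eval_right']

/-- Translation of an oracle program into an ordinary program that takes an additional parameter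
`s` and answers the question `i` to the oracle by running `K` on `⟨s, i⟩`. -/
def toCode (K : Code) : OracleCode → Code
  | zero => .zero
  | succ => .comp .succ .right
  | left => .comp .left .right
  | right => .comp .right .right
  | oracle => K
  | pair a b => .pair (toCode K a) (toCode K b)
  | comp a b => .comp (toCode K a) (.pair .left (toCode K b))
  | prec a b => .comp (.prec (toCode K a) (.comp (toCode K b) assocCode))
      (.pair (.pair .left (.comp .left .right)) (.comp .right .right))
  | rfind a => .comp (.rfind' (.comp (toCode K a) assocCode)) (.pair Code.id .zero)

/-- The oracle that answers `i` by running `K` on `⟨s, i⟩`. -/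
def slice (K : Code) (s : ℕ) : ℕ →. ℕ := fun i => K.eval (Nat.pair s i)

theorem eval_toCode (K : Code) (c : OracleCode) (s x : ℕ) :
    (toCode K c).eval (Nat.pair s x) = c.eval (slice K s) x := by
  induction c generalizing x with
  | zero => rfl
  | succ => simp [toCode, eval, Code.eval_comp', Code.eval_succ', Code.eval_right']
  | left => simp [toCode, eval, Code.eval_comp', Code.eval_left', Code.eval_right']
  | right => simp [toCode, eval, Code.eval_comp', Code.eval_right']
  | oracle => rfl
  | pair a b iha ihb => simp only [toCode, Code.eval_pair', eval_pair', iha, ihb]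
  | comp a b iha ihb =>
    simp [toCode, Code.eval_comp', eval_comp', Code.eval_pair', Code.eval_left', iha, ihb,
      Part.bind_map]
  | prec a b iha ihb =>
    simp only [toCode, Code.eval_comp', Code.eval_pair', Code.eval_left', Code.eval_right',
      Part.bind_some, Part.map_some, Nat.unpair_pair, eval_prec']
    induction x.unpair.2 with
    | zero => exact (Code.eval_prec_zero _ _ _).trans (iha _)
    | succ n ih =>
      rw [Code.eval_prec_succ, ih]
      simp only [Part.bind_eq_bind, Code.eval_comp', eval_assocCode, Part.bind_some, ihb]
  | rfind a iha =>
    simp only [toCode, Code.eval_comp', Code.eval_pair', Code.eval_id, Code.eval_zero',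
      Part.bind_some, Part.map_some]
    ext y
    simp only [Code.mem_eval_rfind'_zero, mem_eval_rfind, Code.eval_comp', eval_assocCode,
      Part.bind_some, iha]

/-- The Gödel number of `toCode K (ofNatCode n)` is computed by course-of-values recursion. -/
theorem primrec_toCode (K : Code) : Primrec (toCode K) := by
  -- the value at `n`, given the list of the values at smaller numbers
  let G : List Code → Option Code := fun l =>
    if l.length = 0 then some .zero
    else if l.length = 1 then some (.comp .succ .right)
    else if l.length = 2 then some (.comp .left .right)
    else if l.length = 3 then some (.comp .right .right)
    else if l.length = 4 then some K
    else
      let q := (l.length - 5) / 4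
      let r := (l.length - 5) % 4
      let A := (l[q.unpair.1]?).getD .zero
      let B := (l[q.unpair.2]?).getD .zero
      if r = 0 then some (.pair A B)
      else if r = 1 then some (.comp A (.pair .left B))
      else if r = 2 then some (.comp (.prec A (.comp B assocCode))
        (.pair (.pair .left (.comp .left .right)) (.comp .right .right)))
      else some (.comp (.rfind' (.comp ((l[q]?).getD .zero) assocCode)) (.pair Code.id .zero))
  have hG : Primrec G := by
    have hl : Primrec (List.length : List Code → ℕ) := Primrec.list_length
    have h5 : Primrec fun l : List Code => l.length - 5 :=
      Primrec.nat_sub.comp hl (Primrec.const 5)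
    have hq : Primrec fun l : List Code => (l.length - 5) / 4 :=
      Primrec.nat_div.comp h5 (Primrec.const 4)
    have hr : Primrec fun l : List Code => (l.length - 5) % 4 :=
      Primrec.nat_mod.comp h5 (Primrec.const 4)
    have hget : ∀ {f : List Code → ℕ}, Primrec f →
        Primrec fun l : List Code => (l[f l]?).getD Code.zero := fun {f} hf =>
      Primrec.option_getD.comp (Primrec.list_getElem?.comp Primrec.id hf) (Primrec.const _)
    have hA := hget (Primrec.fst.comp (Primrec.unpair.comp hq))
    have hB := hget (Primrec.snd.comp (Primrec.unpair.comp hq))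
    have hC := hget hq
    have eq : ∀ {f : List Code → ℕ}, Primrec f → ∀ k, PrimrecPred fun l => f l = k :=
      fun hf k => Primrec.eq.comp hf (Primrec.const k)
    have k : ∀ d : Code, Primrec fun _ : List Code => d := fun d => Primrec.const d
    refine Primrec.ite (eq hl 0) (Primrec.const _) (Primrec.ite (eq hl 1) (Primrec.const _)
      (Primrec.ite (eq hl 2) (Primrec.const _) (Primrec.ite (eq hl 3) (Primrec.const _)
      (Primrec.ite (eq hl 4) (Primrec.const _) (Primrec.ite (eq hr 0)
      (Primrec.option_some.comp (Code.primrec₂_pair.comp hA hB)) (Primrec.ite (eq hr 1)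
      (Primrec.option_some.comp (Code.primrec₂_comp.comp hA (Code.primrec₂_pair.comp (k _) hB)))
      (Primrec.ite (eq hr 2)
      (Primrec.option_some.comp (Code.primrec₂_comp.comp (Code.primrec₂_prec.comp hA
        (Code.primrec₂_comp.comp hB (k _))) (k _)))
      (Primrec.option_some.comp (Code.primrec₂_comp.comp (Code.primrec_rfind'.comp
        (Code.primrec₂_comp.comp hC (k _))) (k _))))))))))
  have hrec : Primrec₂ fun (_ : Unit) (n : ℕ) => toCode K (ofNatCode n) := by
    refine Primrec.nat_strong_rec _ (g := fun _ l => G l) (hG.comp Primrec.snd) fun _ n => ?_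
    simp only [G, List.length_map, List.length_range]
    match n with
    | 0 | 1 | 2 | 3 | 4 => simp [ofNatCode, toCode]
    | n + 5 =>
      have hm : n / 4 < n + 5 := by omega
      have h1 : (n / 4).unpair.1 < n + 5 := lt_of_le_of_lt (n / 4).unpair_left_le hm
      have h2 : (n / 4).unpair.2 < n + 5 := lt_of_le_of_lt (n / 4).unpair_right_le hm
      rw [ofNatCode]
      simp only [Nat.add_sub_cancel, List.getElem?_map, List.getElem?_range hm,
        List.getElem?_range h1, List.getElem?_range h2, Option.map_some, Option.getD_some]
      simp only [show n + 5 ≠ 0 by omega, show n + 5 ≠ 1 by omega, show n + 5 ≠ 2 by omega,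
        show n + 5 ≠ 3 by omega, show n + 5 ≠ 4 by omega, if_false]
      split_ifs <;> rfl
  refine ((hrec.comp (Primrec.const ()) (Primrec.encode (α := OracleCode)))).of_eq fun c => ?_
  exact congrArg _ (ofNatCode_encodeCode c)

/-- A halting computation does not depend on answers of the oracle that it does not use. -/
theorem eval_mono {g h : ℕ →. ℕ} (hgh : ∀ i, ∀ y ∈ g i, y ∈ h i) (c : OracleCode) (x y : ℕ)
    (hy : y ∈ c.eval g x) : y ∈ c.eval h x := by
  induction c generalizing x y with
  | zero => exact hy
  | succ => exact hy
  | left => exact hy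
  | right => exact hy
  | oracle => exact hgh x y hy
  | pair a b iha ihb =>
    rw [eval_pair', Part.mem_bind_iff] at hy ⊢
    obtain ⟨u, hu, hy⟩ := hy
    rw [Part.mem_map_iff] at hy
    obtain ⟨v, hv, rfl⟩ := hy
    exact ⟨u, iha _ _ hu, Part.mem_map _ (ihb _ _ hv)⟩
  | comp a b iha ihb =>
    rw [eval_comp', Part.mem_bind_iff] at hy ⊢
    obtain ⟨u, hu, hy⟩ := hy
    exact ⟨u, ihb _ _ hu, iha _ _ hy⟩
  | prec a b iha ihb =>
    rw [eval_prec'] at hy ⊢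
    generalize x.unpair.2 = n at hy ⊢
    induction n generalizing y with
    | zero => exact iha _ _ hy
    | succ n ih =>
      simp only [Part.mem_bind_iff] at hy ⊢
      obtain ⟨i, hi, hy⟩ := hy
      exact ⟨i, ih i hi, ihb _ _ hy⟩
  | rfind a iha =>
    rw [mem_eval_rfind] at hy ⊢
    refine ⟨iha _ _ hy.1, fun m hm => ?_⟩
    obtain ⟨u, hu, hu0⟩ := hy.2 m hm
    exact ⟨u, iha _ _ hu, hu0⟩

/-- The restriction of an oracle to arguments below `L`. -/
def restrict (g : ℕ →. ℕ) (L : ℕ) : ℕ →. ℕ := fun i => if i < L then g i else Part.none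

theorem mem_restrict {g : ℕ →. ℕ} {L i y : ℕ} : y ∈ restrict g L i ↔ i < L ∧ y ∈ g i := by
  unfold restrict
  split_ifs with h <;> simp [h]

theorem eval_restrict_mono {g : ℕ →. ℕ} {L M : ℕ} (h : L ≤ M) {c : OracleCode} {x y : ℕ}
    (hy : y ∈ c.eval (restrict g L) x) : y ∈ c.eval (restrict g M) x :=
  eval_mono (fun _ _ hi => mem_restrict.2
    ⟨(mem_restrict.1 hi).1.trans_le h, (mem_restrict.1 hi).2⟩) c x y hy

/-- The use principle: a halting oracle computation only asks finitely many questions. -/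
theorem exists_eval_restrict {g : ℕ →. ℕ} (c : OracleCode) (x y : ℕ) (hy : y ∈ c.eval g x) :
    ∃ L, y ∈ c.eval (restrict g L) x := by
  induction c generalizing x y with
  | zero => exact ⟨0, hy⟩
  | succ => exact ⟨0, hy⟩
  | left => exact ⟨0, hy⟩
  | right => exact ⟨0, hy⟩
  | oracle => exact ⟨x + 1, mem_restrict.2 ⟨x.lt_succ_self, hy⟩⟩
  | pair a b iha ihb =>
    rw [eval_pair', Part.mem_bind_iff] at hy
    obtain ⟨u, hu, hy⟩ := hy
    rw [Part.mem_map_iff] at hy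
    obtain ⟨v, hv, rfl⟩ := hy
    obtain ⟨L, hL⟩ := iha _ _ hu
    obtain ⟨M, hM⟩ := ihb _ _ hv
    refine ⟨max L M, ?_⟩
    rw [eval_pair', Part.mem_bind_iff]
    exact ⟨u, eval_restrict_mono (le_max_left _ _) hL,
      Part.mem_map _ (eval_restrict_mono (le_max_right _ _) hM)⟩
  | comp a b iha ihb =>
    rw [eval_comp', Part.mem_bind_iff] at hy
    obtain ⟨u, hu, hy⟩ := hy
    obtain ⟨L, hL⟩ := ihb _ _ hu
    obtain ⟨M, hM⟩ := iha _ _ hy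
    refine ⟨max L M, ?_⟩
    rw [eval_comp', Part.mem_bind_iff]
    exact ⟨u, eval_restrict_mono (le_max_left _ _) hL, eval_restrict_mono (le_max_right _ _) hM⟩
  | prec a b iha ihb =>
    rw [eval_prec'] at hy
    simp only [eval_prec']
    generalize x.unpair.2 = n at hy ⊢
    induction n generalizing y with
    | zero => exact iha _ _ hy
    | succ n ih =>
      simp only [Part.mem_bind_iff] at hy ⊢
      obtain ⟨i, hi, hy⟩ := hy
      obtain ⟨L, hL⟩ := ih i hi
      obtain ⟨M, hM⟩ := ihb _ _ hy
      refine ⟨max L M, i, ?_, eval_restrict_mono (le_max_right _ _) hM⟩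
      have := eval_restrict_mono (c := prec a b) (x := Nat.pair x.unpair.1 n) (y := i)
        (le_max_left L M) (by simpa [eval_prec'] using hL)
      simpa [eval_prec'] using this
  | rfind a iha =>
    rw [mem_eval_rfind] at hy
    have h : ∀ k, ∃ L, k < y → ∃ u ∈ a.eval (restrict g L) (Nat.pair x k), u ≠ 0 := by
      intro k
      by_cases hk : k < y
      · obtain ⟨u, hu, hu0⟩ := hy.2 k hk
        obtain ⟨L, hL⟩ := iha _ _ hu
        exact ⟨L, fun _ => ⟨u, hL, hu0⟩⟩
      · exact ⟨0, fun h => absurd h hk⟩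
    choose L hL using h
    obtain ⟨N, hN⟩ := iha _ _ hy.1
    refine ⟨max N ((Finset.range y).sup L), mem_eval_rfind.2
      ⟨eval_restrict_mono (le_max_left _ _) hN, fun m hm => ?_⟩⟩
    obtain ⟨u, hu, hu0⟩ := hL m hm
    exact ⟨u, eval_restrict_mono
      ((Finset.le_sup (Finset.mem_range.2 hm)).trans (le_max_right _ _)) hu, hu0⟩

end OracleCode

open Nat.Partrec (Code)

/-! ### The normal form for computations from the halting problem -/

/-- The characteristic function of the part of the halting problem found within `u` steps. -/
def haltStage (u i : ℕ) : ℕ :=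
  if (Code.evaln u (Denumerable.ofNat Code i) i).isSome then 1 else 0

theorem primrec_haltStage : Primrec₂ haltStage := by
  have h : Primrec fun p : ℕ × ℕ =>
      (Code.evaln p.1 (Denumerable.ofNat Code p.2) p.2).isSome :=
    Primrec.option_isSome.comp (Code.primrec_evaln.comp (Primrec.pair (Primrec.pair Primrec.fst
      ((Primrec.ofNat Code).comp Primrec.snd)) Primrec.snd))
  exact Primrec.ite (Primrec.eq.comp h (Primrec.const true)) (Primrec.const 1) (Primrec.const 0)

theorem evaln_isSome_mono {u v : ℕ} (h : u ≤ v) {c : Code} {n : ℕ}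
    (hu : (Code.evaln u c n).isSome) : (Code.evaln v c n).isSome := by
  obtain ⟨y, hy⟩ := Option.isSome_iff_exists.1 hu
  exact Option.isSome_iff_exists.2 ⟨y, Code.evaln_mono h hy⟩

theorem eval_dom_iff_evaln {c : Code} {n : ℕ} :
    (c.eval n).Dom ↔ ∃ u, (Code.evaln u c n).isSome := by
  constructor
  · intro h
    obtain ⟨u, hu⟩ := Code.evaln_complete.1 (Part.get_mem h)
    exact ⟨u, Option.isSome_iff_exists.2 ⟨_, hu⟩⟩
  · rintro ⟨u, hu⟩
    obtain ⟨y, hy⟩ := Option.isSome_iff_exists.1 hu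
    exact Part.dom_iff_mem.2 ⟨y, Code.evaln_sound hy⟩

/-- The approximations to the halting problem converge at each argument. -/
theorem eventually_haltStage (i : ℕ) : ∀ᶠ u in atTop, zeroJump i = Part.some (haltStage u i) := by
  by_cases h : ((Denumerable.ofNat Code i).eval i).Dom
  · obtain ⟨u, hu⟩ := eval_dom_iff_evaln.1 h
    filter_upwards [eventually_ge_atTop u] with v hv
    simp [zeroJump, haltStage, h, evaln_isSome_mono hv hu]
  · filter_upwards with v
    have : ¬ (Code.evaln v (Denumerable.ofNat Code i) i).isSome := fun hv =>
      h (eval_dom_iff_evaln.2 ⟨v, hv⟩)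
    simp [zeroJump, haltStage, h, this]

namespace OracleCode

theorem exists_stageCode : ∃ K : Code, ∀ L u i, K.eval (Nat.pair (Nat.pair L u) i) =
    if i < L then Part.some (haltStage u i) else Part.none := by
  have h : Primrec fun n : ℕ => if n.unpair.2 < n.unpair.1.unpair.1 then
      some (haltStage n.unpair.1.unpair.2 n.unpair.2) else none := by
    have h1 := Primrec.fst.comp Primrec.unpair
    have h2 := Primrec.snd.comp Primrec.unpair
    refine Primrec.ite (Primrec.nat_lt.comp h2 (h1.comp h1)) (Primrec.option_some.comp
      (primrec_haltStage.comp (h2.comp h1) h2)) (Primrec.const _)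
  obtain ⟨K, hK⟩ := Code.exists_code.1 (Partrec.nat_iff.1 (Computable.ofOption h.to_comp))
  refine ⟨K, fun L u i => ?_⟩
  rw [hK]
  simp only [Nat.unpair_pair]
  split_ifs <;> rfl

/-- A program answering questions below `L` about the halting problem by the approximation of
stage `u`; the parameter is `⟨L, u⟩`. -/
noncomputable def stageCode : Code := exists_stageCode.choose

/-- The output of `c` on `x` proposed by the witness `w = ⟨⟨L, u⟩, t⟩`: the result, if any, of `t`
steps of the computation that uses as oracle the part below `L` of the approximation of stage `u`
to the halting problem. -/
noncomputable def stageEval (c : OracleCode) (x w : ℕ) : Option ℕ :=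
  Code.evaln w.unpair.2 (toCode stageCode c) (Nat.pair w.unpair.1 x)

/-- The witness `w` has an output, and the part of the oracle that it uses does not change
between the stages `u` and `u + v`. -/
def Certifies (c : OracleCode) (x w v : ℕ) : Prop :=
  (stageEval c x w).isSome ∧ ∀ i < w.unpair.1.unpair.1,
    haltStage (w.unpair.1.unpair.2 + v) i = haltStage w.unpair.1.unpair.2 i

theorem primrec_stageEval :
    Primrec fun p : (OracleCode × ℕ) × ℕ => stageEval p.1.1 p.1.2 p.2 := by
  have h1 := Primrec.fst.comp Primrec.unpair
  have h2 := Primrec.snd.comp Primrec.unpair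
  have c := Primrec.fst.comp (Primrec.fst (α := OracleCode × ℕ) (β := ℕ))
  have x := Primrec.snd.comp (Primrec.fst (α := OracleCode × ℕ) (β := ℕ))
  exact Code.primrec_evaln.comp (Primrec.pair (Primrec.pair (h2.comp Primrec.snd)
    ((primrec_toCode stageCode).comp c))
    (Primrec₂.natPair.comp (h1.comp Primrec.snd) x))

theorem primrecPred_certifies :
    PrimrecPred fun p : ((OracleCode × ℕ) × ℕ) × ℕ => Certifies p.1.1.1 p.1.1.2 p.1.2 p.2 := by
  refine PrimrecPred.and (Primrec.eq.comp (Primrec.option_isSome.comp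
    (primrec_stageEval.comp Primrec.fst)) (Primrec.const true)) ?_
  have hR : PrimrecRel fun (i : ℕ) (q : ℕ × ℕ) => haltStage (q.1 + q.2) i = haltStage q.1 i :=
    Primrec.eq.comp (primrec_haltStage.comp (Primrec.nat_add.comp
      (Primrec.fst.comp Primrec.snd) (Primrec.snd.comp Primrec.snd)) Primrec.fst)
      (primrec_haltStage.comp (Primrec.fst.comp Primrec.snd) Primrec.fst)
  have h1 := Primrec.fst.comp Primrec.unpair
  have h2 := Primrec.snd.comp Primrec.unpair
  have w := Primrec.snd.comp (Primrec.fst (α := (OracleCode × ℕ) × ℕ) (β := ℕ))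
  refine (hR.forall_mem_list.comp (Primrec.list_range.comp ((h1.comp h1).comp w))
    (Primrec.pair ((h2.comp h1).comp w) Primrec.snd)).of_eq fun p => ?_
  simp

/-- If the part below `L` of the approximation of stage `u` never changes, then it is the part below
`L` of the halting problem. -/
theorem slice_stageCode (L u : ℕ) (h : ∀ i < L, ∀ v, haltStage (u + v) i = haltStage u i) :
    slice stageCode (Nat.pair L u) = restrict zeroJump L := by
  funext i
  rw [slice, stageCode, exists_stageCode.choose_spec, restrict]
  split_ifs with hi
  · obtain ⟨N, hN⟩ := eventually_atTop.1 (eventually_haltStage i)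
    rw [hN (u + N) (by omega), h i hi]
  · rfl

/-- The normal form for computations from the halting problem: an output is a value proposed by a
witness that is never refuted. -/
theorem mem_eval_zeroJump {c : OracleCode} {x y : ℕ} :
    y ∈ c.eval zeroJump x ↔ ∃ w, (∀ v, Certifies c x w v) ∧ stageEval c x w = some y := by
  constructor
  · intro hy
    obtain ⟨L, hL⟩ := exists_eval_restrict c x y hy
    have h : ∀ᶠ u in atTop, ∀ i ∈ Finset.range L, zeroJump i = Part.some (haltStage u i) :=
      (Finset.eventually_all _).2 fun i _ => eventually_haltStage i
    obtain ⟨u, hu⟩ := eventually_atTop.1 h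
    have hst : ∀ i < L, ∀ v, haltStage (u + v) i = haltStage u i := fun i hi v => by
      have h1 := hu (u + v) (by omega) i (Finset.mem_range.2 hi)
      have h2 := hu u le_rfl i (Finset.mem_range.2 hi)
      exact Part.some_inj.1 (h1.symm.trans h2)
    rw [← slice_stageCode L u hst, ← eval_toCode, Code.evaln_complete] at hL
    obtain ⟨t, ht⟩ := hL
    refine ⟨Nat.pair (Nat.pair L u) t, ?_, ?_⟩
    · refine fun v => ⟨?_, fun i hi => ?_⟩
      · simpa [stageEval] using Option.isSome_iff_exists.2 ⟨y, ht⟩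
      · simp only [Nat.unpair_pair] at hi ⊢
        exact hst i hi v
    · simpa [stageEval] using ht
  · rintro ⟨w, hw, hy⟩
    have h := slice_stageCode w.unpair.1.unpair.1 w.unpair.1.unpair.2
      fun i hi v => (hw v).2 i hi
    rw [Nat.pair_unpair] at h
    have := Code.evaln_sound (show y ∈ Code.evaln _ _ _ from hy)
    rw [eval_toCode, h] at this
    exact eval_mono (fun _ _ hi => (mem_restrict.1 hi).2) c x y this

theorem eval_dom_zeroJump {c : OracleCode} {x : ℕ} :
    (c.eval zeroJump x).Dom ↔ ∃ w, ∀ v, Certifies c x w v := by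
  rw [Part.dom_iff_mem]
  constructor
  · rintro ⟨y, hy⟩
    obtain ⟨w, hw, -⟩ := mem_eval_zeroJump.1 hy
    exact ⟨w, hw⟩
  · rintro ⟨w, hw⟩
    obtain ⟨y, hy⟩ := Option.isSome_iff_exists.1 (hw 0).1
    exact ⟨y, mem_eval_zeroJump.2 ⟨w, hw, hy⟩⟩

end OracleCode

/-! ### Arithmetic on names of rationals -/

theorem primrecRel_ratOf_le : PrimrecRel fun u v : ℕ => ratOf u ≤ ratOf v := by
  have h1 := Primrec.fst.comp Primrec.unpair
  have h2 := Primrec.snd.comp Primrec.unpair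
  have hu := Primrec.fst (α := ℕ) (β := ℕ)
  have hv := Primrec.snd (α := ℕ) (β := ℕ)
  have a := (h1.comp h1)
  have b := (h2.comp h1)
  refine (Primrec.nat_le.comp
    (Primrec.nat_add.comp (Primrec.nat_mul.comp (a.comp hu) (Primrec.succ.comp (h2.comp hv)))
      (Primrec.nat_mul.comp (b.comp hv) (Primrec.succ.comp (h2.comp hu))))
    (Primrec.nat_add.comp (Primrec.nat_mul.comp (a.comp hv) (Primrec.succ.comp (h2.comp hu)))
      (Primrec.nat_mul.comp (b.comp hu) (Primrec.succ.comp (h2.comp hv))))).of_eq fun p => ?_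
  have e1 : (0 : ℚ) < p.1.unpair.2 + 1 := by positivity
  have e2 : (0 : ℚ) < p.2.unpair.2 + 1 := by positivity
  unfold ratOf
  beta_reduce
  rw [div_le_div_iff₀ e1 e2, ← Nat.cast_le (α := ℚ)]
  push_cast
  constructor <;> intro h <;> linarith

/-- A name of the sum of the rationals named by `u` and `v`. -/
def ratAdd (u v : ℕ) : ℕ :=
  Nat.pair (Nat.pair
    (u.unpair.1.unpair.1 * (v.unpair.2 + 1) + v.unpair.1.unpair.1 * (u.unpair.2 + 1))
    (u.unpair.1.unpair.2 * (v.unpair.2 + 1) + v.unpair.1.unpair.2 * (u.unpair.2 + 1)))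
    ((u.unpair.2 + 1) * (v.unpair.2 + 1) - 1)

theorem ratOf_ratAdd (u v : ℕ) : ratOf (ratAdd u v) = ratOf u + ratOf v := by
  have e1 : (u.unpair.2 + 1 : ℚ) ≠ 0 := by positivity
  have e2 : (v.unpair.2 + 1 : ℚ) ≠ 0 := by positivity
  have h : (((u.unpair.2 + 1) * (v.unpair.2 + 1) - 1 : ℕ) : ℚ)
      = (u.unpair.2 + 1) * (v.unpair.2 + 1) - 1 := by
    rw [Nat.cast_sub (Nat.succ_le_of_lt (by positivity))]
    push_cast
    rfl
  simp only [ratAdd, ratOf, Nat.unpair_pair, h]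
  push_cast
  field_simp
  ring

theorem primrec_ratAdd : Primrec₂ ratAdd := by
  have h1 := Primrec.fst.comp Primrec.unpair
  have h2 := Primrec.snd.comp Primrec.unpair
  have hu := Primrec.fst (α := ℕ) (β := ℕ)
  have hv := Primrec.snd (α := ℕ) (β := ℕ)
  have a := (h1.comp h1)
  have b := (h2.comp h1)
  have du := Primrec.succ.comp (h2.comp hu)
  have dv := Primrec.succ.comp (h2.comp hv)
  exact Primrec₂.natPair.comp (Primrec₂.natPair.comp
    (Primrec.nat_add.comp (Primrec.nat_mul.comp (a.comp hu) dv)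
      (Primrec.nat_mul.comp (a.comp hv) du))
    (Primrec.nat_add.comp (Primrec.nat_mul.comp (b.comp hu) dv)
      (Primrec.nat_mul.comp (b.comp hv) du)))
    (Primrec.nat_sub.comp (Primrec.nat_mul.comp du dv) (Primrec.const 1))

/-- A name of the negative of the rational named by `u`. -/
def ratNeg (u : ℕ) : ℕ :=
  Nat.pair (Nat.pair u.unpair.1.unpair.2 u.unpair.1.unpair.1) u.unpair.2

theorem ratOf_ratNeg (u : ℕ) : ratOf (ratNeg u) = -ratOf u := by
  simp only [ratNeg, ratOf, Nat.unpair_pair]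
  ring

theorem primrec_ratNeg : Primrec ratNeg := by
  have h1 := Primrec.fst.comp Primrec.unpair
  have h2 := Primrec.snd.comp Primrec.unpair
  exact Primrec₂.natPair.comp (Primrec₂.natPair.comp (h2.comp h1) (h1.comp h1)) h2

/-- A name of `2 ^ (-k)`. -/
def ratHalfPow (k : ℕ) : ℕ := Nat.pair (Nat.pair 1 0) (2 ^ k - 1)

theorem ratOf_ratHalfPow (k : ℕ) : ratOf (ratHalfPow k) = (1 / 2) ^ k := by
  simp [ratHalfPow, ratOf]

theorem primrec_ratHalfPow : Primrec ratHalfPow := by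
  have hp : Primrec fun k : ℕ => 2 ^ k :=
    (Primrec₂.unpaired'.1 Nat.Primrec.pow).comp (Primrec.const 2) Primrec.id
  exact Primrec₂.natPair.comp (Primrec.const _) (Primrec.nat_sub.comp hp (Primrec.const 1))

theorem ratOf_zero : ratOf 0 = 0 := by simp [ratOf]

/-- A name of the minimum. -/
def ratMin (u v : ℕ) : ℕ := if ratOf u ≤ ratOf v then u else v

/-- A name of the maximum. -/
def ratMax (u v : ℕ) : ℕ := if ratOf u ≤ ratOf v then v else u

theorem ratOf_ratMin (u v : ℕ) : ratOf (ratMin u v) = min (ratOf u) (ratOf v) := by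
  unfold ratMin
  split_ifs with h
  · exact (min_eq_left h).symm
  · exact (min_eq_right (le_of_not_ge h)).symm

theorem ratOf_ratMax (u v : ℕ) : ratOf (ratMax u v) = max (ratOf u) (ratOf v) := by
  unfold ratMax
  split_ifs with h
  · exact (max_eq_right h).symm
  · exact (max_eq_left (le_of_not_ge h)).symm

theorem primrec_ratMin : Primrec₂ ratMin :=
  Primrec.ite primrecRel_ratOf_le Primrec.fst Primrec.snd

theorem primrec_ratMax : Primrec₂ ratMax :=
  Primrec.ite primrecRel_ratOf_le Primrec.snd Primrec.fst

/-! ### Finite unions of rational intervals -/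

/-- The left end point of the interval named by `n`. -/
def leftEnd (n : ℕ) : ℚ := ratOf n.unpair.1

/-- The right end point of the interval named by `n`. -/
def rightEnd (n : ℕ) : ℚ := ratOf n.unpair.2

theorem mem_openInterval {n : ℕ} {z : ℝ} :
    z ∈ openInterval n ↔ (leftEnd n : ℝ) < z ∧ z < rightEnd n :=
  Iff.rfl

theorem mem_closedInterval {n : ℕ} {z : ℝ} :
    z ∈ closedInterval n ↔ (leftEnd n : ℝ) ≤ z ∧ z ≤ rightEnd n :=
  Iff.rfl

theorem openInterval_subset_closedInterval (n : ℕ) : openInterval n ⊆ closedInterval n :=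
  Set.Ioo_subset_Icc_self

theorem isOpen_openInterval (n : ℕ) : IsOpen (openInterval n) := isOpen_Ioo

theorem volume_openInterval (n : ℕ) :
    volume (openInterval n) = ENNReal.ofReal ((rightEnd n : ℝ) - leftEnd n) := Real.volume_Ioo

/-- The union of the open intervals in a list. -/
def openUnion (l : List ℕ) : Set ℝ := ⋃ n ∈ l, openInterval n

/-- The union of the closed intervals in a list. -/
def closedUnion (l : List ℕ) : Set ℝ := ⋃ n ∈ l, closedInterval n

theorem mem_openUnion {l : List ℕ} {z : ℝ} : z ∈ openUnion l ↔ ∃ n ∈ l, z ∈ openInterval n := by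
  simp [openUnion]

theorem mem_closedUnion {l : List ℕ} {z : ℝ} :
    z ∈ closedUnion l ↔ ∃ n ∈ l, z ∈ closedInterval n := by
  simp [closedUnion]

theorem isOpen_openUnion (l : List ℕ) : IsOpen (openUnion l) :=
  isOpen_biUnion fun n _ => isOpen_openInterval n

theorem openUnion_mono {l l' : List ℕ} (h : l ⊆ l') : openUnion l ⊆ openUnion l' := by
  intro z hz
  obtain ⟨n, hn, hz⟩ := mem_openUnion.1 hz
  exact mem_openUnion.2 ⟨n, h hn, hz⟩

/-- The difference of the open interval `I` and the closed interval `J`, as a list of at most two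
disjoint open intervals. -/
def cut (I J : ℕ) : List ℕ :=
  if ratOf J.unpair.1 ≤ ratOf J.unpair.2 then
    [Nat.pair I.unpair.1 (ratMin I.unpair.2 J.unpair.1),
      Nat.pair (ratMax I.unpair.1 J.unpair.2) I.unpair.2]
  else [I]

theorem primrec_cut : Primrec₂ cut := by
  have h1 := Primrec.fst.comp Primrec.unpair
  have h2 := Primrec.snd.comp Primrec.unpair
  have hI := Primrec.fst (α := ℕ) (β := ℕ)
  have hJ := Primrec.snd (α := ℕ) (β := ℕ)
  refine Primrec.ite (primrecRel_ratOf_le.comp (h1.comp hJ) (h2.comp hJ)) ?_ ?_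
  · exact Primrec.list_cons.comp (Primrec₂.natPair.comp (h1.comp hI)
      (primrec_ratMin.comp (h2.comp hI) (h1.comp hJ))) (Primrec.list_cons.comp
      (Primrec₂.natPair.comp (primrec_ratMax.comp (h1.comp hI) (h2.comp hJ)) (h2.comp hI))
      (Primrec.const []))
  · exact Primrec.list_cons.comp hI (Primrec.const [])

theorem openUnion_cut (I J : ℕ) : openUnion (cut I J) = openInterval I \ closedInterval J := by
  ext z
  rw [mem_openUnion]
  unfold cut
  split_ifs with h
  · simp only [List.mem_cons, List.not_mem_nil, or_false, exists_eq_or_imp, exists_eq_left,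
      openInterval, closedInterval, Nat.unpair_pair, ratOf_ratMin, ratOf_ratMax, Set.mem_sdiff,
      Set.mem_Ioo, Set.mem_Icc, Rat.cast_min, Rat.cast_max, lt_min_iff, max_lt_iff]
    have h' : (ratOf J.unpair.1 : ℝ) ≤ ratOf J.unpair.2 := by exact_mod_cast h
    constructor
    · rintro (⟨a, b, c⟩ | ⟨⟨a, b⟩, c⟩)
      · exact ⟨⟨a, b⟩, fun k => absurd k.1 (not_le.2 c)⟩
      · exact ⟨⟨a, c⟩, fun k => absurd k.2 (not_le.2 b)⟩
    · rintro ⟨⟨a, b⟩, c⟩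
      by_cases hz : z < ratOf J.unpair.1
      · exact Or.inl ⟨a, b, hz⟩
      · exact Or.inr ⟨⟨a, not_le.1 fun k => c ⟨not_lt.1 hz, k⟩⟩, b⟩
  · have h' : ¬ (ratOf J.unpair.1 : ℝ) ≤ ratOf J.unpair.2 := by exact_mod_cast h
    simp only [List.mem_singleton, exists_eq_left, Set.mem_sdiff]
    exact ⟨fun k => ⟨k, fun c => h' (c.1.trans c.2)⟩, fun k => k.1⟩

theorem closedInterval_diff_subset_cut (I J : ℕ) :
    closedInterval I \ openInterval J ⊆ closedUnion (cut I J) := by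
  intro z
  rw [mem_closedUnion]
  unfold cut
  split_ifs with h
  · simp only [List.mem_cons, List.not_mem_nil, or_false, exists_eq_or_imp, exists_eq_left,
      openInterval, closedInterval, Nat.unpair_pair, ratOf_ratMin, ratOf_ratMax, Set.mem_sdiff,
      Set.mem_Ioo, Set.mem_Icc, Rat.cast_min, Rat.cast_max, le_min_iff, max_le_iff]
    rintro ⟨⟨a, b⟩, c⟩
    by_cases hz : z ≤ ratOf J.unpair.1
    · exact Or.inl ⟨a, b, hz⟩
    · exact Or.inr ⟨⟨a, not_lt.1 fun k => c ⟨not_le.1 hz, k⟩⟩, b⟩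
  · simp only [List.mem_singleton, exists_eq_left, Set.mem_sdiff]
    exact fun k => k.1

theorem pairwise_disjoint_cut (I J : ℕ) :
    (cut I J).Pairwise fun m n => Disjoint (openInterval m) (openInterval n) := by
  unfold cut
  split_ifs with h
  · rw [List.pairwise_pair, Set.disjoint_left]
    simp only [openInterval, Nat.unpair_pair, ratOf_ratMin, ratOf_ratMax, Set.mem_Ioo,
      Rat.cast_min, Rat.cast_max, lt_min_iff, max_lt_iff]
    have h' : (ratOf J.unpair.1 : ℝ) ≤ ratOf J.unpair.2 := by exact_mod_cast h
    rintro z ⟨-, -, a⟩ ⟨⟨-, b⟩, -⟩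
    linarith
  · exact List.pairwise_singleton _ _

/-- The difference of the union of the open intervals in `P` and the union of the closed intervals
in `l`, as a list of open intervals. -/
def cutList (P l : List ℕ) : List ℕ := l.foldl (fun P J => P.flatMap fun I => cut I J) P

theorem primrec_cutList : Primrec₂ cutList :=
  Primrec.list_foldl Primrec.snd Primrec.fst (Primrec.list_flatMap
    (Primrec.fst.comp Primrec.snd)
    (primrec_cut.comp Primrec.snd (Primrec.snd.comp (Primrec.snd.comp Primrec.fst))).to₂).to₂

theorem openUnion_flatMap_cut (P : List ℕ) (J : ℕ) :
    openUnion (P.flatMap fun I => cut I J) = openUnion P \ closedInterval J := by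
  ext z
  have h : ∀ I, (∃ n ∈ cut I J, z ∈ openInterval n) ↔ z ∈ openInterval I ∧ z ∉ closedInterval J :=
    fun I => by rw [← mem_openUnion, openUnion_cut, Set.mem_sdiff]
  simp only [Set.mem_sdiff, mem_openUnion, List.mem_flatMap]
  constructor
  · rintro ⟨n, ⟨I, hI, hn⟩, hz⟩
    obtain ⟨h1, h2⟩ := (h I).1 ⟨n, hn, hz⟩
    exact ⟨⟨I, hI, h1⟩, h2⟩
  · rintro ⟨⟨I, hI, h1⟩, h2⟩
    obtain ⟨n, hn, hz⟩ := (h I).2 ⟨h1, h2⟩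
    exact ⟨n, ⟨I, hI, hn⟩, hz⟩

theorem openUnion_cutList (P l : List ℕ) :
    openUnion (cutList P l) = openUnion P \ closedUnion l := by
  induction l generalizing P with
  | nil => simp [cutList, closedUnion]
  | cons J l ih =>
    change openUnion (cutList _ l) = _
    rw [ih, openUnion_flatMap_cut, Set.sdiff_sdiff]
    congr 1
    simp [closedUnion]

/-- Closing the pieces restores all points outside the interiors of the removed intervals. -/
theorem closedUnion_diff_subset_cutList (P l : List ℕ) :
    closedUnion P \ openUnion l ⊆ closedUnion (cutList P l) := by
  induction l generalizing P with
  | nil => simp [cutList, openUnion]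
  | cons J l ih =>
    refine Set.Subset.trans ?_ (ih (P.flatMap fun I => cut I J))
    rintro z ⟨hz, hn⟩
    obtain ⟨I, hI, hzI⟩ := mem_closedUnion.1 hz
    have hJ : z ∉ openInterval J := fun h => hn (mem_openUnion.2 ⟨J, by simp, h⟩)
    obtain ⟨n, hnc, hzn⟩ := mem_closedUnion.1 (closedInterval_diff_subset_cut I J ⟨hzI, hJ⟩)
    refine ⟨mem_closedUnion.2 ⟨n, List.mem_flatMap.2 ⟨I, hI, hnc⟩, hzn⟩, fun h => hn ?_⟩
    exact openUnion_mono (by simp) h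

theorem pairwise_disjoint_cutList {P : List ℕ} (l : List ℕ)
    (hP : P.Pairwise fun m n => Disjoint (openInterval m) (openInterval n)) :
    (cutList P l).Pairwise fun m n => Disjoint (openInterval m) (openInterval n) := by
  induction l generalizing P with
  | nil => exact hP
  | cons J l ih =>
    refine ih (List.pairwise_flatMap.2 ⟨fun I _ => pairwise_disjoint_cut I J, hP.imp ?_⟩)
    intro I I' h m hm n hn
    have sub : ∀ K, ∀ k ∈ cut K J, openInterval k ⊆ openInterval K := fun K k hk z hz =>
      ((openUnion_cut K J).subset (mem_openUnion.2 ⟨k, hk, hz⟩)).1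
    exact h.mono (sub I m hm) (sub I' n hn)

/-- A list of disjoint open intervals whose union agrees with that of `l` up to finitely many
points. -/
def disjointify : List ℕ → List ℕ
  | [] => []
  | I :: l => cutList [I] l ++ disjointify l

theorem primrec_disjointify : Primrec disjointify := by
  have h : Primrec fun l : List ℕ => List.recOn (motive := fun _ => List ℕ) l []
      fun I l IH => cutList [I] l ++ IH :=
    Primrec.list_rec Primrec.id (Primrec.const []) (Primrec.list_append.comp
      (primrec_cutList.comp (Primrec.list_cons.comp (Primrec.fst.comp Primrec.snd)
        (Primrec.const [])) (Primrec.fst.comp (Primrec.snd.comp Primrec.snd)))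
      (Primrec.snd.comp (Primrec.snd.comp Primrec.snd))).to₂
  refine h.of_eq fun l => ?_
  induction l with
  | nil => rfl
  | cons I l ih => rw [disjointify, ← ih]

/-- A name of the length of an interval. -/
def lengthName (n : ℕ) : ℕ :=
  if ratOf n.unpair.1 ≤ ratOf n.unpair.2 then ratAdd n.unpair.2 (ratNeg n.unpair.1) else 0

theorem primrec_lengthName : Primrec lengthName := by
  have h1 := Primrec.fst.comp Primrec.unpair
  have h2 := Primrec.snd.comp Primrec.unpair
  exact Primrec.ite (primrecRel_ratOf_le.comp h1 h2)
    (primrec_ratAdd.comp h2 (primrec_ratNeg.comp h1)) (Primrec.const 0)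

theorem ratOf_lengthName (n : ℕ) : ratOf (lengthName n) = max (rightEnd n - leftEnd n) 0 := by
  unfold lengthName leftEnd rightEnd
  split_ifs with h
  · rw [ratOf_ratAdd, ratOf_ratNeg, max_eq_left (by linarith)]
    ring
  · rw [ratOf_zero, max_eq_right (by linarith [not_le.1 h])]

/-- A name of the sum of the rationals named in a list. -/
def ratSum (l : List ℕ) : ℕ := l.foldr ratAdd 0

theorem primrec_ratSum : Primrec ratSum :=
  Primrec.list_foldr Primrec.id (Primrec.const 0)
    (primrec_ratAdd.comp (Primrec.fst.comp Primrec.snd) (Primrec.snd.comp Primrec.snd)).to₂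

theorem ratOf_ratSum (l : List ℕ) : ratOf (ratSum l) = (l.map ratOf).sum := by
  induction l with
  | nil => exact ratOf_zero
  | cons a l ih =>
    rw [List.map_cons, List.sum_cons, ← ih]
    exact ratOf_ratAdd _ _

/-- A name of the measure of the union of the open intervals in a list. -/
def measureName (l : List ℕ) : ℕ := ratSum ((disjointify l).map lengthName)

theorem primrec_measureName : Primrec measureName :=
  primrec_ratSum.comp (Primrec.list_map primrec_disjointify
    (primrec_lengthName.comp Primrec.snd).to₂)

theorem ratOf_measureName_nonneg (l : List ℕ) : 0 ≤ ratOf (measureName l) := by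
  rw [measureName, ratOf_ratSum]
  refine List.sum_nonneg fun x hx => ?_
  simp only [List.map_map, List.mem_map, Function.comp_apply] at hx
  obtain ⟨n, -, rfl⟩ := hx
  rw [ratOf_lengthName]
  exact le_max_right _ _

theorem volume_openInterval_eq (n : ℕ) :
    volume (openInterval n) = ENNReal.ofReal (ratOf (lengthName n)) := by
  rw [volume_openInterval, ratOf_lengthName]
  push_cast
  rcases le_total (0 : ℝ) ((rightEnd n : ℝ) - leftEnd n) with h | h
  · rw [max_eq_left h]
  · rw [max_eq_right h, ENNReal.ofReal_of_nonpos h, ENNReal.ofReal_zero]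

theorem volume_openUnion_of_pairwise {l : List ℕ}
    (h : l.Pairwise fun m n => Disjoint (openInterval m) (openInterval n)) :
    volume (openUnion l) = ENNReal.ofReal (ratOf (ratSum (l.map lengthName))) := by
  induction l with
  | nil => simp [openUnion, ratOf_ratSum]
  | cons I l ih =>
    rw [List.pairwise_cons] at h
    have e : openUnion (I :: l) = openInterval I ∪ openUnion l := by simp [openUnion]
    have hd : Disjoint (openInterval I) (openUnion l) := by
      rw [openUnion, Set.disjoint_iUnion₂_right]
      exact h.1
    have h0 : ∀ l : List ℕ, (0 : ℝ) ≤ ratOf (ratSum (l.map lengthName)) := fun l => by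
      rw [ratOf_ratSum]
      have : 0 ≤ ((l.map lengthName).map ratOf).sum := by
        refine List.sum_nonneg fun x hx => ?_
        simp only [List.map_map, List.mem_map, Function.comp_apply] at hx
        obtain ⟨n, -, rfl⟩ := hx
        rw [ratOf_lengthName]
        exact le_max_right _ _
      exact_mod_cast this
    have h1 : (0 : ℝ) ≤ ratOf (lengthName I) := by
      rw [ratOf_lengthName]
      exact_mod_cast le_max_right _ _
    rw [e, measure_union hd (isOpen_openUnion l).measurableSet, ih h.2, volume_openInterval_eq,
      ← ENNReal.ofReal_add h1 (h0 l)]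
    congr 1
    rw [List.map_cons, ← Rat.cast_add]
    congr 1
    exact (ratOf_ratAdd _ _).symm

theorem closedInterval_diff_openInterval_countable (n : ℕ) :
    (closedInterval n \ openInterval n).Countable := by
  refine (Set.toFinite ({(leftEnd n : ℝ), (rightEnd n : ℝ)} : Set ℝ)).countable.mono ?_
  rintro z ⟨h1, h2⟩
  rw [mem_closedInterval] at h1
  rw [mem_openInterval, not_and_or] at h2
  rcases h2 with h2 | h2
  · exact Or.inl (le_antisymm (not_lt.1 h2) h1.1)
  · exact Or.inr (le_antisymm h1.2 (not_lt.1 h2))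

/-- Replacing a list of open intervals by disjoint pieces loses at most finitely many points; it is
enough for the measure that the loss is countable. -/
theorem disjointify_spec (l : List ℕ) :
    ((disjointify l).Pairwise fun m n => Disjoint (openInterval m) (openInterval n)) ∧
      openUnion (disjointify l) ⊆ openUnion l ∧
      (openUnion l \ openUnion (disjointify l)).Countable := by
  induction l with
  | nil => simp [disjointify, openUnion]
  | cons I l ih =>
    obtain ⟨h1, h2, h3⟩ := ih
    have e : openUnion (I :: l) = openInterval I ∪ openUnion l := by simp [openUnion]
    have e' : openUnion (disjointify (I :: l)) =
        openUnion (cutList [I] l) ∪ openUnion (disjointify l) := by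
      ext z
      simp only [disjointify, mem_openUnion, List.mem_append, Set.mem_union]
      exact ⟨fun ⟨n, hn, hz⟩ => hn.imp (fun h => ⟨n, h, hz⟩) fun h => ⟨n, h, hz⟩,
        fun h => h.elim (fun ⟨n, hn, hz⟩ => ⟨n, Or.inl hn, hz⟩)
          fun ⟨n, hn, hz⟩ => ⟨n, Or.inr hn, hz⟩⟩
    have hI : openUnion [I] = openInterval I := by simp [openUnion]
    have hcl : openUnion l ⊆ closedUnion l := fun z hz => by
      obtain ⟨n, hn, hz⟩ := mem_openUnion.1 hz
      exact mem_closedUnion.2 ⟨n, hn, openInterval_subset_closedInterval n hz⟩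
    refine ⟨?_, ?_, ?_⟩
    · rw [disjointify, List.pairwise_append]
      refine ⟨pairwise_disjoint_cutList l (List.pairwise_singleton _ _), h1, fun m hm n hn => ?_⟩
      rw [Set.disjoint_left]
      intro z hzm hzn
      have hz1 := (openUnion_cutList [I] l).subset (mem_openUnion.2 ⟨m, hm, hzm⟩)
      exact hz1.2 (hcl (h2 (mem_openUnion.2 ⟨n, hn, hzn⟩)))
    · rw [e', e, openUnion_cutList, hI]
      exact Set.union_subset_union Set.sdiff_subset h2
    · have hc : (⋃ n ∈ l, closedInterval n \ openInterval n).Countable :=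
        (List.finite_toSet l).countable.biUnion fun n _ =>
          closedInterval_diff_openInterval_countable n
      refine (hc.union h3).mono ?_
      rw [e', e, openUnion_cutList, hI]
      rintro z ⟨hz, hn⟩
      simp only [Set.mem_union, Set.mem_sdiff, not_or, not_and, not_not] at hn
      by_cases hzl : z ∈ openUnion l
      · exact Or.inr ⟨hzl, hn.2⟩
      · refine Or.inl ?_
        obtain ⟨n, hnl, hzn⟩ := mem_closedUnion.1 (hn.1 (hz.resolve_right hzl))
        exact Set.mem_biUnion hnl ⟨hzn, fun h => hzl (mem_openUnion.2 ⟨n, hnl, h⟩)⟩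

theorem volume_openUnion (l : List ℕ) :
    volume (openUnion l) = ENNReal.ofReal (ratOf (measureName l)) := by
  obtain ⟨h1, h2, h3⟩ := disjointify_spec l
  rw [measureName, ← volume_openUnion_of_pairwise h1]
  refine le_antisymm ?_ (measure_mono h2)
  calc volume (openUnion l)
      ≤ volume (openUnion (disjointify l) ∪ (openUnion l \ openUnion (disjointify l))) :=
        measure_mono fun z hz => by
          by_cases h : z ∈ openUnion (disjointify l)
          · exact Or.inl h
          · exact Or.inr ⟨hz, h⟩
    _ ≤ _ := (measure_union_le _ _).trans (by rw [h3.measure_zero, add_zero])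

theorem volume_openUnion_ne_top (l : List ℕ) : volume (openUnion l) ≠ ∞ := by
  rw [volume_openUnion]
  exact ENNReal.ofReal_ne_top

theorem volume_openUnion_toReal (l : List ℕ) :
    (volume (openUnion l)).toReal = ratOf (measureName l) := by
  rw [volume_openUnion, ENNReal.toReal_ofReal]
  exact_mod_cast ratOf_measureName_nonneg l

/-- The pairwise intersections of the open intervals in two lists. -/
def interList (l l' : List ℕ) : List ℕ :=
  l.flatMap fun I => l'.map fun J =>
    Nat.pair (ratMax I.unpair.1 J.unpair.1) (ratMin I.unpair.2 J.unpair.2)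

theorem primrec_interList : Primrec₂ interList := by
  have h1 := Primrec.fst.comp Primrec.unpair
  have h2 := Primrec.snd.comp Primrec.unpair
  have hI := Primrec.snd.comp (Primrec.fst (α := (List ℕ × List ℕ) × ℕ) (β := ℕ))
  have hJ := Primrec.snd (α := (List ℕ × List ℕ) × ℕ) (β := ℕ)
  exact Primrec.list_flatMap Primrec.fst (Primrec.list_map (Primrec.snd.comp Primrec.fst)
    (Primrec₂.natPair.comp (primrec_ratMax.comp (h1.comp hI) (h1.comp hJ))
      (primrec_ratMin.comp (h2.comp hI) (h2.comp hJ))).to₂).to₂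

theorem openUnion_interList (l l' : List ℕ) :
    openUnion (interList l l') = openUnion l ∩ openUnion l' := by
  ext z
  simp only [interList, Set.mem_inter_iff, mem_openUnion, List.mem_flatMap, List.mem_map]
  constructor
  · rintro ⟨n, ⟨I, hI, J, hJ, rfl⟩, hz⟩
    simp only [openInterval, Nat.unpair_pair, ratOf_ratMin, ratOf_ratMax, Set.mem_Ioo,
      Rat.cast_min, Rat.cast_max, lt_min_iff, max_lt_iff] at hz
    exact ⟨⟨I, hI, hz.1.1, hz.2.1⟩, J, hJ, hz.1.2, hz.2.2⟩
  · rintro ⟨⟨I, hI, hz1, hz2⟩, J, hJ, hz3, hz4⟩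
    refine ⟨_, ⟨I, hI, J, hJ, rfl⟩, ?_⟩
    simp only [openInterval, Nat.unpair_pair, ratOf_ratMin, ratOf_ratMax, Set.mem_Ioo,
      Rat.cast_min, Rat.cast_max, lt_min_iff, max_lt_iff]
    exact ⟨⟨hz1, hz3⟩, hz2, hz4⟩

/-- The interval named by `n` with both end points moved outwards by the rational named by `e`. -/
def enlarge (e n : ℕ) : ℕ :=
  Nat.pair (ratAdd n.unpair.1 (ratNeg e)) (ratAdd n.unpair.2 e)

theorem primrec_enlarge : Primrec₂ enlarge := by
  have h1 := Primrec.fst.comp Primrec.unpair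
  have h2 := Primrec.snd.comp Primrec.unpair
  have he := Primrec.fst (α := ℕ) (β := ℕ)
  have hn := Primrec.snd (α := ℕ) (β := ℕ)
  exact Primrec₂.natPair.comp (primrec_ratAdd.comp (h1.comp hn) (primrec_ratNeg.comp he))
    (primrec_ratAdd.comp (h2.comp hn) he)

theorem leftEnd_enlarge (e n : ℕ) : leftEnd (enlarge e n) = leftEnd n - ratOf e := by
  simp [leftEnd, enlarge, ratOf_ratAdd, ratOf_ratNeg, sub_eq_add_neg]

theorem rightEnd_enlarge (e n : ℕ) : rightEnd (enlarge e n) = rightEnd n + ratOf e := by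
  simp [rightEnd, enlarge, ratOf_ratAdd]

/-! ### Interval sequence tests from lists computed by the halting problem -/

/-- Every `Σ₁` set is the domain of a program. -/
theorem exists_code_dom_iff {R : ℕ → ℕ → Prop} (hR : PrimrecRel R) :
    ∃ c : Code, ∀ n, (c.eval n).Dom ↔ ∃ v, R n v := by
  classical
  have h : Partrec fun n => Nat.rfind fun v => Part.some (decide (R n v)) :=
    Partrec.rfind (p := fun n v => Part.some (decide (R n v))) hR.decide.to_comp.partrec
  obtain ⟨c, hc⟩ := Code.exists_code.1 (Partrec.nat_iff.1 h)
  refine ⟨c, fun n => ?_⟩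
  rw [hc]
  refine Nat.rfind_dom.trans ?_
  simp

namespace OracleCode

open Classical in
/-- The least witness below `s` not refuted before stage `s`, and `s` if there is none. -/
noncomputable def guess (c : OracleCode) (x s : ℕ) : ℕ :=
  (List.range s).findIdx fun w => decide (∀ v < s, Certifies c x w v)

theorem primrec_guess (c : OracleCode) : Primrec₂ (guess c) := by
  classical
  have hR : PrimrecRel fun (v : ℕ) (q : ℕ × ℕ) => Certifies c q.1 q.2 v :=
    primrecPred_certifies.comp (Primrec.pair (Primrec.pair (Primrec.pair (Primrec.const c)
      (Primrec.fst.comp Primrec.snd)) (Primrec.snd.comp Primrec.snd)) Primrec.fst)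
  have hp : PrimrecRel fun (q : ℕ × ℕ) (w : ℕ) => ∀ v < q.2, Certifies c q.1 w v :=
    (hR.forall_mem_list.comp (Primrec.list_range.comp (Primrec.snd.comp Primrec.fst))
      (Primrec.pair (Primrec.fst.comp Primrec.fst) Primrec.snd)).of_eq fun q => by simp
  exact Primrec.list_findIdx (Primrec.list_range.comp Primrec.snd) hp.decide

/-- The guesses converge to the least correct witness. -/
theorem eventually_guess {c : OracleCode} {x : ℕ} (h : ∃ w, ∀ v, Certifies c x w v) :
    ∃ w, (∀ v, Certifies c x w v) ∧ ∀ᶠ s in atTop, guess c x s = w := by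
  classical
  refine ⟨Nat.find h, Nat.find_spec h, ?_⟩
  have h1 : ∀ᶠ s in atTop, ∀ w ∈ Finset.range (Nat.find h), ∃ v < s, ¬ Certifies c x w v := by
    refine (Finset.eventually_all _).2 fun w hw => ?_
    obtain ⟨v, hv⟩ := not_forall.1 (Nat.find_min h (Finset.mem_range.1 hw))
    filter_upwards [eventually_gt_atTop v] with s hs
    exact ⟨v, hs, hv⟩
  filter_upwards [h1, eventually_gt_atTop (Nat.find h)] with s hs hgt
  unfold guess
  rw [List.findIdx_eq (by simpa using hgt)]
  refine ⟨by simpa using fun v _ => Nat.find_spec h v, fun j hj => ?_⟩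
  simpa using hs j (Finset.mem_range.2 hj)

/-- The list of intervals proposed by the witness `w`. -/
noncomputable def stageList (c : OracleCode) (x w : ℕ) : List ℕ :=
  ((Encodable.decode ((stageEval c x w).getD 0) : Option (List ℕ))).getD []

theorem primrec_stageList (c : OracleCode) : Primrec₂ (stageList c) :=
  Primrec.option_getD.comp (Primrec.decode.comp (Primrec.option_getD.comp
    (primrec_stageEval.comp (Primrec.pair (Primrec.pair (Primrec.const c) Primrec.fst)
      Primrec.snd)) (Primrec.const 0))) (Primrec.const [])

end OracleCode

open OracleCode in
/-- If the halting problem computes finite lists of intervals `f (S, m, r)`, uniformly in `S`, then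
there are an interval sequence and finite c.e. sets, computable from `S`, with the union of the
remaining intervals equal to the union of the list. The `k`-th interval, `k = ⟨s, i⟩ + 1`, is the
`i`-th interval of the list guessed at stage `s`; it is removed if the guess changes later. -/
theorem exists_intervalIndex_of_recursiveIn {α : Type*} [Primcodable α]
    {f : α × ℕ × ℕ →. List ℕ} (hf : RecursiveIn {zeroJump} f) :
    ∃ F : α → IntervalIndex, Computable F ∧ ∀ S m r, ∀ l ∈ f (S, m, r),
      (∀ k, 0 < k → ((F S).1.eval (Nat.pair m (Nat.pair r k))).Dom) ∧ ((F S).E m r).Finite ∧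
      (⋃ k ∈ {k | 0 < k ∧ k ∉ (F S).E m r}, (F S).Q m r k) = openUnion l := by
  obtain ⟨c, hc⟩ := OracleCode.exists_code.1 hf
  -- components of the input `⟨S, ⟨m, ⟨r, k⟩⟩⟩`
  have h1 := Primrec.fst.comp Primrec.unpair
  have h2 := Primrec.snd.comp Primrec.unpair
  let X : ℕ → ℕ := fun n => Nat.pair n.unpair.1
    (Nat.pair n.unpair.2.unpair.1 n.unpair.2.unpair.2.unpair.1)
  let s : ℕ → ℕ := fun n => (n.unpair.2.unpair.2.unpair.2 - 1).unpair.1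
  let i : ℕ → ℕ := fun n => (n.unpair.2.unpair.2.unpair.2 - 1).unpair.2
  have hX : Primrec X := Primrec₂.natPair.comp h1 (Primrec₂.natPair.comp (h1.comp h2)
    (h1.comp (h2.comp h2)))
  have hk : Primrec fun n : ℕ => n.unpair.2.unpair.2.unpair.2 - 1 :=
    Primrec.nat_sub.comp (h2.comp (h2.comp h2)) (Primrec.const 1)
  have hs : Primrec s := h1.comp hk
  have hi : Primrec i := h2.comp hk
  have hl : Primrec fun n => stageList c (X n) (guess c (X n) (s n)) :=
    (primrec_stageList c).comp hX ((primrec_guess c).comp hX hs)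
  have hq : Primrec fun n => (stageList c (X n) (guess c (X n) (s n)))[i n]?.getD 0 :=
    Primrec.option_getD.comp (Primrec.list_getElem?.comp hl hi) (Primrec.const 0)
  have he : PrimrecRel fun n v => i n < (stageList c (X n) (guess c (X n) (s n))).length ∧
      guess c (X n) (s n + v) ≠ guess c (X n) (s n) :=
    (Primrec.nat_lt.comp (hi.comp Primrec.fst)
      (Primrec.list_length.comp (hl.comp Primrec.fst))).and
    (Primrec.eq.comp ((primrec_guess c).comp (hX.comp Primrec.fst)
      (Primrec.nat_add.comp (hs.comp Primrec.fst) Primrec.snd))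
      (((primrec_guess c).comp hX hs).comp Primrec.fst)).not
  obtain ⟨qc, hqc⟩ := Code.exists_code.1 (Partrec.nat_iff.1 hq.to_comp.partrec)
  obtain ⟨ec, hec⟩ := exists_code_dom_iff he
  refine ⟨fun S => (qc.curry (Encodable.encode S), ec.curry (Encodable.encode S)), (Primrec.pair
    (Code.primrec₂_curry.comp (Primrec.const qc) Primrec.encode)
    (Code.primrec₂_curry.comp (Primrec.const ec) Primrec.encode)).to_comp, fun S m r l hlf => ?_⟩
  have hdec : Encodable.encode l ∈
      c.eval zeroJump (Nat.pair (Encodable.encode S) (Nat.pair m r)) := by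
    have e : Nat.pair (Encodable.encode S) (Nat.pair m r) = Encodable.encode (S, m, r) := rfl
    rw [hc, e]
    simp only [Encodable.encodek, Part.coe_some, Part.bind_some]
    exact Part.mem_map _ hlf
  obtain ⟨w, hw, hev⟩ := eventually_guess
    (eval_dom_zeroJump.1 (Part.dom_iff_mem.2 ⟨_, hdec⟩))
  have hwl : stageList c (Nat.pair (Encodable.encode S) (Nat.pair m r)) w = l := by
    obtain ⟨y, hy⟩ := Option.isSome_iff_exists.1 (hw 0).1
    have : y = Encodable.encode l :=
      Part.mem_unique (mem_eval_zeroJump.2 ⟨w, hw, hy⟩) hdec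
    simp [stageList, hy, this]
  generalize hx : Nat.pair (Encodable.encode S) (Nat.pair m r) = x at hev hwl
  have hQ : ∀ k, IntervalIndex.Q
      (qc.curry (Encodable.encode S), ec.curry (Encodable.encode S)) m r k = openInterval
      ((stageList c x (guess c x (k - 1).unpair.1))[(k - 1).unpair.2]?.getD 0) := by
    intro k
    ext z
    simp only [IntervalIndex.Q, Code.eval_curry, hqc, Set.mem_ofPred_eq, Part.mem_some_iff, X, s, i,
      Nat.unpair_pair, hx, PFun.coe_val, exists_eq_left]
  have hE : ∀ k, k ∈ IntervalIndex.E
      (qc.curry (Encodable.encode S), ec.curry (Encodable.encode S)) m r ↔ 0 < k ∧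
      (k - 1).unpair.2 < (stageList c x (guess c x (k - 1).unpair.1)).length ∧
      ∃ v, guess c x ((k - 1).unpair.1 + v) ≠ guess c x (k - 1).unpair.1 := by
    intro k
    simp only [IntervalIndex.E, Code.eval_curry, hec, Set.mem_ofPred_eq]
    simp only [X, s, i, Nat.unpair_pair, hx, exists_and_left]
  obtain ⟨N, hN⟩ := eventually_atTop.1 hev
  refine ⟨fun k _ => ?_, ?_, ?_⟩
  · simp only [Code.eval_curry, hqc]
    trivial
  · have hfin : (⋃ a ∈ Set.Iio N, (fun b => Nat.pair a b + 1) ''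
        Set.Iio (stageList c x (guess c x a)).length).Finite :=
      (Set.finite_Iio N).biUnion fun a _ => (Set.finite_Iio _).image _
    refine hfin.subset fun k hkE => ?_
    obtain ⟨hk0, hlen, v, hv⟩ := (hE k).1 hkE
    refine Set.mem_biUnion (x := (k - 1).unpair.1) ?_ ⟨(k - 1).unpair.2, hlen, ?_⟩
    · rw [Set.mem_Iio]
      by_contra hge
      exact hv ((hN _ (by omega)).trans (hN _ (by omega)).symm)
    · simp only [Nat.pair_unpair]
      omega
  · ext z
    simp only [Set.mem_ofPred_eq, Set.mem_iUnion, hQ, hE, mem_openUnion, exists_prop]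
    constructor
    · rintro ⟨k, ⟨hk0, hkE⟩, hz⟩
      rcases hopt : (stageList c x (guess c x (k - 1).unpair.1))[(k - 1).unpair.2]? with - | n
      · simp [hopt, openInterval] at hz
      · obtain ⟨hlen, hget⟩ := List.getElem?_eq_some_iff.1 hopt
        have hst : ∀ v, guess c x ((k - 1).unpair.1 + v) = guess c x (k - 1).unpair.1 := by
          by_contra hne
          exact hkE ⟨hk0, hlen, not_forall.1 hne⟩
        have hgw : guess c x (k - 1).unpair.1 = w := (hst N).symm.trans (hN _ (by omega))
        rw [hgw, hwl] at hopt hz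
        rw [hopt, Option.getD_some] at hz
        exact ⟨n, List.mem_of_getElem? hopt, hz⟩
    · rintro ⟨n, hn, hz⟩
      obtain ⟨j, hj⟩ := List.getElem?_of_mem hn
      refine ⟨Nat.pair N j + 1, ⟨Nat.succ_pos _, ?_⟩, ?_⟩
      · simp only [Nat.add_sub_cancel, Nat.unpair_pair]
        rintro ⟨-, -, v, hv⟩
        exact hv ((hN _ (by omega)).trans (hN _ le_rfl).symm)
      · simp only [Nat.add_sub_cancel, Nat.unpair_pair]
        rw [hN N le_rfl, hwl, hj, Option.getD_some]
        exact hz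

/-! ### From interval sequence tests to Schnorr tests -/

section

variable {α : Type*} [Primcodable α]

theorem exists_oracleCode_of_recursiveIn {f : α →. ℕ} {g : ℕ →. ℕ} (hf : RecursiveIn {g} f) :
    ∃ c : OracleCode, ∀ a, c.eval g (Encodable.encode a) = f a := by
  obtain ⟨c, hc⟩ := OracleCode.exists_code.1 hf
  refine ⟨c, fun a => ?_⟩
  rw [hc]
  simp [Part.map_id']

open Classical in
theorem mem_search {P : ℕ → ℕ → Prop} {w : ℕ}
    (h : w ∈ Nat.rfind fun w => Part.some (decide (∀ v, P w v))) : ∀ v, P w v := by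
  have := Nat.rfind_spec h
  simpa using this

open Classical in
theorem search_dom {P : ℕ → ℕ → Prop} :
    (Nat.rfind fun w => Part.some (decide (∀ v, P w v))).Dom ↔ ∃ w, ∀ v, P w v := by
  refine Nat.rfind_dom.trans ?_
  simp

/-- Every `Σ₂` set is the domain of a program with the halting problem as oracle. -/
theorem exists_oracleCode_dom_iff {R : α → ℕ → ℕ → Prop}
    (hR : PrimrecPred fun p : (α × ℕ) × ℕ => R p.1.1 p.1.2 p.2) :
    ∃ c : OracleCode, ∀ a, (c.eval zeroJump (Encodable.encode a)).Dom ↔ ∃ w, ∀ v, R a w v := by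
  obtain ⟨c, hc⟩ := exists_oracleCode_of_recursiveIn (RecursiveIn.search hR)
  refine ⟨c, fun a => ?_⟩
  rw [hc]
  exact search_dom

end

/-- Approximations with half the permitted error form a Cauchy name. -/
theorem isCauchyName_of_abs_sub_le {q : ℕ → ℕ} {x : ℝ}
    (h : ∀ j, |(ratOf (q j) : ℝ) - x| ≤ (1 / 2) ^ (j + 1)) : IsCauchyName q x := by
  refine ⟨fun n k hnk => ?_, ?_⟩
  · have h1 : |(ratOf (q k) : ℝ) - ratOf (q n)| ≤ (1 / 2) ^ n := by
      have e : (ratOf (q k) : ℝ) - ratOf (q n) = (ratOf (q k) - x) - (ratOf (q n) - x) := by ring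
      have hp : ((1 : ℝ) / 2) ^ (k + 1) ≤ (1 / 2) ^ (n + 1) :=
        pow_le_pow_of_le_one (by norm_num) (by norm_num) (by omega)
      calc |(ratOf (q k) : ℝ) - ratOf (q n)|
          ≤ |(ratOf (q k) : ℝ) - x| + |(ratOf (q n) : ℝ) - x| := by
            rw [e]
            exact abs_sub _ _
        _ ≤ (1 / 2) ^ (n + 1) + (1 / 2) ^ (n + 1) := add_le_add ((h k).trans hp) (h n)
        _ = (1 / 2) ^ n := by ring
    rw [← Rat.cast_le (K := ℝ)]
    push_cast
    exact h1
  · rw [tendsto_iff_dist_tendsto_zero]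
    refine squeeze_zero (fun _ => dist_nonneg) (fun n => ?_)
      ((tendsto_pow_atTop_nhds_zero_of_lt_one (r := (1 / 2 : ℝ)) (by norm_num)
        (by norm_num)).comp (tendsto_add_atTop_nat 1))
    exact h n

theorem IsCauchyName.abs_sub_le {q : ℕ → ℕ} {x : ℝ} (h : IsCauchyName q x) (j : ℕ) :
    |(ratOf (q j) : ℝ) - x| ≤ (1 / 2) ^ j := by
  have h1 : Tendsto (fun k => |(ratOf (q k) : ℝ) - ratOf (q j)|) atTop
      (𝓝 |x - ratOf (q j)|) := (h.2.sub_const _).abs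
  rw [abs_sub_comm]
  refine le_of_tendsto h1 ?_
  filter_upwards [eventually_ge_atTop j] with k hk
  have := (Rat.cast_le (K := ℝ)).2 (h.1 j k hk)
  push_cast at this
  exact this

theorem tsum_inv_two_pow (a : ℕ) : ∑' r : ℕ, (2⁻¹ : ℝ≥0∞) ^ (a + (r + 1)) = 2⁻¹ ^ a := by
  simp_rw [pow_add]
  rw [ENNReal.tsum_mul_left]
  have : ∑' r : ℕ, (2⁻¹ : ℝ≥0∞) ^ r * 2⁻¹ ^ 1 = 1 := by
    rw [ENNReal.tsum_mul_right, ENNReal.tsum_geometric, ENNReal.one_sub_inv_two, inv_inv, pow_one,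
      ENNReal.mul_inv_cancel (by norm_num) (by norm_num)]
  rw [this, mul_one]

theorem toReal_inv_two_pow (a : ℕ) : ((2⁻¹ : ℝ≥0∞) ^ a).toReal = (1 / 2 : ℝ) ^ a := by
  simp

theorem ofReal_half_pow (a : ℕ) : ENNReal.ofReal ((1 / 2 : ℝ) ^ a) = 2⁻¹ ^ a := by
  rw [ENNReal.ofReal_pow (by norm_num), one_div, ENNReal.ofReal_inv_of_pos (by norm_num)]
  simp

theorem primrec_evaln_comp {α : Type*} [Primcodable α] {u n : α → ℕ} {c : α → Code}
    (hu : Primrec u) (hc : Primrec c) (hn : Primrec n) :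
    Primrec fun a => Code.evaln (u a) (c a) (n a) :=
  Code.primrec_evaln.comp (Primrec.pair (Primrec.pair hu hc) hn)

namespace IntervalIndex

variable (T : IntervalIndex) (m : ℕ)

/-- The open set remaining of the `r`-th interval sequence after the removal of `E^m_r`. -/
def block (r : ℕ) : Set ℝ := ⋃ k ∈ {k | 0 < k ∧ k ∉ T.E m r}, T.Q m r k

/-- The union of the blocks of level `m`. -/
def level : Set ℝ := ⋃ r : ℕ, T.block m (r + 1)

/-- The union of the first `R` blocks of level `m`. -/
def partialLevel (R : ℕ) : Set ℝ := ⋃ r ∈ Finset.range R, T.block m (r + 1)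

theorem fails_iff {z : ℝ} : T.Fails z ↔ ∀ m, z ∈ T.level (m + 1) := by
  have h : ∀ m, z ∈ T.level m ↔ ∃ r, 0 < r ∧ ∃ k, 0 < k ∧ k ∉ T.E m r ∧ z ∈ T.Q m r k := by
    intro m
    simp only [level, block, Set.mem_iUnion, Set.mem_ofPred_eq, exists_prop, and_assoc]
    exact ⟨fun ⟨r, hr⟩ => ⟨r + 1, r.succ_pos, hr⟩, fun ⟨r, hr, h⟩ =>
      ⟨r - 1, by rwa [Nat.sub_add_cancel hr]⟩⟩
  simp only [h, Fails]
  exact ⟨fun H m => H (m + 1) m.succ_pos, fun H m hm => by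
    simpa [Nat.sub_add_cancel hm] using H (m - 1)⟩

variable {T m}

theorem IsTest.volume_block_le (hT : T.IsTest) (hm : 0 < m) (r : ℕ) :
    volume (T.block m (r + 1)) ≤ 2⁻¹ ^ (m + (r + 1)) :=
  (hT m (r + 1) hm r.succ_pos).2.2

theorem IsTest.volume_level_le (hT : T.IsTest) (hm : 0 < m) :
    volume (T.level m) ≤ 2⁻¹ ^ m :=
  (measure_iUnion_le _).trans
    ((ENNReal.tsum_le_tsum fun r => hT.volume_block_le hm r).trans (tsum_inv_two_pow m).le)

theorem partialLevel_subset (R : ℕ) : T.partialLevel m R ⊆ T.level m :=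
  Set.iUnion₂_subset fun r _ => Set.subset_iUnion (fun r => T.block m (r + 1)) r

/-- The blocks after the first `R` ones are negligible. -/
theorem IsTest.volume_level_le_add (hT : T.IsTest) (hm : 0 < m) (R : ℕ) :
    volume (T.level m) ≤ volume (T.partialLevel m R) + 2⁻¹ ^ (m + R) := by
  have hsub : T.level m ⊆ T.partialLevel m R ∪ ⋃ r : ℕ, T.block m (R + r + 1) := by
    refine Set.iUnion_subset fun r => ?_
    by_cases hr : r < R
    · exact Set.subset_union_of_subset_left (Set.subset_biUnion_of_mem
        (u := fun r => T.block m (r + 1)) (Finset.mem_coe.2 (Finset.mem_range.2 hr))) _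
    · refine Set.subset_union_of_subset_right ?_ _
      have := Set.subset_iUnion (fun r : ℕ => T.block m (R + r + 1)) (r - R)
      rwa [show R + (r - R) = r by omega] at this
  refine (measure_mono hsub).trans ((measure_union_le _ _).trans (add_le_add le_rfl ?_))
  refine (measure_iUnion_le _).trans (le_trans (ENNReal.tsum_le_tsum fun r => ?_)
    (tsum_inv_two_pow (m + R)).le)
  rw [add_assoc m R]
  exact hT.volume_block_le hm (R + r)

/-- The intervals of the first `R` blocks of level `m` as they appear at stage `s`. -/
def stageIntervals (T : IntervalIndex) (m R s : ℕ) : List ℕ :=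
  (List.range R).flatMap fun r => (List.range s).filterMap fun k =>
    if (Code.evaln s T.2 (Nat.pair m (Nat.pair (r + 1) (k + 1)))).isSome then none
    else Code.evaln s T.1 (Nat.pair m (Nat.pair (r + 1) (k + 1)))

theorem mem_stageIntervals {R s n : ℕ} : n ∈ T.stageIntervals m R s ↔ ∃ r < R, ∃ k < s,
    ¬ (Code.evaln s T.2 (Nat.pair m (Nat.pair (r + 1) (k + 1)))).isSome ∧
      Code.evaln s T.1 (Nat.pair m (Nat.pair (r + 1) (k + 1))) = some n := by
  simp [stageIntervals]

theorem primrec_stageIntervals : Primrec fun p : (IntervalIndex × ℕ) × ℕ × ℕ =>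
    stageIntervals p.1.1 p.1.2 p.2.1 p.2.2 := by
  let β := (((IntervalIndex × ℕ) × ℕ × ℕ) × ℕ) × ℕ
  have P : Primrec fun q : β => q.1.1 := Primrec.fst.comp Primrec.fst
  have T : Primrec fun q : β => q.1.1.1.1 := Primrec.fst.comp (Primrec.fst.comp P)
  have hm : Primrec fun q : β => q.1.1.1.2 := Primrec.snd.comp (Primrec.fst.comp P)
  have hs : Primrec fun q : β => q.1.1.2.2 := Primrec.snd.comp (Primrec.snd.comp P)
  have arg : Primrec fun q : β => Nat.pair q.1.1.1.2 (Nat.pair (q.1.2 + 1) (q.2 + 1)) :=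
    Primrec₂.natPair.comp hm (Primrec₂.natPair.comp
      (Primrec.succ.comp (Primrec.snd.comp Primrec.fst)) (Primrec.succ.comp Primrec.snd))
  have e1 : Primrec fun q : β => Code.evaln q.1.1.2.2 q.1.1.1.1.1
      (Nat.pair q.1.1.1.2 (Nat.pair (q.1.2 + 1) (q.2 + 1))) :=
    primrec_evaln_comp hs (Primrec.fst.comp T) arg
  have e2 : Primrec fun q : β => Code.evaln q.1.1.2.2 q.1.1.1.1.2
      (Nat.pair q.1.1.1.2 (Nat.pair (q.1.2 + 1) (q.2 + 1))) :=
    primrec_evaln_comp hs (Primrec.snd.comp T) arg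
  refine Primrec.list_flatMap
    (Primrec.list_range.comp (Primrec.fst.comp Primrec.snd)) (Primrec₂.mk ?_)
  refine Primrec.listFilterMap (Primrec.list_range.comp
    (Primrec.snd.comp (Primrec.snd.comp Primrec.fst))) (Primrec₂.mk ?_)
  exact Primrec.ite (Primrec.eq.comp (Primrec.option_isSome.comp e2) (Primrec.const true))
    (Primrec.const none) e1

/-- All removals from the first `R` blocks of level `m` have happened by stage `s`. -/
def Settled (T : IntervalIndex) (m R s : ℕ) : Prop :=
  ∀ r < R, ∀ k, (T.2.eval (Nat.pair m (Nat.pair (r + 1) (k + 1)))).Dom →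
    (Code.evaln s T.2 (Nat.pair m (Nat.pair (r + 1) (k + 1)))).isSome

theorem Settled.mono {R s t : ℕ} (h : T.Settled m R s) (hst : s ≤ t) : T.Settled m R t :=
  fun r hr k hk => evaln_isSome_mono hst (h r hr k hk)

theorem IsTest.exists_settled (hT : T.IsTest) (hm : 0 < m) (R : ℕ) : ∃ s, T.Settled m R s := by
  have h : ∀ᶠ s in atTop, ∀ r ∈ Finset.range R, ∀ k ∈ T.E m (r + 1),
      (Code.evaln s T.2 (Nat.pair m (Nat.pair (r + 1) k))).isSome := by
    refine (Finset.eventually_all _).2 fun r _ => ?_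
    refine (Set.Finite.eventually_all (hT m (r + 1) hm r.succ_pos).2.1).2 fun k hk => ?_
    obtain ⟨u, hu⟩ := eval_dom_iff_evaln.1 hk.2
    filter_upwards [eventually_ge_atTop u] with s hs
    exact evaln_isSome_mono hs hu
  obtain ⟨s, hs⟩ := h.exists
  exact ⟨s, fun r hr k hk => hs r (Finset.mem_range.2 hr) (k + 1) ⟨k.succ_pos, hk⟩⟩

/-- After a settled stage no interval is lost. -/
theorem Settled.stageIntervals_subset {R s t : ℕ} (h : T.Settled m R s) (hst : s ≤ t) :
    T.stageIntervals m R s ⊆ T.stageIntervals m R t := by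
  intro n hn
  obtain ⟨r, hr, k, hk, h1, h2⟩ := mem_stageIntervals.1 hn
  exact mem_stageIntervals.2 ⟨r, hr, k, hk.trans_le hst,
    fun h3 => h1 (h r hr k (eval_dom_iff_evaln.2 ⟨t, h3⟩)), Code.evaln_mono hst h2⟩

theorem Settled.monotone {R s : ℕ} (h : T.Settled m R s) :
    Monotone fun v => openUnion (T.stageIntervals m R (s + v)) := fun _ _ hvw =>
  openUnion_mono ((h.mono (Nat.le_add_right _ _)).stageIntervals_subset (by omega))

theorem mem_partialLevel {R : ℕ} {z : ℝ} : z ∈ T.partialLevel m R ↔ ∃ r < R, ∃ k,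
    ¬ (T.2.eval (Nat.pair m (Nat.pair (r + 1) (k + 1)))).Dom ∧
      ∃ n ∈ T.1.eval (Nat.pair m (Nat.pair (r + 1) (k + 1))), z ∈ openInterval n := by
  simp only [partialLevel, block, E, Q, Set.mem_iUnion, Set.mem_ofPred_eq, Finset.mem_range,
    exists_prop]
  refine exists_congr fun r => and_congr_right fun _ => ⟨?_, ?_⟩
  · rintro ⟨k, ⟨hk, hE⟩, hQ⟩
    obtain ⟨k, rfl⟩ := Nat.exists_eq_add_of_lt hk
    rw [zero_add] at hE hQ
    exact ⟨k, fun h => hE ⟨k.succ_pos, h⟩, hQ⟩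
  · rintro ⟨k, hE, hQ⟩
    exact ⟨k + 1, ⟨k.succ_pos, fun h => hE h.2⟩, hQ⟩

theorem Settled.iUnion_eq {R s : ℕ} (h : T.Settled m R s) :
    ⋃ v, openUnion (T.stageIntervals m R (s + v)) = T.partialLevel m R := by
  ext z
  simp only [Set.mem_iUnion, mem_openUnion, mem_partialLevel, mem_stageIntervals]
  constructor
  · rintro ⟨v, n, ⟨r, hr, k, -, h1, h2⟩, hz⟩
    exact ⟨r, hr, k, fun hd => h1 (evaln_isSome_mono (Nat.le_add_right _ _) (h r hr k hd)), n,
      Code.evaln_sound h2, hz⟩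
  · rintro ⟨r, hr, k, hd, n, hn, hz⟩
    obtain ⟨t, ht⟩ := Code.evaln_complete.1 hn
    exact ⟨k + 1 + t, n, ⟨r, hr, k, by omega, fun h3 => hd (eval_dom_iff_evaln.2 ⟨_, h3⟩),
      Code.evaln_mono (by omega) ht⟩, hz⟩

/-- The condition on a stage `s`, tested at stage `s + v`, that makes the intervals found by stage
`s` a good approximation to the first `R` blocks of level `m`: no removal happens after stage `s`,
and the measure grows by at most `2 ^ (-R)` after stage `s`. -/
def GoodStage (T : IntervalIndex) (m R s v : ℕ) : Prop :=
  (∀ r < R, ∀ k < s + v,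
    (Code.evaln (s + v) T.2 (Nat.pair m (Nat.pair (r + 1) (k + 1)))).isSome →
    (Code.evaln s T.2 (Nat.pair m (Nat.pair (r + 1) (k + 1)))).isSome) ∧
  ratOf (measureName (T.stageIntervals m R (s + v))) ≤
    ratOf (ratAdd (measureName (T.stageIntervals m R s)) (ratHalfPow R))

theorem settled_of_goodStage {R s : ℕ} (h : ∀ v, T.GoodStage m R s v) : T.Settled m R s := by
  intro r hr k hd
  obtain ⟨u, hu⟩ := eval_dom_iff_evaln.1 hd
  exact (h (k + 1 + u)).1 r hr k (by omega) (evaln_isSome_mono (by omega) hu)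

/-- The intervals found by a good stage approximate the first `R` blocks from inside, because the
measure of the union is the limit of the measures at later stages. -/
theorem openUnion_stageIntervals_approx {R s : ℕ} (h : ∀ v, T.GoodStage m R s v) :
    openUnion (T.stageIntervals m R s) ⊆ T.partialLevel m R ∧
    volume (T.partialLevel m R) ≤ volume (openUnion (T.stageIntervals m R s)) + 2⁻¹ ^ R := by
  have hS := settled_of_goodStage h
  refine ⟨hS.iUnion_eq ▸ Set.subset_iUnion
    (fun v => openUnion (T.stageIntervals m R (s + v))) 0, ?_⟩
  have ht := tendsto_measure_iUnion_atTop (μ := volume) hS.monotone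
  rw [hS.iUnion_eq] at ht
  refine le_of_tendsto' ht fun v => ?_
  have h2 := (h v).2
  rw [ratOf_ratAdd, ratOf_ratHalfPow] at h2
  have h0 : (0 : ℝ) ≤ ratOf (measureName (T.stageIntervals m R s)) := by
    exact_mod_cast ratOf_measureName_nonneg _
  simp only [Function.comp_apply]
  rw [volume_openUnion, volume_openUnion, ← ofReal_half_pow,
    ← ENNReal.ofReal_add h0 (by positivity)]
  refine ENNReal.ofReal_le_ofReal ?_
  have := (Rat.cast_le (K := ℝ)).2 h2
  push_cast at this
  exact this

theorem IsTest.exists_goodStage (hT : T.IsTest) (hm : 0 < m) (R : ℕ) :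
    ∃ s, ∀ v, T.GoodStage m R s v := by
  obtain ⟨s, hS⟩ := hT.exists_settled hm R
  have ht := tendsto_measure_iUnion_atTop (μ := volume) hS.monotone
  rw [hS.iUnion_eq] at ht
  have hfin : volume (T.partialLevel m R) ≠ ∞ :=
    ((measure_mono (partialLevel_subset R)).trans (hT.volume_level_le hm)).trans_lt
      (ENNReal.pow_lt_top (by simp)) |>.ne
  have ht' := (ENNReal.tendsto_toReal hfin).comp ht
  have hev : ∀ᶠ v in atTop, (volume (T.partialLevel m R)).toReal - (1 / 2) ^ R <
      (volume (openUnion (T.stageIntervals m R (s + v)))).toReal :=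
    ht'.eventually (lt_mem_nhds (by
      have : (0 : ℝ) < (1 / 2) ^ R := by positivity
      linarith))
  obtain ⟨v, hv⟩ := hev.exists
  refine ⟨s + v, fun w => ⟨fun r hr k _ h3 => ?_, ?_⟩⟩
  · exact hS.mono (Nat.le_add_right _ _) r hr k (eval_dom_iff_evaln.2 ⟨_, h3⟩)
  · have hsub : openUnion (T.stageIntervals m R (s + v + w)) ⊆ T.partialLevel m R := by
      rw [← hS.iUnion_eq, add_assoc]
      exact Set.subset_iUnion (fun v => openUnion (T.stageIntervals m R (s + v))) (v + w)
    have h1 := ENNReal.toReal_mono hfin (measure_mono (μ := volume) hsub)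
    rw [volume_openUnion_toReal] at h1 hv
    rw [ratOf_ratAdd, ratOf_ratHalfPow, ← Rat.cast_le (K := ℝ)]
    push_cast
    linarith

theorem primrecPred_goodStage :
    PrimrecPred fun p : ((IntervalIndex × ℕ) × ℕ × ℕ) × ℕ =>
      GoodStage p.1.1.1 p.1.1.2 p.1.2.1 p.1.2.2 p.2 := by
  let β := ((IntervalIndex × ℕ) × ℕ × ℕ) × ℕ
  have hT : Primrec fun p : β => p.1.1.1 := Primrec.fst.comp (Primrec.fst.comp Primrec.fst)
  have hm : Primrec fun p : β => p.1.1.2 := Primrec.snd.comp (Primrec.fst.comp Primrec.fst)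
  have hR : Primrec fun p : β => p.1.2.1 := Primrec.fst.comp (Primrec.snd.comp Primrec.fst)
  have hs : Primrec fun p : β => p.1.2.2 := Primrec.snd.comp (Primrec.snd.comp Primrec.fst)
  have hsv : Primrec fun p : β => p.1.2.2 + p.2 := Primrec.nat_add.comp hs Primrec.snd
  refine PrimrecPred.and ?_ (primrecRel_ratOf_le.comp
    (primrec_measureName.comp (primrec_stageIntervals.comp (Primrec.pair (Primrec.pair hT hm)
      (Primrec.pair hR hsv))))
    (primrec_ratAdd.comp (primrec_measureName.comp (primrec_stageIntervals.comp Primrec.fst))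
      (primrec_ratHalfPow.comp hR)))
  have ev : ∀ {f : ℕ × ℕ × β → ℕ}, Primrec f → PrimrecPred fun q : ℕ × ℕ × β =>
      (Code.evaln (f q) q.2.2.1.1.1.2
        (Nat.pair q.2.2.1.1.2 (Nat.pair (q.2.1 + 1) (q.1 + 1)))).isSome := by
    intro f hf
    have b : Primrec fun q : ℕ × ℕ × β => q.2.2 := Primrec.snd.comp Primrec.snd
    exact Primrec.eq.comp (Primrec.option_isSome.comp (primrec_evaln_comp hf
      (Primrec.snd.comp (hT.comp b)) (Primrec₂.natPair.comp (hm.comp b)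
      (Primrec₂.natPair.comp (Primrec.succ.comp (Primrec.fst.comp Primrec.snd))
        (Primrec.succ.comp Primrec.fst))))) (Primrec.const true)
  have b : Primrec fun q : ℕ × ℕ × β => q.2.2 := Primrec.snd.comp Primrec.snd
  have h1 : PrimrecRel fun (k : ℕ) (q : ℕ × β) =>
      (Code.evaln (q.2.1.2.2 + q.2.2) q.2.1.1.1.2
        (Nat.pair q.2.1.1.2 (Nat.pair (q.1 + 1) (k + 1)))).isSome →
      (Code.evaln q.2.1.2.2 q.2.1.1.1.2
        (Nat.pair q.2.1.1.2 (Nat.pair (q.1 + 1) (k + 1)))).isSome :=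
    ((ev (hsv.comp b)).not.or (ev (hs.comp b))).of_eq fun q => imp_iff_not_or.symm
  have h2 : PrimrecRel fun (r : ℕ) (p : β) => ∀ k ∈ List.range (p.1.2.2 + p.2),
      (Code.evaln (p.1.2.2 + p.2) p.1.1.1.2
        (Nat.pair p.1.1.2 (Nat.pair (r + 1) (k + 1)))).isSome →
      (Code.evaln p.1.2.2 p.1.1.1.2
        (Nat.pair p.1.1.2 (Nat.pair (r + 1) (k + 1)))).isSome :=
    h1.forall_mem_list.comp (Primrec.list_range.comp (hsv.comp Primrec.snd)) Primrec.id
  exact (h2.forall_mem_list.comp (Primrec.list_range.comp hR) Primrec.id).of_eq fun p => by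
    simp only [List.mem_range, id]

end IntervalIndex

namespace IntervalIndex

theorem mem_level {T : IntervalIndex} {m : ℕ} {z : ℝ} : z ∈ T.level m ↔ ∃ r k,
    ¬ (T.2.eval (Nat.pair m (Nat.pair (r + 1) (k + 1)))).Dom ∧
      ∃ n ∈ T.1.eval (Nat.pair m (Nat.pair (r + 1) (k + 1))), z ∈ openInterval n := by
  have h : z ∈ T.level m ↔ ∃ R, z ∈ T.partialLevel m R := by
    simp only [level, partialLevel, Set.mem_iUnion, Finset.mem_range, exists_prop]
    exact ⟨fun ⟨r, hr⟩ => ⟨r + 1, r, r.lt_succ_self, hr⟩, fun ⟨_, r, _, hr⟩ => ⟨r, hr⟩⟩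
  simp only [h, mem_partialLevel]
  exact ⟨fun ⟨_, r, _, hr⟩ => ⟨r, hr⟩, fun ⟨r, hr⟩ => ⟨r + 1, r, r.lt_succ_self, hr⟩⟩

/-- An oracle program whose domain consists of the intervals that remain in level `m + 1`. -/
theorem exists_levelCode : ∃ c : OracleCode, ∀ (T : IntervalIndex) (m : ℕ),
    ⋃ n ∈ {n | (c.eval zeroJump (Nat.pair (Encodable.encode T) (Nat.pair m n))).Dom},
      openInterval n = T.level (m + 1) := by
  -- a witness `⟨⟨r, k⟩, t⟩`: the program for the intervals halts on `(m + 1, r + 1, k + 1)` within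
  -- `t` steps; it is refuted by a stage `v` at which `k + 1` is removed
  let arg : ℕ → ℕ → ℕ := fun m w =>
    Nat.pair (m + 1) (Nat.pair (w.unpair.1.unpair.1 + 1) (w.unpair.1.unpair.2 + 1))
  have harg : Primrec₂ arg := by
    have h1 := Primrec.fst.comp Primrec.unpair
    have h2 := Primrec.snd.comp Primrec.unpair
    exact Primrec₂.natPair.comp (Primrec.succ.comp Primrec.fst) (Primrec₂.natPair.comp
      (Primrec.succ.comp ((h1.comp h1).comp Primrec.snd))
      (Primrec.succ.comp ((h2.comp h1).comp Primrec.snd)))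
  have hR : PrimrecPred fun p : ((IntervalIndex × ℕ × ℕ) × ℕ) × ℕ =>
      Code.evaln p.1.2.unpair.2 p.1.1.1.1 (arg p.1.1.2.1 p.1.2) = some p.1.1.2.2 ∧
        ¬ (Code.evaln p.2 p.1.1.1.2 (arg p.1.1.2.1 p.1.2)).isSome := by
    have T : Primrec fun p : ((IntervalIndex × ℕ × ℕ) × ℕ) × ℕ => p.1.1.1 :=
      Primrec.fst.comp (Primrec.fst.comp Primrec.fst)
    have mn : Primrec fun p : ((IntervalIndex × ℕ × ℕ) × ℕ) × ℕ => p.1.1.2 :=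
      Primrec.snd.comp (Primrec.fst.comp Primrec.fst)
    have w : Primrec fun p : ((IntervalIndex × ℕ × ℕ) × ℕ) × ℕ => p.1.2 :=
      Primrec.snd.comp Primrec.fst
    have a := harg.comp (Primrec.fst.comp mn) w
    refine PrimrecPred.and (Primrec.eq.comp (primrec_evaln_comp
      (Primrec.snd.comp (Primrec.unpair.comp w)) (Primrec.fst.comp T) a)
      (Primrec.option_some.comp (Primrec.snd.comp mn))) (PrimrecPred.not (Primrec.eq.comp
        (Primrec.option_isSome.comp (primrec_evaln_comp Primrec.snd (Primrec.snd.comp T) a))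
        (Primrec.const true)))
  obtain ⟨c, hc⟩ := exists_oracleCode_dom_iff (R := fun (a : IntervalIndex × ℕ × ℕ) w v =>
    Code.evaln w.unpair.2 a.1.1 (arg a.2.1 w) = some a.2.2 ∧
      ¬ (Code.evaln v a.1.2 (arg a.2.1 w)).isSome) hR
  refine ⟨c, fun T m => ?_⟩
  have hc' : ∀ n, (c.eval zeroJump (Nat.pair (Encodable.encode T) (Nat.pair m n))).Dom ↔ _ :=
    fun n => hc (T, m, n)
  ext z
  simp only [hc', mem_level, Set.mem_iUnion, Set.mem_ofPred_eq, exists_prop]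
  constructor
  · rintro ⟨n, ⟨w, hw⟩, hz⟩
    exact ⟨w.unpair.1.unpair.1, w.unpair.1.unpair.2,
      fun hd => (eval_dom_iff_evaln.1 hd).elim fun v hv => (hw v).2 hv, n,
      Code.evaln_sound (hw 0).1, hz⟩
  · rintro ⟨r, k, hd, n, hn, hz⟩
    obtain ⟨t, ht⟩ := Code.evaln_complete.1 hn
    refine ⟨n, ⟨Nat.pair (Nat.pair r k) t, fun v => ⟨?_, fun hv => hd ?_⟩⟩, hz⟩
    · simpa [arg] using ht
    · exact eval_dom_iff_evaln.2 ⟨v, by simpa [arg] using hv⟩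

/-- An oracle program computing Cauchy names of the measures of the levels of a test. -/
theorem exists_levelMeasureCode : ∃ c : OracleCode, ∀ T : IntervalIndex, T.IsTest → ∀ m,
    ∃ q : ℕ → ℕ,
      (∀ j, q j ∈ c.eval zeroJump (Nat.pair (Encodable.encode T) (Nat.pair m j))) ∧
      IsCauchyName q (volume (T.level (m + 1))).toReal := by
  classical
  have hm : Primrec fun a : IntervalIndex × ℕ × ℕ => a.2.1 + 1 :=
    Primrec.succ.comp (Primrec.fst.comp Primrec.snd)
  have hj : Primrec fun a : IntervalIndex × ℕ × ℕ => a.2.2 + 2 :=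
    Primrec.succ.comp (Primrec.succ.comp (Primrec.snd.comp Primrec.snd))
  have hR : PrimrecPred fun p : ((IntervalIndex × ℕ × ℕ) × ℕ) × ℕ =>
      GoodStage p.1.1.1 (p.1.1.2.1 + 1) (p.1.1.2.2 + 2) p.1.2 p.2 :=
    primrecPred_goodStage.comp (Primrec.pair (Primrec.pair (Primrec.pair
      (Primrec.fst.comp (Primrec.fst.comp Primrec.fst))
      (hm.comp (Primrec.fst.comp Primrec.fst))) (Primrec.pair
      (hj.comp (Primrec.fst.comp Primrec.fst)) (Primrec.snd.comp Primrec.fst))) Primrec.snd)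
  have hout : Primrec₂ fun (a : IntervalIndex × ℕ × ℕ) (s : ℕ) =>
      measureName (stageIntervals a.1 (a.2.1 + 1) (a.2.2 + 2) s) :=
    primrec_measureName.comp (primrec_stageIntervals.comp (Primrec.pair (Primrec.pair
      (Primrec.fst.comp Primrec.fst) (hm.comp Primrec.fst))
      (Primrec.pair (hj.comp Primrec.fst) Primrec.snd)))
  obtain ⟨c, hc⟩ := exists_oracleCode_of_recursiveIn ((RecursiveIn.search
    (R := fun (a : IntervalIndex × ℕ × ℕ) s v =>
      GoodStage a.1 (a.2.1 + 1) (a.2.2 + 2) s v) hR).map hout.computableIn₂)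
  refine ⟨c, fun T hT m => ?_⟩
  -- with `j + 2` blocks, the missing blocks and the search for a good stage each cost an error
  -- of at most `2 ^ (-(j + 2))`
  have h : ∀ j, ∃ y, y ∈ c.eval zeroJump (Nat.pair (Encodable.encode T) (Nat.pair m j)) ∧
      |(ratOf y : ℝ) - (volume (T.level (m + 1))).toReal| ≤ (1 / 2) ^ (j + 1) := by
    intro j
    have e : c.eval zeroJump (Nat.pair (Encodable.encode T) (Nat.pair m j)) = _ := hc (T, m, j)
    obtain ⟨s, hs⟩ := Part.dom_iff_mem.1
      (search_dom.2 (hT.exists_goodStage m.succ_pos (j + 2)))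
    refine ⟨measureName (T.stageIntervals (m + 1) (j + 2) s), ?_, ?_⟩
    · rw [e]
      exact Part.mem_map _ hs
    · have hfin : volume (T.level (m + 1)) ≠ ∞ :=
        ((hT.volume_level_le m.succ_pos).trans_lt (ENNReal.pow_lt_top (by simp))).ne
      obtain ⟨h1, h2⟩ := openUnion_stageIntervals_approx (mem_search hs)
      have hp := partialLevel_subset (T := T) (m := m + 1) (j + 2)
      have h3 := hT.volume_level_le_add m.succ_pos (j + 2)
      have h4 := ENNReal.toReal_mono hfin (measure_mono (μ := volume) (h1.trans hp))
      have h5 : volume (T.level (m + 1)) ≤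
          volume (openUnion (T.stageIntervals (m + 1) (j + 2) s)) + 2⁻¹ ^ (j + 2) +
            2⁻¹ ^ (m + 1 + (j + 2)) := h3.trans (add_le_add h2 le_rfl)
      have hne : volume (openUnion (T.stageIntervals (m + 1) (j + 2) s)) + 2⁻¹ ^ (j + 2) ≠ ∞ :=
        ENNReal.add_ne_top.2 ⟨volume_openUnion_ne_top _, (ENNReal.pow_lt_top (by simp)).ne⟩
      have h6 := ENNReal.toReal_mono
        (ENNReal.add_ne_top.2 ⟨hne, (ENNReal.pow_lt_top (by simp)).ne⟩) h5
      rw [ENNReal.toReal_add hne (ENNReal.pow_lt_top (by simp)).ne,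
        ENNReal.toReal_add (volume_openUnion_ne_top _) (ENNReal.pow_lt_top (by simp)).ne,
        toReal_inv_two_pow, toReal_inv_two_pow] at h6
      rw [volume_openUnion_toReal] at h4 h6
      have h7 : ((1 : ℝ) / 2) ^ (m + 1 + (j + 2)) ≤ (1 / 2) ^ (j + 2) :=
        pow_le_pow_of_le_one (by norm_num) (by norm_num) (by omega)
      have h8 : ((1 : ℝ) / 2) ^ (j + 1) = 2 * (1 / 2) ^ (j + 2) := by ring
      have h9 : (0 : ℝ) < (1 / 2) ^ (j + 1) := by positivity
      rw [abs_le]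
      constructor <;> linarith
  choose q hq1 hq2 using h
  exact ⟨q, hq1, isCauchyName_of_abs_sub_le hq2⟩

/-- Every interval sequence test is uniformly equivalent to a Schnorr test relative to the halting
problem. -/
theorem exists_toSchnorr : ∃ F : IntervalIndex → SchnorrIndex, Computable F ∧
    ∀ T : IntervalIndex, T.IsTest → (F T).IsTest ∧ ∀ z : ℝ, T.Fails z ↔ (F T).Fails z := by
  obtain ⟨c, hc⟩ := exists_levelCode
  obtain ⟨d, hd⟩ := exists_levelMeasureCode
  refine ⟨fun T => (c.curry (Encodable.encode T), d.curry (Encodable.encode T)), (Primrec.pair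
    ((OracleCode.primrec_curry c).comp Primrec.encode)
    ((OracleCode.primrec_curry d).comp Primrec.encode)).to_comp, fun T hT => ?_⟩
  have hG : ∀ m, SchnorrIndex.G (c.curry (Encodable.encode T), d.curry (Encodable.encode T)) m =
      T.level (m + 1) := fun m => by
    simp only [SchnorrIndex.G, OracleCode.eval_curry]
    exact hc T m
  refine ⟨fun m => ?_, fun z => ?_⟩
  · rw [hG]
    refine ⟨(hT.volume_level_le m.succ_pos).trans (pow_le_pow_of_le_one (by simp) (by simp)
      m.le_succ), ?_⟩
    simp only [OracleCode.eval_curry]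
    exact hd T hT m
  · simp only [fails_iff, SchnorrIndex.Fails, hG]

end IntervalIndex

/-! ### From Schnorr tests to interval sequence tests -/

/-- Shrinking all intervals of a finite union by a small amount removes little measure. -/
theorem volume_openUnion_diff_closedUnion_le (l : List ℕ) {e : ℕ} (he : 0 ≤ ratOf e) :
    volume (openUnion l \ closedUnion (l.map (enlarge (ratNeg e)))) ≤
      l.length * ENNReal.ofReal (2 * ratOf e) := by
  induction l with
  | nil => simp [openUnion]
  | cons I l ih =>
    have hsub : openUnion (I :: l) \ closedUnion ((I :: l).map (enlarge (ratNeg e))) ⊆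
        (openInterval I \ closedInterval (enlarge (ratNeg e) I)) ∪
          (openUnion l \ closedUnion (l.map (enlarge (ratNeg e)))) := by
      rintro z ⟨hz, hn⟩
      obtain ⟨n, hn1, hzn⟩ := mem_openUnion.1 hz
      rw [mem_closedUnion, not_exists] at hn
      rcases List.mem_cons.1 hn1 with rfl | hnl
      · exact Or.inl ⟨hzn, fun h => hn _ ⟨by simp, h⟩⟩
      · refine Or.inr ⟨mem_openUnion.2 ⟨n, hnl, hzn⟩, fun h => ?_⟩
        obtain ⟨k, hk, hzk⟩ := mem_closedUnion.1 h
        exact hn k ⟨by simp [List.mem_map.1 hk], hzk⟩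
    have hI : volume (openInterval I \ closedInterval (enlarge (ratNeg e) I)) ≤
        ENNReal.ofReal (2 * ratOf e) := by
      have hs : openInterval I \ closedInterval (enlarge (ratNeg e) I) ⊆
          Set.Ico (leftEnd I : ℝ) (leftEnd I + ratOf e) ∪
            Set.Ioc ((rightEnd I : ℝ) - ratOf e) (rightEnd I) := by
        rintro z ⟨h1, h2⟩
        rw [mem_openInterval] at h1
        rw [mem_closedInterval, leftEnd_enlarge, rightEnd_enlarge, ratOf_ratNeg, not_and_or] at h2
        push_cast at h2
        rcases h2 with h2 | h2
        · exact Or.inl ⟨h1.1.le, by linarith⟩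
        · exact Or.inr ⟨by linarith, h1.2.le⟩
      have he' : (0 : ℝ) ≤ ratOf e := by exact_mod_cast he
      refine (measure_mono hs).trans ((measure_union_le _ _).trans ?_)
      rw [Real.volume_Ico, Real.volume_Ioc, add_sub_cancel_left, sub_sub_cancel, two_mul,
        ENNReal.ofReal_add he' he']
    refine (measure_mono hsub).trans ((measure_union_le _ _).trans ?_)
    rw [List.length_cons]
    push_cast
    rw [add_mul, one_mul, add_comm]
    exact add_le_add ih hI

theorem closedInterval_enlarge_neg_subset {e n : ℕ} (he : 0 < ratOf e) :
    closedInterval (enlarge (ratNeg e) n) ⊆ openInterval n := by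
  intro z hz
  have he' : (0 : ℝ) < ratOf e := by exact_mod_cast he
  rw [mem_closedInterval, leftEnd_enlarge, rightEnd_enlarge, ratOf_ratNeg] at hz
  push_cast at hz
  exact mem_openInterval.2 ⟨by linarith [hz.1], by linarith [hz.2]⟩

namespace SchnorrIndex

variable (S : SchnorrIndex) (m : ℕ)

/-- The pair `e = ⟨n, p⟩` is a correct enumeration of the interval `n` into the `m`-th set if this
holds for all `v`: the witness `p` is not refuted by stage `v`. -/
def Enumerates (e v : ℕ) : Prop :=
  S.1.Certifies (Nat.pair m e.unpair.1) e.unpair.2 v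

theorem primrecPred_enumerates {α : Type*} [Primcodable α] {S : α → SchnorrIndex}
    {m e v : α → ℕ} (hS : Primrec S) (hm : Primrec m) (he : Primrec e) (hv : Primrec v) :
    PrimrecPred fun a => Enumerates (S a) (m a) (e a) (v a) :=
  OracleCode.primrecPred_certifies.comp (Primrec.pair (Primrec.pair (Primrec.pair
    (Primrec.fst.comp hS) (Primrec₂.natPair.comp hm (Primrec.fst.comp (Primrec.unpair.comp he))))
    (Primrec.snd.comp (Primrec.unpair.comp he))) hv)

variable {S m}

theorem mem_G {z : ℝ} :
    z ∈ S.G m ↔ ∃ e, (∀ v, S.Enumerates m e v) ∧ z ∈ openInterval e.unpair.1 := by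
  simp only [G, Set.mem_iUnion, Set.mem_ofPred_eq, exists_prop, OracleCode.eval_dom_zeroJump,
    Enumerates]
  constructor
  · rintro ⟨n, ⟨w, hw⟩, hz⟩
    exact ⟨Nat.pair n w, by simpa using hw, by simpa using hz⟩
  · rintro ⟨e, hw, hz⟩
    exact ⟨_, ⟨_, hw⟩, hz⟩

open Classical in
/-- The intervals enumerated into the `m`-th set by the pairs below `N` that are not refuted before
stage `u`. -/
noncomputable def enumList (S : SchnorrIndex) (m N u : ℕ) : List ℕ :=
  (List.range N).filterMap fun e =>
    if ∀ v < u, S.Enumerates m e v then some e.unpair.1 else none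

theorem mem_enumList {N u n : ℕ} : n ∈ S.enumList m N u ↔
    ∃ e < N, (∀ v < u, S.Enumerates m e v) ∧ e.unpair.1 = n := by
  simp [enumList]

theorem primrecPred_forall_enumerates {α : Type*} [Primcodable α] {S : α → SchnorrIndex}
    {m e u : α → ℕ} (hS : Primrec S) (hm : Primrec m) (he : Primrec e) (hu : Primrec u) :
    PrimrecPred fun a => ∀ v < u a, Enumerates (S a) (m a) (e a) v := by
  have h : PrimrecRel fun (v : ℕ) (a : α) => Enumerates (S a) (m a) (e a) v :=
    primrecPred_enumerates (hS.comp Primrec.snd) (hm.comp Primrec.snd) (he.comp Primrec.snd)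
      Primrec.fst
  exact (h.forall_mem_list.comp (Primrec.list_range.comp hu) Primrec.id).of_eq fun a => by simp

theorem primrec_enumList : Primrec fun p : (SchnorrIndex × ℕ) × ℕ × ℕ =>
    enumList p.1.1 p.1.2 p.2.1 p.2.2 := by
  classical
  refine Primrec.listFilterMap (Primrec.list_range.comp (Primrec.fst.comp Primrec.snd))
    (Primrec₂.mk (Primrec.ite ?_ (Primrec.option_some.comp
      (Primrec.fst.comp (Primrec.unpair.comp Primrec.snd))) (Primrec.const none)))
  exact primrecPred_forall_enumerates (Primrec.fst.comp (Primrec.fst.comp Primrec.fst))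
    (Primrec.snd.comp (Primrec.fst.comp Primrec.fst)) Primrec.snd
    (Primrec.snd.comp (Primrec.snd.comp Primrec.fst))

/-- The list of intervals with the parameters `⟨⟨N, u⟩, p⟩` exhausts the `m`-th set up to measure
`2 ^ (-j)` if this holds for all `v`. The component `p` is a witness for an approximation to the
measure of the set with an error of at most `2 ^ (-(j + 2))`. -/
def Exhausts (S : SchnorrIndex) (m j w v : ℕ) : Prop :=
  (j ≤ w.unpair.1.unpair.1 ∧
    ∀ e < w.unpair.1.unpair.1, (∀ v' < w.unpair.1.unpair.2, S.Enumerates m e v') →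
      S.Enumerates m e v) ∧
  S.2.Certifies (Nat.pair m (j + 2)) w.unpair.2 v ∧
  ratOf ((S.2.stageEval (Nat.pair m (j + 2)) w.unpair.2).getD 0) ≤
    ratOf (ratAdd (measureName (S.enumList m w.unpair.1.unpair.1 w.unpair.1.unpair.2))
      (ratHalfPow (j + 1)))

theorem primrecPred_exhausts : PrimrecPred fun p : ((SchnorrIndex × ℕ × ℕ) × ℕ) × ℕ =>
    Exhausts p.1.1.1 p.1.1.2.1 p.1.1.2.2 p.1.2 p.2 := by
  let β := ((SchnorrIndex × ℕ × ℕ) × ℕ) × ℕ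
  have hS : Primrec fun p : β => p.1.1.1 := Primrec.fst.comp (Primrec.fst.comp Primrec.fst)
  have hm : Primrec fun p : β => p.1.1.2.1 :=
    Primrec.fst.comp (Primrec.snd.comp (Primrec.fst.comp Primrec.fst))
  have hj : Primrec fun p : β => p.1.1.2.2 :=
    Primrec.snd.comp (Primrec.snd.comp (Primrec.fst.comp Primrec.fst))
  have hw : Primrec fun p : β => p.1.2.unpair := Primrec.unpair.comp (Primrec.snd.comp Primrec.fst)
  have hp : Primrec fun p : β => p.1.2.unpair.2 := Primrec.snd.comp hw
  have hN : Primrec fun p : β => p.1.2.unpair.1.unpair.1 :=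
    Primrec.fst.comp (Primrec.unpair.comp (Primrec.fst.comp hw))
  have hu : Primrec fun p : β => p.1.2.unpair.1.unpair.2 :=
    Primrec.snd.comp (Primrec.unpair.comp (Primrec.fst.comp hw))
  have hj2 : Primrec fun p : β => Nat.pair p.1.1.2.1 (p.1.1.2.2 + 2) :=
    Primrec₂.natPair.comp hm (Primrec.succ.comp (Primrec.succ.comp hj))
  have hb : PrimrecRel fun (e : ℕ) (p : β) =>
      (∀ v' < p.1.2.unpair.1.unpair.2, Enumerates p.1.1.1 p.1.1.2.1 e v') →
        Enumerates p.1.1.1 p.1.1.2.1 e p.2 := by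
    have h1 := (primrecPred_forall_enumerates (hS.comp Primrec.snd) (hm.comp Primrec.snd)
      (Primrec.fst (α := ℕ) (β := β)) (hu.comp Primrec.snd)).not
    have h2 := primrecPred_enumerates (hS.comp Primrec.snd) (hm.comp Primrec.snd)
      (Primrec.fst (α := ℕ) (β := β)) (Primrec.snd.comp Primrec.snd)
    exact (h1.or h2).of_eq fun p => imp_iff_not_or.symm
  have hb' : PrimrecPred fun p : β => ∀ e < p.1.2.unpair.1.unpair.1,
      (∀ v' < p.1.2.unpair.1.unpair.2, Enumerates p.1.1.1 p.1.1.2.1 e v') →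
        Enumerates p.1.1.1 p.1.1.2.1 e p.2 :=
    (hb.forall_mem_list.comp (Primrec.list_range.comp hN) Primrec.id).of_eq fun p => by
      simp only [List.mem_range, id]
  have hc : PrimrecPred fun p : β =>
      p.1.1.1.2.Certifies (Nat.pair p.1.1.2.1 (p.1.1.2.2 + 2)) p.1.2.unpair.2 p.2 :=
    OracleCode.primrecPred_certifies.comp (Primrec.pair (Primrec.pair (Primrec.pair
      (Primrec.snd.comp hS) hj2) hp) Primrec.snd)
  have he : Primrec fun p : β =>
      (p.1.1.1.2.stageEval (Nat.pair p.1.1.2.1 (p.1.1.2.2 + 2)) p.1.2.unpair.2).getD 0 :=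
    Primrec.option_getD.comp (OracleCode.primrec_stageEval.comp
      (Primrec.pair (Primrec.pair (Primrec.snd.comp hS) hj2) hp)) (Primrec.const 0)
  have hl : Primrec fun p : β => enumList p.1.1.1 p.1.1.2.1 p.1.2.unpair.1.unpair.1
      p.1.2.unpair.1.unpair.2 :=
    primrec_enumList.comp (Primrec.pair (Primrec.pair hS hm) (Primrec.pair hN hu))
  exact ((Primrec.nat_le.comp hj hN).and hb').and (hc.and (primrecRel_ratOf_le.comp he
    (primrec_ratAdd.comp (primrec_measureName.comp hl)
      (primrec_ratHalfPow.comp (Primrec.succ.comp hj)))))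

/-- The properties of a finite list of intervals that exhausts the `m`-th set up to `2 ^ (-j)`. -/
structure IsExhausting (S : SchnorrIndex) (m j : ℕ) (l : List ℕ) : Prop where
  subset : openUnion l ⊆ S.G m
  volume_le : volume (S.G m) ≤ volume (openUnion l) + 2⁻¹ ^ j
  mem : ∀ e < j, (∀ v, S.Enumerates m e v) → e.unpair.1 ∈ l

theorem IsTest.volume_ne_top (hS : S.IsTest) : volume (S.G m) ≠ ∞ :=
  ((hS m).1.trans_lt (ENNReal.pow_lt_top (by simp))).ne

/-- The search for exhausting lists is correct. The errors `2 ^ (-(j + 2))` of the approximation and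
`2 ^ (-(j + 1))` of the comparison add up to less than `2 ^ (-j)`. -/
theorem IsTest.isExhausting (hS : S.IsTest) {j w : ℕ} (hw : ∀ v, S.Exhausts m j w v) :
    S.IsExhausting m j (S.enumList m w.unpair.1.unpair.1 w.unpair.1.unpair.2) := by
  have hsub : openUnion (S.enumList m w.unpair.1.unpair.1 w.unpair.1.unpair.2) ⊆ S.G m := by
    intro z hz
    obtain ⟨n, hn, hz⟩ := mem_openUnion.1 hz
    obtain ⟨e, he, hv, rfl⟩ := mem_enumList.1 hn
    exact mem_G.2 ⟨e, fun v => (hw v).1.2 e he hv, hz⟩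
  refine ⟨hsub, ?_, fun e he hv => mem_enumList.2
    ⟨e, he.trans_le (hw 0).1.1, fun v _ => hv v, rfl⟩⟩
  obtain ⟨q, hq1, hq2⟩ := (hS m).2
  obtain ⟨y, hy⟩ := Option.isSome_iff_exists.1 (hw 0).2.1.1
  have hyq : y = q (j + 2) := Part.mem_unique
    (OracleCode.mem_eval_zeroJump.2 ⟨_, fun v => (hw v).2.1, hy⟩) (hq1 (j + 2))
  have h1 := (Rat.cast_le (K := ℝ)).2 (hw 0).2.2
  rw [hy, Option.getD_some, ratOf_ratAdd, ratOf_ratHalfPow, hyq] at h1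
  push_cast at h1
  have h2 := (abs_le.1 (hq2.abs_sub_le (j + 2))).1
  have h3 : ((1 : ℝ) / 2) ^ (j + 1) + (1 / 2) ^ (j + 2) ≤ (1 / 2) ^ j := by
    have : (0 : ℝ) < (1 / 2) ^ j := by positivity
    rw [pow_add, pow_add]
    linarith
  have h0 : (0 : ℝ) ≤ ratOf (measureName
      (S.enumList m w.unpair.1.unpair.1 w.unpair.1.unpair.2)) := by
    exact_mod_cast ratOf_measureName_nonneg _
  rw [volume_openUnion, ← ofReal_half_pow, ← ENNReal.ofReal_add h0 (by positivity),
    ← ENNReal.ofReal_toReal hS.volume_ne_top]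
  exact ENNReal.ofReal_le_ofReal (by linarith)

/-- The search for exhausting lists succeeds: take `N` so large that the pairs below `N` exhaust the
set, and then `u` so large that the incorrect pairs among them are refuted before stage `u`. -/
theorem IsTest.exists_exhausts (hS : S.IsTest) (j : ℕ) : ∃ w, ∀ v, S.Exhausts m j w v := by
  classical
  -- the union of the intervals enumerated by the correct pairs below `N`
  let U : ℕ → Set ℝ := fun N => ⋃ e ∈ {e | e < N ∧ ∀ v, S.Enumerates m e v},
    openInterval e.unpair.1
  have hmono : Monotone U := fun M N hMN => Set.biUnion_subset_biUnion_left
    fun e he => ⟨he.1.trans_le hMN, he.2⟩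
  have hU : ⋃ N, U N = S.G m := by
    ext z
    simp only [U, Set.mem_iUnion, Set.mem_ofPred_eq, exists_prop, mem_G]
    exact ⟨fun ⟨_, e, he, hz⟩ => ⟨e, he.2, hz⟩,
      fun ⟨e, he, hz⟩ => ⟨e + 1, e, ⟨e.lt_succ_self, he⟩, hz⟩⟩
  have ht := tendsto_measure_iUnion_atTop (μ := volume) hmono
  rw [hU] at ht
  have hev : ∀ᶠ N in atTop, (volume (S.G m)).toReal - (1 / 2) ^ (j + 2) < (volume (U N)).toReal :=
    ((ENNReal.tendsto_toReal hS.volume_ne_top).comp ht).eventually (lt_mem_nhds (by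
      have : (0 : ℝ) < (1 / 2) ^ (j + 2) := by positivity
      linarith))
  obtain ⟨N, hN, hNj⟩ := (hev.and (eventually_ge_atTop j)).exists
  have href : ∀ᶠ u in atTop, ∀ e ∈ Finset.range N, (∀ v < u, S.Enumerates m e v) →
      ∀ v, S.Enumerates m e v := by
    refine (Finset.eventually_all _).2 fun e _ => ?_
    by_cases he : ∀ v, S.Enumerates m e v
    · exact Eventually.of_forall fun _ _ => he
    · obtain ⟨v, hv⟩ := not_forall.1 he
      filter_upwards [eventually_gt_atTop v] with u hu h
      exact absurd (h v hu) hv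
  obtain ⟨u, hu⟩ := href.exists
  obtain ⟨q, hq1, hq2⟩ := (hS m).2
  obtain ⟨p, hp, hpq⟩ := OracleCode.mem_eval_zeroJump.1 (hq1 (j + 2))
  have hl : openUnion (S.enumList m N u) = U N := by
    ext z
    simp only [U, mem_openUnion, mem_enumList, Set.mem_iUnion, Set.mem_ofPred_eq, exists_prop]
    constructor
    · rintro ⟨n, ⟨e, he, hv, rfl⟩, hz⟩
      exact ⟨e, ⟨he, hu e (Finset.mem_range.2 he) hv⟩, hz⟩
    · rintro ⟨e, ⟨he, hv⟩, hz⟩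
      exact ⟨_, ⟨e, he, fun v _ => hv v, rfl⟩, hz⟩
  refine ⟨Nat.pair (Nat.pair N u) p, fun v => ?_⟩
  simp only [Exhausts, Nat.unpair_pair]
  refine ⟨⟨hNj, fun e he hv => hu e (Finset.mem_range.2 he) hv v⟩, hp v, ?_⟩
  rw [hpq, Option.getD_some, ratOf_ratAdd, ratOf_ratHalfPow, ← Rat.cast_le (K := ℝ)]
  rw [← hl, volume_openUnion_toReal] at hN
  have h2 := (abs_le.1 (hq2.abs_sub_le (j + 2))).2
  have h3 : ((1 : ℝ) / 2) ^ (j + 1) = (1 / 2) ^ (j + 2) + (1 / 2) ^ (j + 2) := by ring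
  push_cast
  linarith

/-- The halting problem computes exhausting finite lists of intervals. -/
theorem exists_exhausting : ∃ f : SchnorrIndex × ℕ × ℕ →. List ℕ, RecursiveIn {zeroJump} f ∧
    ∀ S : SchnorrIndex, S.IsTest → ∀ m j, ∃ l ∈ f (S, m, j), S.IsExhausting m j l := by
  classical
  have hout : Primrec₂ fun (a : SchnorrIndex × ℕ × ℕ) (w : ℕ) =>
      enumList a.1 a.2.1 w.unpair.1.unpair.1 w.unpair.1.unpair.2 := by
    have hu : Primrec fun q : (SchnorrIndex × ℕ × ℕ) × ℕ => q.2.unpair.1.unpair :=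
      Primrec.unpair.comp (Primrec.fst.comp (Primrec.unpair.comp Primrec.snd))
    exact primrec_enumList.comp (Primrec.pair (Primrec.pair (Primrec.fst.comp Primrec.fst)
      (Primrec.fst.comp (Primrec.snd.comp Primrec.fst)))
      (Primrec.pair (Primrec.fst.comp hu) (Primrec.snd.comp hu)))
  refine ⟨_, (RecursiveIn.search (R := fun (a : SchnorrIndex × ℕ × ℕ) w v =>
    Exhausts a.1 a.2.1 a.2.2 w v) primrecPred_exhausts).map hout.computableIn₂,
    fun S hS m j => ?_⟩
  obtain ⟨w, hw⟩ := Part.dom_iff_mem.1 (search_dom.2 (hS.exists_exhausts (m := m) j))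
  exact ⟨_, Part.mem_map _ hw, hS.isExhausting (mem_search hw)⟩

end SchnorrIndex

/-- A family of finite lists of intervals that is partial recursive in the halting problem turns
uniformly into a family of interval sequence tests, wherever the lists satisfy the measure bounds
required of a test. -/
theorem exists_test_of_recursiveIn {α : Type*} [Primcodable α] {f : α × ℕ × ℕ →. List ℕ}
    (hf : RecursiveIn {zeroJump} f) : ∃ F : α → IntervalIndex, Computable F ∧
      ∀ S, ∀ l : ℕ → ℕ → List ℕ, (∀ m r, 0 < m → 0 < r → l m r ∈ f (S, m, r) ∧
        volume (openUnion (l m r)) ≤ 2⁻¹ ^ (m + r)) →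
      (F S).IsTest ∧ ∀ z, (F S).Fails z ↔ ∀ m, 0 < m → ∃ r, 0 < r ∧ z ∈ openUnion (l m r) := by
  obtain ⟨F, hF, h⟩ := exists_intervalIndex_of_recursiveIn hf
  refine ⟨F, hF, fun S l hl => ⟨fun m r hm hr => ?_, fun z => ?_⟩⟩
  · obtain ⟨h1, h2, h3⟩ := h S m r _ (hl m r hm hr).1
    exact ⟨h1, h2, h3 ▸ (hl m r hm hr).2⟩
  · refine forall₂_congr fun m hm => exists_congr fun r => and_congr_right fun hr => ?_
    rw [← (h S m r _ (hl m r hm hr).1).2.2]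
    simp [and_assoc]

namespace SchnorrIndex

variable {S : SchnorrIndex} {m j : ℕ}

theorem IsExhausting.volume_diff_le {l : List ℕ} (h : S.IsExhausting m j l) :
    volume (S.G m \ openUnion l) ≤ 2⁻¹ ^ j := by
  rw [measure_sdiff h.subset (isOpen_openUnion l).measurableSet.nullMeasurableSet
    (volume_openUnion_ne_top l)]
  exact tsub_le_iff_left.2 h.volume_le

/-- The part of the list `l` outside the intervals of `l'`, each of which is shrunk a little before
it is removed, so that the result is open and contains `openUnion l \ openUnion l'`. -/
def shrunkDiff (n : ℕ) (l l' : List ℕ) : List ℕ :=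
  cutList l (l'.map (enlarge (ratNeg (ratHalfPow (n + l'.length + 1)))))

theorem primrec_shrunkDiff {α : Type*} [Primcodable α] {n : α → ℕ} {l l' : α → List ℕ}
    (hn : Primrec n) (hl : Primrec l) (hl' : Primrec l') :
    Primrec fun a => shrunkDiff (n a) (l a) (l' a) := by
  have h : Primrec fun a => ratNeg (ratHalfPow (n a + (l' a).length + 1)) :=
    primrec_ratNeg.comp (primrec_ratHalfPow.comp (Primrec.succ.comp
      (Primrec.nat_add.comp hn (Primrec.list_length.comp hl'))))
  exact primrec_cutList.comp hl (Primrec.list_map hl'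
    (primrec_enlarge.comp (h.comp Primrec.fst) Primrec.snd))

theorem diff_subset_shrunkDiff (n : ℕ) (l l' : List ℕ) :
    openUnion l \ openUnion l' ⊆ openUnion (shrunkDiff n l l') := by
  rw [shrunkDiff, openUnion_cutList]
  refine Set.sdiff_subset_sdiff_right fun z hz => ?_
  obtain ⟨k, hk, hz⟩ := mem_closedUnion.1 hz
  obtain ⟨I, hI, rfl⟩ := List.mem_map.1 hk
  exact mem_openUnion.2 ⟨I, hI, closedInterval_enlarge_neg_subset
    (by rw [ratOf_ratHalfPow]; positivity) hz⟩

theorem shrunkDiff_subset (n : ℕ) (l l' : List ℕ) :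
    openUnion (shrunkDiff n l l') ⊆ openUnion l := by
  rw [shrunkDiff, openUnion_cutList]
  exact Set.sdiff_subset

theorem volume_shrunkDiff_le (n : ℕ) (l l' : List ℕ) :
    volume (openUnion (shrunkDiff n l l')) ≤
      volume (openUnion l \ openUnion l') + 2⁻¹ ^ n := by
  have h0 : (0 : ℚ) ≤ ratOf (ratHalfPow (n + l'.length + 1)) := by
    rw [ratOf_ratHalfPow]; positivity
  have hsub : openUnion (shrunkDiff n l l') ⊆ (openUnion l \ openUnion l') ∪ (openUnion l' \
      closedUnion (l'.map (enlarge (ratNeg (ratHalfPow (n + l'.length + 1)))))) := by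
    rw [shrunkDiff, openUnion_cutList]
    rintro z ⟨h1, h2⟩
    by_cases h : z ∈ openUnion l'
    exacts [Or.inr ⟨h, h2⟩, Or.inl ⟨h1, h⟩]
  refine (measure_mono hsub).trans ((measure_union_le _ _).trans (add_le_add le_rfl
    ((volume_openUnion_diff_closedUnion_le l' h0).trans ?_)))
  have hlen : (l'.length : ℝ) ≤ 2 ^ l'.length := by
    exact_mod_cast Nat.lt_two_pow_self.le
  rw [ratOf_ratHalfPow, ← ofReal_half_pow, ← ENNReal.ofReal_natCast,
    ← ENNReal.ofReal_mul (Nat.cast_nonneg _)]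
  refine ENNReal.ofReal_le_ofReal ?_
  push_cast
  calc (l'.length : ℝ) * (2 * (1 / 2) ^ (n + l'.length + 1))
      ≤ 2 ^ l'.length * (2 * (1 / 2) ^ (n + l'.length + 1)) := by gcongr
    _ = (1 / 2) ^ n * (2 * (1 / 2)) ^ l'.length := by rw [mul_pow]; ring
    _ = (1 / 2) ^ n := by norm_num

/-- Every Schnorr test relative to the halting problem is uniformly equivalent to an interval
sequence test. -/
theorem exists_toInterval : ∃ F : SchnorrIndex → IntervalIndex, Computable F ∧
    ∀ S : SchnorrIndex, S.IsTest → (F S).IsTest ∧ ∀ z : ℝ, S.Fails z ↔ (F S).Fails z := by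
  obtain ⟨f, hf, hfS⟩ := exists_exhausting
  -- finite approximations to the intersection of the sets with numbers `m - 1` and `m + 2`: the
  -- first set makes all sets appear, the second one makes the measure small
  let V : SchnorrIndex × ℕ × ℕ →. List ℕ := fun a =>
    (f (a.1, a.2.1 - 1, a.2.1 + a.2.2 + 4)).bind fun l =>
      (f (a.1, a.2.1 + 2, a.2.1 + a.2.2 + 4)).map fun l' => interList l l'
  have hS : Primrec fun a : SchnorrIndex × ℕ × ℕ => a.1 := Primrec.fst
  have hm : Primrec fun a : SchnorrIndex × ℕ × ℕ => a.2.1 := Primrec.fst.comp Primrec.snd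
  have hr : Primrec fun a : SchnorrIndex × ℕ × ℕ => a.2.2 := Primrec.snd.comp Primrec.snd
  have hj : Primrec fun a : SchnorrIndex × ℕ × ℕ => a.2.1 + a.2.2 + 4 :=
    Primrec.nat_add.comp (Primrec.nat_add.comp hm hr) (Primrec.const 4)
  have hV : RecursiveIn {zeroJump} V := by
    have h1 : RecursiveIn {zeroJump} fun a : SchnorrIndex × ℕ × ℕ =>
        f (a.1, a.2.1 - 1, a.2.1 + a.2.2 + 4) :=
      hf.comp (Primrec.pair hS (Primrec.pair
        (Primrec.nat_sub.comp hm (Primrec.const 1)) hj)).computableIn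
    have h2 : RecursiveIn {zeroJump} fun a : (SchnorrIndex × ℕ × ℕ) × List ℕ =>
        f (a.1.1, a.1.2.1 + 2, a.1.2.1 + a.1.2.2 + 4) :=
      hf.comp ((Primrec.pair hS (Primrec.pair
        (Primrec.nat_add.comp hm (Primrec.const 2)) hj)).comp Primrec.fst).computableIn
    have h3 : Primrec₂ fun (a : (SchnorrIndex × ℕ × ℕ) × List ℕ) (l' : List ℕ) =>
        interList a.2 l' :=
      primrec_interList.comp (Primrec.snd.comp Primrec.fst) Primrec.snd
    exact h1.bind (h2.map h3.computableIn₂)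
  let g : SchnorrIndex × ℕ × ℕ →. List ℕ := fun a => (V a).bind fun l =>
    (V (a.1, a.2.1, a.2.2 - 1)).map fun l' =>
      shrunkDiff (a.2.1 + a.2.2 + 1) l (if a.2.2 ≤ 1 then [] else l')
  have hg : RecursiveIn {zeroJump} g := by
    have h2 : RecursiveIn {zeroJump} fun a : (SchnorrIndex × ℕ × ℕ) × List ℕ =>
        V (a.1.1, a.1.2.1, a.1.2.2 - 1) :=
      hV.comp ((Primrec.pair hS (Primrec.pair hm
        (Primrec.nat_sub.comp hr (Primrec.const 1)))).comp Primrec.fst).computableIn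
    have h3 : Primrec₂ fun (a : (SchnorrIndex × ℕ × ℕ) × List ℕ) (l' : List ℕ) =>
        shrunkDiff (a.1.2.1 + a.1.2.2 + 1) a.2 (if a.1.2.2 ≤ 1 then [] else l') :=
      primrec_shrunkDiff
        ((Primrec.succ.comp (Primrec.nat_add.comp hm hr)).comp (Primrec.fst.comp Primrec.fst))
        (Primrec.snd.comp Primrec.fst)
        (Primrec.ite (Primrec.nat_le.comp (hr.comp (Primrec.fst.comp Primrec.fst))
          (Primrec.const 1)) (Primrec.const []) Primrec.snd)
    exact hV.bind (h2.map h3.computableIn₂)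
  obtain ⟨F, hF, hFS⟩ := exists_test_of_recursiveIn hg
  refine ⟨F, hF, fun S hS => ?_⟩
  choose b hb hex using hfS S hS
  let v : ℕ → ℕ → List ℕ := fun m r => interList (b (m - 1) (m + r + 4)) (b (m + 2) (m + r + 4))
  have hv : ∀ m r, v m r ∈ V (S, m, r) := fun m r =>
    Part.mem_bind (hb _ _) (Part.mem_map _ (hb _ _))
  have hvU : ∀ m r, openUnion (v m r) =
      openUnion (b (m - 1) (m + r + 4)) ∩ openUnion (b (m + 2) (m + r + 4)) := fun m r =>
    openUnion_interList _ _
  let w : ℕ → ℕ → List ℕ := fun m r =>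
    shrunkDiff (m + r + 1) (v m r) (if r ≤ 1 then [] else v m (r - 1))
  have hw : ∀ m r, w m r ∈ g (S, m, r) := fun m r =>
    Part.mem_bind (hv m r) (Part.mem_map _ (hv m (r - 1)))
  have hvsub : ∀ m r, openUnion (v m r) ⊆ S.G (m - 1) ∩ S.G (m + 2) := fun m r => by
    rw [hvU]
    exact Set.inter_subset_inter (hex _ _).subset (hex _ _).subset
  have hvol : ∀ m r, 0 < m → 0 < r → volume (openUnion (w m r)) ≤ 2⁻¹ ^ (m + r) := by
    intro m r hm hr
    rcases eq_or_lt_of_le (Nat.succ_le_of_lt hr) with rfl | hr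
    · refine (measure_mono ((shrunkDiff_subset _ _ _).trans
        ((hvsub m 1).trans Set.inter_subset_right))).trans ((hS _).1.trans ?_)
      exact pow_le_pow_of_le_one (by simp) (by simp) (by omega)
    · obtain ⟨r, rfl⟩ : ∃ r', r = r' + 2 := ⟨r - 2, by omega⟩
      have hsub : openUnion (v m (r + 2)) \ openUnion (v m (r + 1)) ⊆
          (S.G (m - 1) \ openUnion (b (m - 1) (m + (r + 1) + 4))) ∪
            (S.G (m + 2) \ openUnion (b (m + 2) (m + (r + 1) + 4))) := by
        rintro z ⟨h1, h2⟩
        have h3 := hvsub _ _ h1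
        rw [hvU, Set.mem_inter_iff, not_and_or] at h2
        exact h2.imp (fun h => ⟨h3.1, h⟩) fun h => ⟨h3.2, h⟩
      have hd := (measure_mono hsub).trans ((measure_union_le _ _).trans (add_le_add
        ((hex _ _).volume_diff_le) ((hex _ _).volume_diff_le)))
      have hp : ∀ n : ℕ, (2⁻¹ : ℝ≥0∞) ^ (n + 1) + 2⁻¹ ^ (n + 1) = 2⁻¹ ^ n := fun n => by
        rw [pow_succ, ← mul_add, ENNReal.inv_two_add_inv_two, mul_one]
      rw [show m + (r + 1) + 4 = (m + (r + 2) + 2) + 1 by ring, hp] at hd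
      have := volume_shrunkDiff_le (m + (r + 2) + 1) (v m (r + 2)) (v m (r + 1))
      simp only [w, show ¬ r + 2 ≤ 1 by omega, if_false, Nat.add_succ_sub_one]
      refine this.trans ?_
      rw [← hp (m + (r + 2))]
      exact add_le_add (hd.trans (pow_le_pow_of_le_one (by simp) (by simp) (Nat.le_succ _))) le_rfl
  obtain ⟨hT, hfail⟩ := hFS S w fun m r hm hr => ⟨hw m r, hvol m r hm hr⟩
  refine ⟨hT, fun z => ?_⟩
  rw [hfail]
  constructor
  · intro hz m hm
    -- some list of index `r` contains `z`, and the least one loses nothing at `z`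
    have hmem : ∃ r, 0 < r ∧ z ∈ openUnion (v m r) := by
      obtain ⟨e, he, hze⟩ := mem_G.1 (hz (m - 1))
      obtain ⟨e', he', hze'⟩ := mem_G.1 (hz (m + 2))
      refine ⟨e + e' + 1, Nat.succ_pos _, ?_⟩
      rw [hvU]
      exact ⟨mem_openUnion.2 ⟨_, (hex _ _).mem e (by omega) he, hze⟩,
        mem_openUnion.2 ⟨_, (hex _ _).mem e' (by omega) he', hze'⟩⟩
    classical
    obtain ⟨hr, hzr⟩ := Nat.find_spec hmem
    refine ⟨Nat.find hmem, hr, diff_subset_shrunkDiff _ _ _ ⟨hzr, ?_⟩⟩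
    split_ifs with h1
    · simp [openUnion]
    · exact fun h => Nat.find_min hmem (m := Nat.find hmem - 1) (by omega) ⟨by omega, h⟩
  · intro h m
    obtain ⟨r, -, hz⟩ := h (m + 1) m.succ_pos
    exact (hvsub _ _ (shrunkDiff_subset _ _ _ hz)).1

end SchnorrIndex

/-! ### Sequences of non-overlapping closed intervals -/

/-- The interval named by `k` if its end points are in order, and a degenerate interval
otherwise. -/
def orderEnds (k : ℕ) : ℕ := if ratOf k.unpair.1 ≤ ratOf k.unpair.2 then k else 0

theorem primrec_orderEnds : Primrec orderEnds :=
  Primrec.ite (primrecRel_ratOf_le.comp (Primrec.fst.comp Primrec.unpair)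
    (Primrec.snd.comp Primrec.unpair)) Primrec.id (Primrec.const 0)

theorem leftEnd_orderEnds_le (k : ℕ) : leftEnd (orderEnds k) ≤ rightEnd (orderEnds k) := by
  unfold orderEnds
  split_ifs with h
  · exact h
  · simp [leftEnd, rightEnd]

theorem openInterval_zero : openInterval 0 = ∅ := by
  simp [openInterval]

theorem openInterval_orderEnds (k : ℕ) : openInterval (orderEnds k) = openInterval k := by
  unfold orderEnds
  split_ifs with h
  · rfl
  · rw [openInterval_zero, openInterval, Set.Ioo_eq_empty]
    exact fun hlt => h (by exact_mod_cast hlt.le)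

theorem closedInterval_subset_orderEnds (k : ℕ) :
    closedInterval k ⊆ closedInterval (orderEnds k) := by
  unfold orderEnds
  split_ifs with h
  · rfl
  · rintro z ⟨h1, h2⟩
    exact absurd (by exact_mod_cast h1.trans h2) h

/-- The parts of the `p`-th open interval of a sequence outside the earlier ones. -/
def pieces (I : ℕ → ℕ) (p : ℕ) : List ℕ := cutList [I p] ((List.range p).map I)

/-- A sequence of non-overlapping closed intervals with the same union as a sequence of open
intervals, up to countably many points: `⟨p, i⟩` is the index of the `i`-th piece of the `p`-th
interval. -/
def piece (I : ℕ → ℕ) (q : ℕ) : ℕ := orderEnds ((pieces I q.unpair.1).getD q.unpair.2 0)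

theorem exists_getD_of_mem_openInterval {l : List ℕ} {i : ℕ} {z : ℝ}
    (h : z ∈ openInterval (l.getD i 0)) : ∃ hi : i < l.length, z ∈ openInterval l[i] := by
  rcases lt_or_ge i l.length with hi | hi
  · exact ⟨hi, by rwa [List.getD_eq_getElem _ _ hi] at h⟩
  · rw [List.getD_eq_default _ _ hi, openInterval_zero] at h
    exact h.elim

theorem mem_of_mem_piece {I : ℕ → ℕ} {q : ℕ} {z : ℝ} (h : z ∈ openInterval (piece I q)) :
    z ∈ openInterval (I q.unpair.1) ∧ ∀ p < q.unpair.1, z ∉ closedInterval (I p) := by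
  rw [piece, openInterval_orderEnds] at h
  obtain ⟨hi, h⟩ := exists_getD_of_mem_openInterval h
  have := (openUnion_cutList _ _).subset (mem_openUnion.2 ⟨_, List.getElem_mem hi, h⟩)
  rw [Set.mem_sdiff, mem_openUnion, mem_closedUnion] at this
  simpa using this

theorem pairwise_disjoint_piece (I : ℕ → ℕ) :
    Pairwise fun q q' => Disjoint (openInterval (piece I q)) (openInterval (piece I q')) := by
  intro q q' hne
  rw [Set.disjoint_left]
  intro z h h'
  have h1 := mem_of_mem_piece h
  have h2 := mem_of_mem_piece h'
  rcases lt_trichotomy q.unpair.1 q'.unpair.1 with hlt | heq | hlt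
  · exact h2.2 _ hlt (openInterval_subset_closedInterval _ h1.1)
  · have hne' : q.unpair.2 ≠ q'.unpair.2 := fun e => hne (by
      rw [← Nat.pair_unpair q, ← Nat.pair_unpair q', heq, e])
    rw [piece, openInterval_orderEnds] at h h'
    rw [heq] at h
    obtain ⟨hi, h⟩ := exists_getD_of_mem_openInterval h
    obtain ⟨hi', h'⟩ := exists_getD_of_mem_openInterval h'
    have hp := List.pairwise_iff_getElem.1 (pairwise_disjoint_cutList
      ((List.range q'.unpair.1).map I) (List.pairwise_singleton _ (I q'.unpair.1)))
    rcases lt_or_gt_of_ne hne' with hlt | hlt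
    · exact Set.disjoint_left.1 (hp _ _ hi hi' hlt) h h'
    · exact Set.disjoint_left.1 (hp _ _ hi' hi hlt) h' h
  · exact h1.2 _ hlt (openInterval_subset_closedInterval _ h2.1)

theorem iUnion_openInterval_subset_piece (I : ℕ → ℕ) :
    ⋃ p, openInterval (I p) ⊆ ⋃ q, closedInterval (piece I q) := by
  classical
  intro z hz
  have hex := Set.mem_iUnion.1 hz
  have h1 : z ∈ closedUnion [I (Nat.find hex)] := mem_closedUnion.2
    ⟨_, List.mem_singleton_self _, openInterval_subset_closedInterval _ (Nat.find_spec hex)⟩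
  have h2 : z ∉ openUnion ((List.range (Nat.find hex)).map I) := by
    rw [mem_openUnion]
    rintro ⟨n, hn, hzn⟩
    obtain ⟨p, hp, rfl⟩ := List.mem_map.1 hn
    exact Nat.find_min hex (List.mem_range.1 hp) hzn
  obtain ⟨n, hn, hzn⟩ := mem_closedUnion.1 (closedUnion_diff_subset_cutList _ _ ⟨h1, h2⟩)
  obtain ⟨i, hi, rfl⟩ := List.getElem_of_mem hn
  refine Set.mem_iUnion.2 ⟨Nat.pair (Nat.find hex) i, closedInterval_subset_orderEnds _ ?_⟩
  rw [Nat.unpair_pair, pieces, List.getD_eq_getElem _ _ hi]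
  exact hzn

theorem volume_iUnion_openInterval (I : ℕ → ℕ) :
    volume (⋃ p, openInterval (I p)) = ∑' q, volume (openInterval (piece I q)) := by
  rw [← measure_iUnion (pairwise_disjoint_piece I) fun q => (isOpen_openInterval _).measurableSet]
  refine le_antisymm ?_ (measure_mono (Set.iUnion_subset fun q z hz =>
    Set.mem_iUnion.2 ⟨_, (mem_of_mem_piece hz).1⟩))
  have hc : (⋃ q, closedInterval (piece I q) \ openInterval (piece I q)).Countable :=
    Set.countable_iUnion fun q => closedInterval_diff_openInterval_countable _
  have hsub : ⋃ p, openInterval (I p) ⊆ (⋃ q, openInterval (piece I q)) ∪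
      ⋃ q, closedInterval (piece I q) \ openInterval (piece I q) := by
    refine (iUnion_openInterval_subset_piece I).trans fun z hz => ?_
    obtain ⟨q, hq⟩ := Set.mem_iUnion.1 hz
    by_cases h : z ∈ openInterval (piece I q)
    · exact Or.inl (Set.mem_iUnion.2 ⟨q, h⟩)
    · exact Or.inr (Set.mem_iUnion.2 ⟨q, hq, h⟩)
  refine (measure_mono hsub).trans ((measure_union_le _ _).trans ?_)
  rw [hc.measure_zero, add_zero]

theorem hasSum_length_piece {I : ℕ → ℕ} (h : volume (⋃ p, openInterval (I p)) ≠ ∞) :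
    HasSum (fun q => (rightEnd (piece I q) : ℝ) - leftEnd (piece I q))
      (volume (⋃ p, openInterval (I p))).toReal := by
  rw [volume_iUnion_openInterval] at h ⊢
  have := ENNReal.hasSum_toReal h
  rw [← ENNReal.tsum_toReal_eq fun q => ENNReal.ne_top_of_tsum_ne_top h q] at this
  refine this.congr_fun fun q => ?_
  have h0 : (leftEnd (piece I q) : ℝ) ≤ rightEnd (piece I q) := by
    exact_mod_cast leftEnd_orderEnds_le _
  rw [volume_openInterval, ENNReal.toReal_ofReal (sub_nonneg.2 h0)]

/-- The halting problem decides which pairs enumerate intervals into the sets of a Schnorr test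
relative to it, so the pieces of these intervals are computable in it. -/
theorem SchnorrIndex.exists_enumeration (S : SchnorrIndex) : ∃ I : ℕ → ℕ → ℕ,
    ComputableIn₂ {zeroJump} (fun n q => piece (I n) q) ∧
      ∀ n, ⋃ j, openInterval (I n j) = S.G n := by
  classical
  -- the default value `0` names an empty open interval
  let I : ℕ → ℕ → ℕ := fun n j => cond (decide (∀ v, S.Enumerates n j v)) j.unpair.1 0
  have hI : ComputableIn₂ {zeroJump} I := by
    have hR : PrimrecRel fun (a : ℕ × ℕ) v => S.Enumerates a.1 a.2 v :=
      primrecPred_enumerates (Primrec.const S) (Primrec.fst.comp Primrec.fst)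
        (Primrec.snd.comp Primrec.fst) Primrec.snd
    have hc : Primrec₂ fun (b : Bool) (k : ℕ) => cond b k 0 :=
      Primrec.cond Primrec.fst Primrec.snd (Primrec.const 0)
    have hk : ComputableIn {zeroJump} fun a : ℕ × ℕ => a.2.unpair.1 :=
      (Primrec.fst.comp (Primrec.unpair.comp Primrec.snd)).computableIn
    exact ComputableIn.comp (f := fun b : Bool × ℕ => cond b.1 b.2 0) hc.computableIn
      ((ComputableIn.decide_forall hR).pair hk)
  refine ⟨I, ?_, fun n => ?_⟩
  · have hp : Primrec fun a : ℕ × ℕ => a.2.unpair.1 :=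
      Primrec.fst.comp (Primrec.unpair.comp Primrec.snd)
    have hl : ComputableIn {zeroJump} fun a : ℕ × ℕ =>
        (List.range a.2.unpair.1).map fun j => I a.1 j :=
      ComputableIn.list_map_range hp.computableIn
        (ComputableIn₂.comp hI (Primrec.fst.comp Primrec.fst).computableIn ComputableIn.snd)
    have hc : Primrec fun b : (ℕ × List ℕ) × ℕ => cutList [b.1.1] b.1.2 :=
      primrec_cutList.comp (Primrec.list_cons.comp (Primrec.fst.comp Primrec.fst)
        (Primrec.const [])) (Primrec.snd.comp Primrec.fst)
    have hi : Primrec fun b : (ℕ × List ℕ) × ℕ => b.2.unpair.2 :=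
      Primrec.snd.comp (Primrec.unpair.comp Primrec.snd)
    have hout : Primrec fun b : (ℕ × List ℕ) × ℕ =>
        orderEnds ((cutList [b.1.1] b.1.2).getD b.2.unpair.2 0) :=
      primrec_orderEnds.comp ((Primrec.list_getD 0).comp hc hi)
    have hIp : ComputableIn {zeroJump} fun a : ℕ × ℕ => I a.1 a.2.unpair.1 :=
      ComputableIn₂.comp hI ComputableIn.fst hp.computableIn
    have harg : ComputableIn {zeroJump} fun a : ℕ × ℕ => ((I a.1 a.2.unpair.1,
        (List.range a.2.unpair.1).map fun j => I a.1 j), a.2) :=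
      (hIp.pair hl).pair ComputableIn.snd
    exact (ComputableIn.comp hout.computableIn harg).of_eq fun a => rfl
  · ext z
    rw [mem_G, Set.mem_iUnion]
    refine exists_congr fun e => ?_
    by_cases h : ∀ v, S.Enumerates n e v
    · simp only [I, h, implies_true, decide_true, cond_true, true_and]
    · simp only [I, h, decide_false, cond_false, openInterval_zero, false_and,
        Set.mem_empty_iff_false]

theorem AlmostEveryPseudoNumber.almostEveryRelComputable {P : ℝ → Prop}
    (h : AlmostEveryPseudoNumber P) : AlmostEveryRelComputable P := by
  obtain ⟨T, hT, hP⟩ := h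
  obtain ⟨F, -, hF⟩ := IntervalIndex.exists_toSchnorr
  obtain ⟨hS, hfail⟩ := hF T hT
  obtain ⟨I, hI, hG⟩ := (F T).exists_enumeration
  choose q hq1 hq2 using fun m => (hS m).2
  have hq : ComputableIn₂ {zeroJump} q := by
    have hc : RecursiveIn {zeroJump} fun x => (F T).2.eval zeroJump x :=
      RecursiveIn.iff_nat.2 (OracleCode.exists_code.2 ⟨_, rfl⟩)
    exact (hc.comp (g := fun a : ℕ × ℕ => Nat.pair a.1 a.2)
      Primrec₂.natPair.computableIn).of_eq_some fun a => Part.eq_some_iff.2 (hq1 a.1 a.2)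
  refine ⟨fun n => piece (I n), q, hI, hq, fun n i => leftEnd_orderEnds_le _,
    fun n => pairwise_disjoint_piece _, fun n => ⟨_, hasSum_length_piece ?_, ?_, ?_⟩, ?_⟩
  · rw [hG]
    exact hS.volume_ne_top
  · rw [hG]
    exact hq2 n
  · rw [hG, ← toReal_inv_two_pow]
    exact ENNReal.toReal_mono (ENNReal.pow_lt_top (by simp)).ne (hS n).1
  · rintro z hz ⟨n, hn⟩
    refine hP z hz fun hz' => ?_
    have h1 := iUnion_openInterval_subset_piece (I n) ((hG n).symm.subset ((hfail z).1 hz' n))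
    obtain ⟨i, hi⟩ := Set.mem_iUnion.1 h1
    exact hn i hi

/-! ### Covering a sequence of closed intervals by interval sequence tests -/

theorem volume_openUnion_map_range_le (k : ℕ) (I : ℕ → ℕ) :
    volume (openUnion ((List.range k).map I)) ≤
      ∑ i ∈ Finset.range k, volume (openInterval (I i)) := by
  have e : openUnion ((List.range k).map I) = ⋃ i ∈ Finset.range k, openInterval (I i) := by
    ext z
    simp [mem_openUnion]
  rw [e]
  exact measure_biUnion_finset_le _ _

theorem volume_openInterval_enlarge {e n : ℕ} (hn : leftEnd n ≤ rightEnd n) (he : 0 ≤ ratOf e) :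
    volume (openInterval (enlarge e n)) =
      ENNReal.ofReal ((rightEnd n : ℝ) - leftEnd n) + ENNReal.ofReal (2 * ratOf e) := by
  have h1 : (0 : ℝ) ≤ (rightEnd n : ℝ) - leftEnd n := sub_nonneg.2 (by exact_mod_cast hn)
  have h2 : (0 : ℝ) ≤ 2 * ratOf e := by exact_mod_cast mul_nonneg zero_le_two he
  rw [volume_openInterval, leftEnd_enlarge, rightEnd_enlarge, ← ENNReal.ofReal_add h1 h2]
  push_cast
  congr 1
  ring

theorem closedInterval_subset_enlarge {e n : ℕ} (he : 0 < ratOf e) :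
    closedInterval n ⊆ openInterval (enlarge e n) := by
  intro z hz
  have he' : (0 : ℝ) < ratOf e := by exact_mod_cast he
  rw [mem_closedInterval] at hz
  rw [mem_openInterval, leftEnd_enlarge, rightEnd_enlarge]
  push_cast
  exact ⟨by linarith [hz.1], by linarith [hz.2]⟩

/-- The open neighbourhoods of radius `2 ^ (-(c + i + 2))` of the intervals `I i` for
`M ≤ i < N`. -/
def neighbourhoods (I : ℕ → ℕ) (c M N : ℕ) : List ℕ :=
  (List.range (N - M)).map fun i => enlarge (ratHalfPow (c + (M + i) + 2)) (I (M + i))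

theorem mem_neighbourhoods {I : ℕ → ℕ} {c M N i : ℕ} (hM : M ≤ i) (hN : i < N) {z : ℝ}
    (hz : z ∈ closedInterval (I i)) : z ∈ openUnion (neighbourhoods I c M N) := by
  obtain ⟨k, rfl⟩ := Nat.exists_eq_add_of_le hM
  refine mem_openUnion.2 ⟨_, List.mem_map.2 ⟨k, List.mem_range.2 (by omega), rfl⟩,
    closedInterval_subset_enlarge ?_ hz⟩
  rw [ratOf_ratHalfPow]
  positivity

theorem volume_neighbourhoods_le {I : ℕ → ℕ} (hI : ∀ i, leftEnd (I i) ≤ rightEnd (I i)) {s : ℝ}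
    (hs : HasSum (fun i => (rightEnd (I i) : ℝ) - leftEnd (I i)) s) (c M N : ℕ) :
    volume (openUnion (neighbourhoods I c M N)) ≤
      ENNReal.ofReal (s - ∑ i ∈ Finset.range M, ((rightEnd (I i) : ℝ) - leftEnd (I i))) +
        2⁻¹ ^ c := by
  have h0 : ∀ i, (0 : ℝ) ≤ (rightEnd (I i) : ℝ) - leftEnd (I i) := fun i =>
    sub_nonneg.2 (by exact_mod_cast hI i)
  have hvol : ∀ i, volume (openInterval (enlarge (ratHalfPow (c + (M + i) + 2)) (I (M + i)))) ≤
      ENNReal.ofReal ((rightEnd (I (M + i)) : ℝ) - leftEnd (I (M + i))) +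
        2⁻¹ ^ (c + (i + 1)) := fun i => by
    rw [volume_openInterval_enlarge (hI _) (by rw [ratOf_ratHalfPow]; positivity),
      ratOf_ratHalfPow, ← ofReal_half_pow]
    refine add_le_add le_rfl (ENNReal.ofReal_le_ofReal ?_)
    have : ((1 : ℝ) / 2) ^ (c + (M + i) + 1) ≤ (1 / 2) ^ (c + (i + 1)) :=
      pow_le_pow_of_le_one (by norm_num) (by norm_num) (by omega)
    push_cast
    rw [pow_succ]
    linarith
  refine (volume_openUnion_map_range_le _ _).trans ((Finset.sum_le_sum fun i _ => hvol i).trans ?_)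
  rw [Finset.sum_add_distrib, ← ENNReal.ofReal_sum_of_nonneg fun i _ => h0 _]
  refine add_le_add (ENNReal.ofReal_le_ofReal ?_)
    ((ENNReal.sum_le_tsum _).trans (tsum_inv_two_pow c).le)
  rw [le_sub_iff_add_le', ← Finset.sum_range_add]
  exact sum_le_hasSum _ (fun i _ => h0 i) hs

/-- If the lengths of a sequence of intervals have a sum that the halting problem computes, then it
also computes how many intervals have to be removed to make the remaining sum small. -/
theorem exists_tail_bound {H L : ℕ → ℕ → ℕ} (hH : ComputableIn₂ {zeroJump} H)
    (hL : ComputableIn₂ {zeroJump} L) (hle : ∀ n i, leftEnd (H n i) ≤ rightEnd (H n i))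
    {s : ℕ → ℝ} (hs : ∀ n, HasSum (fun i => (rightEnd (H n i) : ℝ) - leftEnd (H n i)) (s n))
    (hc : ∀ n, IsCauchyName (L n) (s n)) :
    ∃ N : ℕ → ℕ → ℕ, ComputableIn₂ {zeroJump} N ∧ ∀ n j, j ≤ N n j ∧
      s n - ∑ i ∈ Finset.range (N n j), ((rightEnd (H n i) : ℝ) - leftEnd (H n i)) ≤
        (1 / 2) ^ j := by
  classical
  have hlen : ∀ n i, ratOf (lengthName (H n i)) = rightEnd (H n i) - leftEnd (H n i) :=
      fun n i => by
    rw [ratOf_lengthName, max_eq_left (sub_nonneg.2 (hle n i))]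
  let A : ℕ → ℕ → ℕ := fun n k => ratSum ((List.range k).map fun i => lengthName (H n i))
  have hA : ∀ n k, (ratOf (A n k) : ℝ) =
      ∑ i ∈ Finset.range k, ((rightEnd (H n i) : ℝ) - leftEnd (H n i)) := fun n k => by
    simp only [A, ratOf_ratSum, List.map_map]
    induction k with
    | zero => simp
    | succ k ih =>
      rw [List.range_succ, List.map_append, List.sum_append, Finset.sum_range_succ, ← ih]
      simp [hlen]
  -- the search accepts `k` if the `k`-th partial sum is close to the approximation of the sum
  let p : ℕ × ℕ → ℕ → Bool := fun a k => decide (a.2 ≤ k ∧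
    ratOf (L a.1 (a.2 + 2)) ≤ ratOf (ratAdd (A a.1 k) (ratHalfPow (a.2 + 1))))
  have hp : ComputableIn₂ {zeroJump} p := by
    have hsum : ComputableIn {zeroJump} fun b : (ℕ × ℕ) × ℕ => A b.1.1 b.2 := by
      have h1 : ComputableIn₂ {zeroJump} fun (b : (ℕ × ℕ) × ℕ) (i : ℕ) =>
          lengthName (H b.1.1 i) :=
        ComputableIn.comp primrec_lengthName.computableIn (ComputableIn₂.comp hH
          (Primrec.fst.comp (Primrec.fst.comp Primrec.fst)).computableIn ComputableIn.snd)
      exact ComputableIn.comp primrec_ratSum.computableIn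
        (ComputableIn.list_map_range ComputableIn.snd h1)
    have hap : ComputableIn {zeroJump} fun b : (ℕ × ℕ) × ℕ => L b.1.1 (b.1.2 + 2) :=
      ComputableIn₂.comp hL (Primrec.fst.comp Primrec.fst).computableIn
        (Primrec.succ.comp (Primrec.succ.comp (Primrec.snd.comp Primrec.fst))).computableIn
    have hout : PrimrecPred fun c : ((ℕ × ℕ) × ℕ) × ℕ × ℕ => c.1.1.2 ≤ c.1.2 ∧
        ratOf c.2.1 ≤ ratOf (ratAdd c.2.2 (ratHalfPow (c.1.1.2 + 1))) := by
      have hj : Primrec fun c : ((ℕ × ℕ) × ℕ) × ℕ × ℕ => c.1.1.2 :=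
        Primrec.snd.comp (Primrec.fst.comp Primrec.fst)
      exact (Primrec.nat_le.comp hj (Primrec.snd.comp Primrec.fst)).and
        (primrecRel_ratOf_le.comp (Primrec.fst.comp Primrec.snd)
          (primrec_ratAdd.comp (Primrec.snd.comp Primrec.snd)
            (primrec_ratHalfPow.comp (Primrec.succ.comp hj))))
    have harg : ComputableIn {zeroJump} fun b : (ℕ × ℕ) × ℕ =>
        (b, L b.1.1 (b.1.2 + 2), A b.1.1 b.2) := ComputableIn.id.pair (hap.pair hsum)
    exact (ComputableIn.comp hout.decide.computableIn harg).of_eq fun b => rfl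
  have hdom : ∀ a, (Nat.rfind fun k => Part.some (p a k)).Dom := fun a => by
    have ht := (hs a.1).tendsto_sum_nat.eventually (lt_mem_nhds (show
      s a.1 - (1 / 2) ^ (a.2 + 2) < s a.1 from sub_lt_self _ (by positivity)))
    obtain ⟨k, hk, hjk⟩ := (ht.and (eventually_ge_atTop a.2)).exists
    refine Nat.rfind_dom.2 ⟨k, ?_, fun _ => trivial⟩
    rw [Part.mem_some_iff, eq_comm]
    refine decide_eq_true ⟨hjk, ?_⟩
    have h1 := (abs_le.1 ((hc a.1).abs_sub_le (a.2 + 2))).2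
    have h2 : ((1 : ℝ) / 2) ^ (a.2 + 1) = (1 / 2) ^ (a.2 + 2) + (1 / 2) ^ (a.2 + 2) := by ring
    rw [ratOf_ratAdd, ratOf_ratHalfPow, ← Rat.cast_le (K := ℝ)]
    push_cast
    rw [hA]
    linarith
  refine ⟨fun n j => (Nat.rfind fun k => Part.some (p (n, j) k)).get (hdom (n, j)),
    (RecursiveIn.rfind hp).of_eq_some fun a => (Part.some_get (hdom a)).symm, fun n j => ?_⟩
  have hspec := Nat.rfind_spec (Part.get_mem (hdom (n, j)))
  rw [Part.mem_some_iff, eq_comm] at hspec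
  obtain ⟨h1, h2⟩ := of_decide_eq_true hspec
  refine ⟨h1, ?_⟩
  rw [ratOf_ratAdd, ratOf_ratHalfPow, ← Rat.cast_le (K := ℝ)] at h2
  push_cast at h2
  rw [hA] at h2
  have h3 := (abs_le.1 ((hc n).abs_sub_le (j + 2))).1
  have h4 : ((1 : ℝ) / 2) ^ (j + 1) = (1 / 2) ^ j * (1 / 2) := by ring
  have h5 : ((1 : ℝ) / 2) ^ (j + 2) = (1 / 2) ^ j * (1 / 4) := by ring
  have h6 : (0 : ℝ) < (1 / 2) ^ j := by positivity
  simp only at h2 ⊢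
  linarith

theorem AlmostEveryRelComputable.almostEveryPseudoNumber {P : ℝ → Prop}
    (h : AlmostEveryRelComputable P) : AlmostEveryPseudoNumber P := by
  obtain ⟨H, L, hH, hL, hle, -, hsum, hP⟩ := h
  choose s hs hc hs2 using hsum
  obtain ⟨N, hN, hNj⟩ := exists_tail_bound hH hL hle hs hc
  -- the `r`-th list consists of the intervals between the tails with numbers `r - 1` and `r`; the
  -- first tail is the whole sequence
  let M : ℕ → ℕ → ℕ := fun m r => if r ≤ 1 then 0 else N (m + 2) (m + r + 1)
  let l : ℕ → ℕ → List ℕ := fun m r =>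
    neighbourhoods (H (m + 2)) (m + r + 1) (M m r) (N (m + 2) (m + r + 2))
  have hl : ComputableIn {zeroJump} fun a : Unit × ℕ × ℕ => l a.2.1 a.2.2 := by
    have hm : Primrec fun a : Unit × ℕ × ℕ => a.2.1 := Primrec.fst.comp Primrec.snd
    have hr : Primrec fun a : Unit × ℕ × ℕ => a.2.2 := Primrec.snd.comp Primrec.snd
    have hm2 : Primrec fun a : Unit × ℕ × ℕ => a.2.1 + 2 := Primrec.succ.comp (Primrec.succ.comp hm)
    have hc : Primrec fun a : Unit × ℕ × ℕ => a.2.1 + a.2.2 + 1 :=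
      Primrec.succ.comp (Primrec.nat_add.comp hm hr)
    have hN1 : ComputableIn {zeroJump} fun a : Unit × ℕ × ℕ => N (a.2.1 + 2) (a.2.1 + a.2.2 + 1) :=
      ComputableIn₂.comp hN hm2.computableIn hc.computableIn
    have hN2 : ComputableIn {zeroJump} fun a : Unit × ℕ × ℕ => N (a.2.1 + 2) (a.2.1 + a.2.2 + 2) :=
      ComputableIn₂.comp hN hm2.computableIn (Primrec.succ.comp hc).computableIn
    have hM : ComputableIn {zeroJump} fun a : Unit × ℕ × ℕ => M a.2.1 a.2.2 := by
      have hout : Primrec fun b : ℕ × ℕ => if b.1 ≤ 1 then 0 else b.2 :=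
        Primrec.ite (Primrec.nat_le.comp Primrec.fst (Primrec.const 1)) (Primrec.const 0)
          Primrec.snd
      have harg : ComputableIn {zeroJump} fun a : Unit × ℕ × ℕ =>
          (a.2.2, N (a.2.1 + 2) (a.2.1 + a.2.2 + 1)) := hr.computableIn.pair hN1
      exact (ComputableIn.comp hout.computableIn harg).of_eq fun a => rfl
    have hlen : ComputableIn {zeroJump} fun a : Unit × ℕ × ℕ =>
        N (a.2.1 + 2) (a.2.1 + a.2.2 + 2) - M a.2.1 a.2.2 :=
      (ComputableIn.comp Primrec.nat_sub.computableIn (hN2.pair hM)).of_eq fun a => rfl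
    have hi : ComputableIn {zeroJump} fun b : (Unit × ℕ × ℕ) × ℕ => M b.1.2.1 b.1.2.2 + b.2 := by
      have harg : ComputableIn {zeroJump} fun b : (Unit × ℕ × ℕ) × ℕ =>
          (M b.1.2.1 b.1.2.2, b.2) :=
        (hM.comp (g := fun b : (Unit × ℕ × ℕ) × ℕ => b.1) ComputableIn.fst).pair ComputableIn.snd
      exact (ComputableIn.comp Primrec.nat_add.computableIn harg).of_eq fun b => rfl
    have hHi : ComputableIn {zeroJump} fun b : (Unit × ℕ × ℕ) × ℕ =>
        H (b.1.2.1 + 2) (M b.1.2.1 b.1.2.2 + b.2) :=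
      ComputableIn₂.comp hH (hm2.comp Primrec.fst).computableIn hi
    have hout : Primrec fun b : ℕ × ℕ × ℕ => enlarge (ratHalfPow (b.1 + b.2.1 + 2)) b.2.2 :=
      primrec_enlarge.comp (primrec_ratHalfPow.comp (Primrec.succ.comp (Primrec.succ.comp
        (Primrec.nat_add.comp Primrec.fst (Primrec.fst.comp Primrec.snd)))))
        (Primrec.snd.comp Primrec.snd)
    have hg : ComputableIn₂ {zeroJump} fun (a : Unit × ℕ × ℕ) (i : ℕ) =>
        enlarge (ratHalfPow (a.2.1 + a.2.2 + 1 + (M a.2.1 a.2.2 + i) + 2))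
          (H (a.2.1 + 2) (M a.2.1 a.2.2 + i)) := by
      have harg : ComputableIn {zeroJump} fun b : (Unit × ℕ × ℕ) × ℕ => (b.1.2.1 + b.1.2.2 + 1,
          M b.1.2.1 b.1.2.2 + b.2, H (b.1.2.1 + 2) (M b.1.2.1 b.1.2.2 + b.2)) :=
        (hc.comp Primrec.fst).computableIn.pair (hi.pair hHi)
      exact (ComputableIn.comp hout.computableIn harg).of_eq fun b => rfl
    exact ComputableIn.list_map_range hlen hg
  obtain ⟨F, -, hF⟩ := exists_test_of_recursiveIn
    (f := fun a : Unit × ℕ × ℕ => Part.some (l a.2.1 a.2.2)) hl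
  have hvol : ∀ m r, 0 < m → 0 < r → volume (openUnion (l m r)) ≤ 2⁻¹ ^ (m + r) := by
    intro m r hm hr
    refine (volume_neighbourhoods_le (hle _) (hs _) _ _ _).trans ?_
    have htail : s (m + 2) - ∑ i ∈ Finset.range (M m r),
        ((rightEnd (H (m + 2) i) : ℝ) - leftEnd (H (m + 2) i)) ≤ (1 / 2) ^ (m + r + 1) := by
      simp only [M]
      split_ifs with h1
      · obtain rfl : r = 1 := by omega
        simpa using hs2 (m + 2)
      · exact (hNj _ _).2
    refine (add_le_add (ENNReal.ofReal_le_ofReal htail) le_rfl).trans ?_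
    rw [ofReal_half_pow, pow_succ, ← mul_add, ENNReal.inv_two_add_inv_two, mul_one]
  obtain ⟨hT, hfail⟩ := hF () l fun m r hm hr => ⟨Part.mem_some _, hvol m r hm hr⟩
  refine ⟨F (), hT, fun z hz hz' => hP z hz ?_⟩
  rw [hfail] at hz'
  push Not at hz'
  obtain ⟨m, -, hm⟩ := hz'
  refine ⟨m + 2, fun i hi => ?_⟩
  classical
  have hex : ∃ r, 0 < r ∧ i < N (m + 2) (m + r + 2) :=
    ⟨i + 1, i.succ_pos, lt_of_lt_of_le (by omega) (hNj _ _).1⟩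
  obtain ⟨hr, hlt⟩ := Nat.find_spec hex
  refine hm _ hr (mem_neighbourhoods ?_ hlt hi)
  simp only [M]
  split_ifs with h1
  · exact Nat.zero_le _
  · have h2 := Nat.find_min hex (m := Nat.find hex - 1) (by omega)
    rw [not_and, not_lt] at h2
    have h3 := h2 (by omega)
    rwa [show m + (Nat.find hex - 1) + 2 = m + Nat.find hex + 1 by omega] at h3

theorem mainTheorem1 :
    (∃ F : IntervalIndex → SchnorrIndex, Computable F ∧
      ∀ T : IntervalIndex, T.IsTest → (F T).IsTest ∧ ∀ z : ℝ, T.Fails z ↔ (F T).Fails z) ∧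
    (∃ F : SchnorrIndex → IntervalIndex, Computable F ∧
      ∀ T : SchnorrIndex, T.IsTest → (F T).IsTest ∧ ∀ z : ℝ, T.Fails z ↔ (F T).Fails z) ∧
    (∀ P : ℝ → Prop, AlmostEveryPseudoNumber P ↔ AlmostEveryRelComputable P) :=
  ⟨IntervalIndex.exists_toSchnorr, SchnorrIndex.exists_toInterval, fun _ =>
    ⟨AlmostEveryPseudoNumber.almostEveryRelComputable,
      AlmostEveryRelComputable.almostEveryPseudoNumber⟩⟩
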